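/- Let $p$ be a complex polynomial of degree at least $2$ and let $z$ be an attracting fixed point of $p$, i.e. $p(z)=z$ and $|p'(z)|<1$. Let $J_p$ be the Julia set of $p$ (the boundary of the set of points with bounded forward orbit), and let $\Omega$, the immediate basin of $z$, be the connected component of $\mathbb C\setminus J_p$ containing $z$. For a continuous map $f:X\to X$ and $U\subseteq X$, let $\hat U=\{(\dots,w_{-2},w_{-1},w_0): w_0\in U,\ f(w_{-i-1})=w_{-i}\in X \text{ for all } i\ge 0\}$ be the space of histories of points of $U$, with the topology induced from the product topology, and let $\hat f(\dots,w_{-1},w_0)=(\dots,w_{-1},w_0,f(w_0))$. For $f=p$ on $\mathbb C$, let $\hat{\hat\Omega}\subseteq\hat\Omega$ be the set of histories $(\dots,w_{-1},w_0)\in\hat\Omega$ such that for every $i\ge0$ the point $w_{-i}$ lies in the connected component of $p^{-i}(\Omega)$ containing $z$, and let $\underline z=(\dots,z,z)$. Then: 1. $\hat{\hat\Omega}$ is the connected component of $\hat\Omega$ containing $\underline z$. 2. $p$ maps $\Omega$ to itself with some degree $n\ge 2$: every point of $\Omega$ has exactly $n$ preimages under $p$ in $\Omega$, counted with multiplicity.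 3. With this $n$, let $p_0:\mathbb C\to\mathbb C$, $p_0(\zeta)=\zeta^n$, and let $\widehat{\mathbb D}$ be the space of histories under $p_0$ of points of the open unit disk $\mathbb D$. Then $\hat p$ maps $\hat{\hat\Omega}$ into itself, and there is a homeomorphism $\psi:\hat{\hat\Omega}\to\widehat{\mathbb D}$ with $\psi\circ\hat p=\hat p_0\circ\psi$. 4. $\hat{\hat\Omega}$ is homeomorphic to the open cone $(\Sigma_n\times[0,1))/(\Sigma_n\times\{0\})$ over the solenoid $\Sigma_n=\varprojlim(S^1,s\mapsto s^n)$, by a homeomorphism which takes the cone point to $\underline z$. 5. No neighborhood of $\underline z$ in $\hat{\hat\Omega}$ admits the structure of a Riemann surface lamination, that is, of a Hausdorff space locally isomorphic to a product of a topological space with a Riemann surface (it has an atlas of charts to open subsets of products $T\times\mathbb C$, with $T$ a topological space, whose coordinate changes are locally of the form $(t,\zeta)\mapsto(\tau(t),h(t,\zeta))$ with $h$ holomorphic in $\zeta$). -/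

import Mathlib

open Polynomial Topology

noncomputable section

/-- The filled Julia set `K_p`: the points with bounded forward orbit under `p`. -/
def filledJuliaSet (p : ℂ[X]) : Set ℂ :=
  {x | Bornology.IsBounded (Set.range fun k : ℕ => (fun y => p.eval y)^[k] x)}

/-- The Julia set `J_p = ∂K_p`. -/
def juliaSet (p : ℂ[X]) : Set ℂ := frontier (filledJuliaSet p)

/-- The immediate basin `Ω` of an attracting fixed point `z`:
the connected component of `ℂ - J_p` that contains `z`. -/
def immediateBasin (p : ℂ[X]) (z : ℂ) : Set ℂ := connectedComponentIn (juliaSet p)ᶜ z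

/-- The number of solutions in `U` of `p(x) = w`, counted with multiplicity (for nonconstant `p`). -/
def preimageCount (p : ℂ[X]) (U : Set ℂ) (w : ℂ) : ℕ := by
  classical
  exact Multiset.countP (fun x => x ∈ U) (p - C w).roots

/-- `p` maps `U` to itself with degree `n`: every point of `U` has exactly `n` preimages in `U`,
counted with multiplicity. -/
def HasDegreeOn (p : ℂ[X]) (U : Set ℂ) (n : ℕ) : Prop :=
  Set.MapsTo (fun x => p.eval x) U U ∧ ∀ w ∈ U, preimageCount p U w = n

/-- The projective limit `lim (X ← X ← ⋯)` of `f : X → X`, i.e. the set of histories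
`(…, w₋₂, w₋₁, w₀)` with `f w₋ᵢ₋₁ = w₋ᵢ`; here `w i` stands for `w₋ᵢ`.
It carries the topology induced by the product topology. -/
def historySpace {X : Type*} (f : X → X) : Set (ℕ → X) := {w | ∀ i, f (w (i + 1)) = w i}

/-- The map induced by `f` on histories: `(…, w₋₁, w₀) ↦ (…, w₋₁, w₀, f w₀)`. -/
def historyMap {X : Type*} (f : X → X) (w : ℕ → X) : ℕ → X
  | 0 => f (w 0)
  | i + 1 => w i

/-- The histories of the points of `U`, i.e. the part of the history space above `U`. -/
def historiesOver {X : Type*} (f : X → X) (U : Set X) : Set (ℕ → X) :=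
  {w | w ∈ historySpace f ∧ w 0 ∈ U}

/-- The distinguished component `(…, [z], [z])` of the space of histories of points of the immediate
basin `Ω` of `z`: the histories such that, for every `i`, the point `w₋ᵢ` lies in the connected
component of `p^{-i}(Ω)` that contains `z`. -/
def distinguishedComponent (p : ℂ[X]) (z : ℂ) : Set (ℕ → ℂ) :=
  {w | w ∈ historiesOver (fun x => p.eval x) (immediateBasin p z) ∧
    ∀ i : ℕ, w i ∈
      connectedComponentIn ((fun x => p.eval x)^[i] ⁻¹' immediateBasin p z) z}

/-- The histories of the points of the open unit disk under `ζ ↦ ζ ^ n`. -/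
def diskHistories (n : ℕ) : Set (ℕ → ℂ) :=
  historiesOver (fun ζ : ℂ => ζ ^ n) (Metric.ball 0 1)

/-- The `n`-adic solenoid, the projective limit of the circle under `s ↦ s ^ n`. -/
def solenoid (n : ℕ) : Set (ℕ → Circle) := historySpace fun s : Circle => s ^ n

/-- The relation on `S × [0, 1)` which collapses `S × {0}` to one point. -/
def coneSetoid (S : Type*) : Setoid (S × Set.Ico (0 : ℝ) 1) where
  r a b := a = b ∨ ((a.2 : ℝ) = 0 ∧ (b.2 : ℝ) = 0)
  iseqv := by
    refine ⟨fun a => Or.inl rfl, ?_, ?_⟩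
    · rintro a b (h | ⟨h, h'⟩)
      · exact Or.inl h.symm
      · exact Or.inr ⟨h', h⟩
    · rintro a b c (rfl | ⟨h, h'⟩) hbc
      · exact hbc
      · rcases hbc with rfl | ⟨_, h''⟩
        · exact Or.inr ⟨h, h'⟩
        · exact Or.inr ⟨h, h''⟩

/-- The (open) cone over `S`: the space `S × [0, 1)` with `S × {0}` collapsed to one point,
with the quotient topology. -/
abbrev OpenCone (S : Type*) : Type _ := Quotient (coneSetoid S)

/-- The class in the cone over `S` of the pair `(s, 0)`. All these classes coincide: they are the
cone point. -/
def OpenCone.apex {S : Type*} (s : S) : OpenCone S :=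
  Quotient.mk (coneSetoid S) (s, ⟨0, le_refl 0, zero_lt_one⟩)

/-- A chart of a lamination by surfaces: a homeomorphism of an open subset of `X` onto an open
subset of the product of a topological space with `ℂ`. -/
structure LaminationChart.{u} (X : Type u) [TopologicalSpace X] where
  transversal : Type u
  [top : TopologicalSpace transversal]
  chart : OpenPartialHomeomorph X (transversal × ℂ)

attribute [instance] LaminationChart.top

/-- The change of charts from `c` to `d` is locally of the form `(t, ζ) ↦ (τ(t), h(t, ζ))` with
`h(t, ζ)` holomorphic in `ζ`, i.e. it is locally an isomorphism of products of a topological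
space with a Riemann surface. -/
def LaminationChart.Compatible.{u} {X : Type u} [TopologicalSpace X]
    (c d : LaminationChart X) : Prop :=
  ∀ q ∈ (c.chart.symm.trans d.chart).source, ∃ N : Set (c.transversal × ℂ),
    IsOpen N ∧ q ∈ N ∧ N ⊆ (c.chart.symm.trans d.chart).source ∧
    (∀ q₁ ∈ N, ∀ q₂ ∈ N, q₁.1 = q₂.1 →
      (d.chart (c.chart.symm q₁)).1 = (d.chart (c.chart.symm q₂)).1) ∧
    ∀ t : c.transversal,
      DifferentiableOn ℂ (fun ζ : ℂ => (d.chart (c.chart.symm (t, ζ))).2) {ζ | (t, ζ) ∈ N}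

/-- `X` admits the structure of a Riemann surface lamination: it is Hausdorff, and it has an atlas
which makes it locally isomorphic to a product of a topological space with a Riemann surface. -/
def IsRiemannSurfaceLamination.{u} (X : Type u) [TopologicalSpace X] : Prop :=
  T2Space X ∧ ∃ A : Set (LaminationChart X),
    (∀ x : X, ∃ c ∈ A, x ∈ c.chart.source) ∧ ∀ c ∈ A, ∀ d ∈ A, c.Compatible d

end

/-! The interior of the filled Julia set is completely invariant under `p`, so the component of
`p^{-i}(Ω)` containing `z` is `Ω` itself, and the distinguished component consists of the histories
all of whose points lie in `Ω`.

The maximum principle, applied to the iterates of `p`, shows that `Ω` has no holes. Runge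
approximation then gives primitives and square roots on `Ω`, and Koebe's extremal argument gives a
Riemann map `ξ` with `ξ z = 0` (`exists_riemannMap`). Since `p` is proper on `Ω`, the map `ξ ∘ p ∘
ξ⁻¹` is a finite Blaschke product `B` with `B 0 = 0` (`IsRiemannMap.exists_blaschkeProduct`). Its
degree `n` is at least 2, because a rotation attracts nothing, and counting the roots of `B = ξ w`
identifies `n` with the degree of `p` on `Ω`.

On the whole disk `B` need not be conjugate to `ζ ↦ ζ ^ n`, but histories only see the dynamics near
the circle: going back in time, every history except the constant one enters any given annulus near
the circle. Through `ζ = exp (-x)`, `B` lifts near the circle to a map `P` of a strip whose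
derivative has real part greater than 1. It extends to a homeomorphism `φ` of the plane which is
multiplication by `n` far to the right (`IsStripLift.exists_isStripExtension`), and `n ^ (-k) φ^k`
becomes constant in `k` at each point of the right half-plane; its eventual value linearizes `φ`
(`IsStripExtension.exists_isLinearization`). Descending to the punctured disk, `B` is conjugate to
the power map near the circle. `IsConjOn.homeomorph` turns this into a conjugacy of histories: go
back far enough, apply the conjugacy, and come forward again with the other map.

A history of the power map in the disk has polar coordinates: a point of the solenoid and the
modulus of its last point. This gives the open cone and, by shrinking the modulus, connectedness.
The cone point has arbitrarily small connected neighborhoods, while no other point has them, since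
nearby histories are told apart by roots of unity. In a lamination chart, translation along the leaf
would carry this property from the cone point to other nearby points, which is impossible. -/

noncomputable section

/-! ### Green's formula and the Cauchy–Pompeiu formula -/

open MeasureTheory Complex

/-- Twice the Wirtinger derivative `∂/∂ζ̄`. -/
def dbar (u : ℂ → ℂ) (ζ : ℂ) : ℂ := fderiv ℝ u ζ 1 + I * fderiv ℝ u ζ I

theorem dbar_mul {u v : ℂ → ℂ} {ζ : ℂ} (hu : DifferentiableAt ℝ u ζ)
    (hv : DifferentiableAt ℝ v ζ) :
    dbar (fun x => u x * v x) ζ = dbar u ζ * v ζ + u ζ * dbar v ζ := by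
  simp only [dbar, fderiv_fun_mul hu hv]
  simp
  ring

theorem dbar_eq_zero_of_differentiableAt {v : ℂ → ℂ} {ζ : ℂ} (hv : DifferentiableAt ℂ v ζ) :
    dbar v ζ = 0 := by
  have h := hv.hasDerivAt.hasFDerivAt.restrictScalars ℝ
  simp only [dbar, h.fderiv]
  simp
  linear_combination (deriv v ζ) * I_mul_I

theorem Filter.EventuallyEq.dbar_eq {u v : ℂ → ℂ} {ζ : ℂ} (h : u =ᶠ[𝓝 ζ] v) :
    dbar u ζ = dbar v ζ := by
  simp [dbar, h.fderiv_eq]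

theorem continuous_dbar {u : ℂ → ℂ} (hu : ContDiff ℝ 1 u) : Continuous (dbar u) := by
  have := hu.continuous_fderiv one_ne_zero
  unfold dbar
  fun_prop

theorem support_dbar_subset (u : ℂ → ℂ) : Function.support (dbar u) ⊆ tsupport u := by
  intro x hx
  by_contra h
  apply hx
  have h0 : u =ᶠ[𝓝 x] fun _ => 0 := notMem_tsupport_iff_eventuallyEq.mp h
  rw [h0.dbar_eq]
  simp [dbar]

/-- Integration by parts against the constant 1 kills each directional derivative of a compactly
supported function. -/
theorem integral_dbar_eq_zero {G : ℂ → ℂ} (hG : ContDiff ℝ 1 G) (hc : HasCompactSupport G) :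
    ∫ ζ, dbar G ζ = 0 := by
  have hcont := hG.continuous_fderiv one_ne_zero
  have key : ∀ v : ℂ, Integrable (fun ζ => fderiv ℝ G ζ v) ∧ ∫ ζ, fderiv ℝ G ζ v = 0 := by
    intro v
    have hi : Integrable (fun ζ => fderiv ℝ G ζ v) :=
      (by fun_prop : Continuous fun ζ => fderiv ℝ G ζ v).integrable_of_hasCompactSupport
        (hc.fderiv_apply ℝ v)
    refine ⟨hi, ?_⟩
    have h := integral_mul_fderiv_eq_neg_fderiv_mul_of_integrable (μ := volume)
      (f := fun _ : ℂ => (1 : ℂ)) (g := G) (v := v) (by simp) (by simpa using hi)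
      (by simpa using hG.continuous.integrable_of_hasCompactSupport hc)
      (fun x _ => differentiableAt_const _)
      (fun x _ => hG.differentiable one_ne_zero x)
    simpa using h
  unfold dbar
  rw [integral_add (key 1).1 ((key I).1.const_mul I), integral_const_mul, (key 1).2, (key I).2]
  simp

/-- Green's formula: the integral of `∂u/∂ζ̄` against a function which is holomorphic
near the support of `u` vanishes. -/
theorem integral_dbar_mul_eq_zero {u : ℂ → ℂ} (hu : ContDiff ℝ 1 u) (hc : HasCompactSupport u)
    {V : Set ℂ} (hV : IsOpen V) (hs : tsupport u ⊆ V) {H : ℂ → ℂ} (hH : DifferentiableOn ℂ H V) :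
    ∫ ζ, dbar u ζ * H ζ = 0 := by
  have hHc : ContDiffOn ℝ 1 H V := (hH.contDiffOn hV).restrict_scalars ℝ
  have hG : ContDiff ℝ 1 (fun ζ => u ζ * H ζ) := by
    rw [contDiff_iff_contDiffAt]
    intro x
    by_cases hx : x ∈ tsupport u
    · exact hu.contDiffAt.mul (hHc.contDiffAt (hV.mem_nhds (hs hx)))
    · have h0 : (fun ζ => u ζ * H ζ) =ᶠ[𝓝 x] fun _ => 0 := by
        filter_upwards [notMem_tsupport_iff_eventuallyEq.mp hx] with y hy
        simp [hy]
      exact contDiffAt_const.congr_of_eventuallyEq h0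
  have h := integral_dbar_eq_zero hG hc.mul_right
  rw [← h]
  congr 1
  ext x
  by_cases hx : x ∈ tsupport u
  · have hd := hH.differentiableAt (hV.mem_nhds (hs hx))
    rw [dbar_mul (hu.differentiable one_ne_zero x) (hd.restrictScalars ℝ),
      dbar_eq_zero_of_differentiableAt hd]
    simp
  · have h0 : (fun ζ => u ζ * H ζ) =ᶠ[𝓝 x] fun _ => 0 := by
      filter_upwards [notMem_tsupport_iff_eventuallyEq.mp hx] with y hy
      simp [hy]
    have h1 : dbar u x = 0 := by
      by_contra h
      exact hx (support_dbar_subset u h)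
    rw [h0.dbar_eq, h1]
    simp [dbar]

/-- A radial cutoff function which is `1` on the unit disk. -/
def radialCutoff (ζ : ℂ) : ℂ := (Real.smoothTransition (2 - normSq ζ) : ℝ)

theorem normSq_hasFDerivAt (ζ : ℂ) :
    HasFDerivAt normSq ((2 * ζ.re) • reCLM + (2 * ζ.im) • imCLM) ζ := by
  have h1 : HasFDerivAt (fun x : ℂ => x.re * x.re + x.im * x.im)
      ((ζ.re • reCLM + ζ.re • reCLM) + (ζ.im • imCLM + ζ.im • imCLM)) ζ :=
    (reCLM.hasFDerivAt.mul reCLM.hasFDerivAt).add (imCLM.hasFDerivAt.mul imCLM.hasFDerivAt)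
  have h2 : (normSq : ℂ → ℝ) = fun x : ℂ => x.re * x.re + x.im * x.im := by
    ext x; exact normSq_apply x
  rw [h2]
  convert h1 using 1
  ext
  simp
  ring

theorem contDiff_radialCutoff : ContDiff ℝ 1 radialCutoff := by
  have h2 : (normSq : ℂ → ℝ) = fun x : ℂ => x.re * x.re + x.im * x.im := by
    ext x; exact normSq_apply x
  have h3 : ContDiff ℝ 1 (normSq : ℂ → ℝ) := by
    rw [h2]
    exact (reCLM.contDiff.mul reCLM.contDiff).add (imCLM.contDiff.mul imCLM.contDiff)
  have h4 : ContDiff ℝ 1 Real.smoothTransition := Real.smoothTransition.contDiff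
  exact ofRealCLM.contDiff.comp (h4.comp (contDiff_const.sub h3))

theorem hasCompactSupport_radialCutoff : HasCompactSupport radialCutoff := by
  apply HasCompactSupport.intro (isCompact_closedBall (0 : ℂ) 2)
  intro x hx
  simp only [Metric.mem_closedBall, dist_zero_right, not_le] at hx
  unfold radialCutoff
  rw [Real.smoothTransition.zero_of_nonpos, ofReal_zero]
  rw [normSq_eq_norm_sq]
  nlinarith

theorem radialCutoff_eq_one {ζ : ℂ} (h : ‖ζ‖ ≤ 1) : radialCutoff ζ = 1 := by
  unfold radialCutoff
  rw [Real.smoothTransition.one_of_one_le, ofReal_one]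
  rw [normSq_eq_norm_sq]
  nlinarith [norm_nonneg ζ]

theorem dbar_radialCutoff (ζ : ℂ) :
    dbar radialCutoff ζ = ((-2 * deriv Real.smoothTransition (2 - normSq ζ) : ℝ) : ℂ) * ζ := by
  have h4 : ContDiff ℝ 1 Real.smoothTransition := Real.smoothTransition.contDiff
  have h5 : HasDerivAt Real.smoothTransition _ (2 - normSq ζ) :=
    (h4.differentiable one_ne_zero _).hasDerivAt
  have h6 := h5.comp_hasFDerivAt (f := fun x : ℂ => 2 - normSq x) ζ
    ((normSq_hasFDerivAt ζ).const_sub 2)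
  have h7 : HasFDerivAt radialCutoff _ ζ := ofRealCLM.hasFDerivAt.comp ζ h6
  simp only [dbar, h7.fderiv]
  apply Complex.ext <;> (simp; ring)

/-- The cutoff is radial and decreasing in `‖ζ‖`, and the factor `ζ` in its `dbar` cancels `ζ⁻¹`, so
the integrand is real and nonpositive. Only the nonvanishing of this constant matters, not its
value. -/
theorem integral_dbar_radialCutoff_div_ne_zero :
    ∫ ζ, dbar radialCutoff ζ * ζ⁻¹ ≠ 0 := by
  have h4 : ContDiff ℝ 1 Real.smoothTransition := Real.smoothTransition.contDiff
  have h4d : Continuous (deriv Real.smoothTransition) := h4.continuous_deriv le_rfl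
  have hsupp : ∀ ζ : ℂ, ‖ζ‖ > 2 → deriv Real.smoothTransition (2 - normSq ζ) = 0 := by
    intro ζ hζ
    have : Real.smoothTransition =ᶠ[𝓝 (2 - normSq ζ)] fun _ => 0 := by
      have h0 : 2 - normSq ζ < 0 := by rw [normSq_eq_norm_sq]; nlinarith
      filter_upwards [Iio_mem_nhds h0] with x hx
      exact Real.smoothTransition.zero_of_nonpos (le_of_lt hx)
    rw [this.deriv_eq]
    simp
  have heq : ∀ ζ : ℂ, dbar radialCutoff ζ * ζ⁻¹ =
      ((-(2 * deriv Real.smoothTransition (2 - normSq ζ)) : ℝ) : ℂ) := by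
    intro ζ
    rw [dbar_radialCutoff]
    by_cases h : ζ = 0
    · subst h
      have : Real.smoothTransition =ᶠ[𝓝 (2 - normSq 0)] fun _ => 1 := by
        have h0 : (1 : ℝ) < 2 - normSq 0 := by simp
        filter_upwards [Ioi_mem_nhds h0] with x hx
        exact Real.smoothTransition.one_of_one_le (le_of_lt hx)
      rw [this.deriv_eq]
      simp
    · rw [mul_assoc, mul_inv_cancel₀ h]
      push_cast
      ring
  simp_rw [heq]
  rw [integral_complex_ofReal]
  norm_cast
  rw [integral_neg]
  apply ne_of_lt
  rw [neg_lt_zero]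
  -- The mean value theorem gives a point where the derivative equals 1; it is attained on the
  -- circle `‖ζ‖ ^ 2 = 2 - s`, so the integrand is not identically zero.
  obtain ⟨s, hs, hs'⟩ : ∃ s ∈ Set.Ioo (0 : ℝ) 1, deriv Real.smoothTransition s =
      (Real.smoothTransition 1 - Real.smoothTransition 0) / (1 - 0) :=
    exists_deriv_eq_slope _ zero_lt_one h4.continuous.continuousOn
      (h4.differentiable one_ne_zero).differentiableOn
  have hcont : Continuous fun a : ℂ => 2 * deriv Real.smoothTransition (2 - normSq a) := by
    have := continuous_normSq
    fun_prop
  refine hcont.integral_pos_of_hasCompactSupport_nonneg_nonzero (x := (Real.sqrt (2 - s) : ℂ))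
    ?_ ?_ ?_
  · apply HasCompactSupport.intro (isCompact_closedBall (0 : ℂ) 2)
    intro x hx
    simp only [Metric.mem_closedBall, dist_zero_right, not_le] at hx
    simp [hsupp x hx]
  · intro a
    have := Real.smoothTransition.monotone.deriv_nonneg (x := 2 - normSq a)
    simp only [Pi.zero_apply]
    linarith
  · rw [normSq_ofReal, Real.mul_self_sqrt (by linarith [hs.2])]
    simp [hs']

/-- **Cauchy-Pompeiu formula** with an unspecified constant. -/
theorem exists_cauchyPompeiu : ∃ c : ℂ, c ≠ 0 ∧
    ∀ {χ : ℂ → ℂ} {U : Set ℂ} {F : ℂ → ℂ} {w : ℂ}, ContDiff ℝ 1 χ → HasCompactSupport χ →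
      IsOpen U → tsupport χ ⊆ U → DifferentiableOn ℂ F U → w ∈ U → (∀ᶠ ζ in 𝓝 w, χ ζ = 1) →
      ∫ ζ, dbar χ ζ * F ζ * (ζ - w)⁻¹ = c * F w := by
  refine ⟨_, integral_dbar_radialCutoff_div_ne_zero, ?_⟩
  intro χ U F w hχ hχc hU hs hF hw h1
  have hd0 : ∀ᶠ ζ in 𝓝 w, dbar χ ζ = 0 := by
    filter_upwards [h1.eventually_nhds] with ζ hζ
    have : χ =ᶠ[𝓝 ζ] fun _ => 1 := hζ
    rw [this.dbar_eq]
    simp [dbar]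
  have hsupp : w ∉ tsupport (dbar χ) := by
    rw [notMem_tsupport_iff_eventuallyEq]
    exact hd0
  have hcs : HasCompactSupport (dbar χ) :=
    HasCompactSupport.of_support_subset_isCompact hχc (support_dbar_subset χ)
  -- integrability of `dbar χ` times continuous functions
  have hint : ∀ f : ℂ → ℂ, ContinuousOn f (tsupport (dbar χ)) →
      Integrable (fun ζ => dbar χ ζ * f ζ) := by
    intro f hf
    have hc : HasCompactSupport (fun ζ => dbar χ ζ * f ζ) := hcs.mul_right
    have hcont : ContinuousOn (fun ζ => dbar χ ζ * f ζ) (tsupport (dbar χ)) :=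
      (continuous_dbar hχ).continuousOn.mul hf
    have := hcont.integrableOn_compact (μ := volume) hcs
    rwa [integrableOn_iff_integrable_of_support_subset] at this
    intro x hx
    apply subset_tsupport
    intro h
    apply hx
    simp [h]
  have hinv : ContinuousOn (fun ζ : ℂ => (ζ - w)⁻¹) (tsupport (dbar χ)) := by
    apply ContinuousOn.inv₀ (by fun_prop)
    intro x hx h
    rw [sub_eq_zero] at h
    exact hsupp (h ▸ hx)
  have hFc : ContinuousOn F (tsupport (dbar χ)) :=
    hF.continuousOn.mono ((closure_minimal (support_dbar_subset χ) (isClosed_tsupport _)).trans hs)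
  -- The divided difference of `F` at `w` is holomorphic on `U`, so Green's formula annihilates it.
  -- Expanding it reduces the claim to the case `F = 1`; the expansion also holds at `ζ = w`,
  -- because `dbar χ` vanishes there.
  have e1 : ∫ ζ, dbar χ ζ * dslope F w ζ = 0 :=
    integral_dbar_mul_eq_zero hχ hχc hU hs
      ((differentiableOn_dslope (hU.mem_nhds hw)).mpr hF)
  have e2 : ∀ ζ, dbar χ ζ * dslope F w ζ =
      dbar χ ζ * F ζ * (ζ - w)⁻¹ - F w * (dbar χ ζ * (ζ - w)⁻¹) := by
    intro ζ
    by_cases h : ζ = w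
    · rw [h, hd0.self_of_nhds]; ring
    · rw [dslope_of_ne _ h, slope_def_field]
      field_simp
  simp_rw [e2] at e1
  rw [integral_sub, integral_const_mul, sub_eq_zero] at e1
  rotate_left
  · simp_rw [mul_assoc]
    exact hint _ (hFc.mul hinv)
  · exact (hint _ hinv).const_mul _
  rw [e1, mul_comm]
  congr 1
  -- compare with the radial cutoff centered at `w`
  have hβ : ContDiff ℝ 1 (fun ζ => radialCutoff (ζ - w)) :=
    contDiff_radialCutoff.comp (contDiff_id.sub contDiff_const)
  have hβc : HasCompactSupport (fun ζ => radialCutoff (ζ - w)) :=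
    hasCompactSupport_radialCutoff.comp_homeomorph (Homeomorph.subRight w)
  have hu : ContDiff ℝ 1 (fun ζ => χ ζ - radialCutoff (ζ - w)) := hχ.sub hβ
  have hu1 : w ∉ tsupport (fun ζ => χ ζ - radialCutoff (ζ - w)) := by
    rw [notMem_tsupport_iff_eventuallyEq]
    filter_upwards [h1, Metric.ball_mem_nhds w one_pos] with ζ h2 h3
    rw [h2, radialCutoff_eq_one]
    · simp
    · rw [Metric.mem_ball, dist_eq_norm] at h3
      exact h3.le
  have e3 := integral_dbar_mul_eq_zero hu (hχc.sub hβc) (isOpen_compl_singleton (x := w))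
    (fun x hx h => hu1 (h ▸ hx)) (H := fun ζ => (ζ - w)⁻¹) (by
      intro x hx
      refine DifferentiableAt.differentiableWithinAt ?_
      refine DifferentiableAt.inv (by fun_prop) ?_
      simpa [sub_eq_zero] using hx)
  have hdβ : ∀ ζ, dbar (fun ζ => radialCutoff (ζ - w)) ζ = dbar radialCutoff (ζ - w) := by
    intro ζ
    simp only [dbar, fderiv_comp_sub]
  have e4 : ∀ ζ, dbar (fun ζ => χ ζ - radialCutoff (ζ - w)) ζ * (ζ - w)⁻¹ =
      dbar χ ζ * (ζ - w)⁻¹ - dbar radialCutoff (ζ - w) * (ζ - w)⁻¹ := by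
    intro ζ
    rw [← sub_mul, ← hdβ]
    congr 1
    simp only [dbar]
    rw [fderiv_fun_sub (hχ.differentiable one_ne_zero ζ) (hβ.differentiable one_ne_zero ζ)]
    simp
    ring
  simp_rw [e4] at e3
  -- The integral of a nonintegrable function is 0 by convention, so a nonzero integral already
  -- proves integrability.
  have hI2 : Integrable (fun ζ => dbar radialCutoff ζ * ζ⁻¹) := by
    by_contra h
    exact integral_dbar_radialCutoff_div_ne_zero (integral_undef h)
  rw [integral_sub (hint _ hinv) (hI2.comp_sub_right w), sub_eq_zero] at e3
  rw [e3]
  exact integral_sub_right_eq_self (fun ζ => dbar radialCutoff ζ * ζ⁻¹) w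

end

/-! ### Runge's theorem -/

noncomputable section

open MeasureTheory Complex Filter

theorem exists_contDiff_cutoff {K U : Set ℂ} (hK : IsCompact K) (hU : IsOpen U) (hKU : K ⊆ U) :
    ∃ χ : ℂ → ℂ, ContDiff ℝ 1 χ ∧ HasCompactSupport χ ∧ tsupport χ ⊆ U ∧
      ∀ᶠ x in 𝓝ˢ K, χ x = 1 := by
  obtain ⟨L, hL, hKL, hLU⟩ := exists_compact_between hK hU hKU
  obtain ⟨f, h1, h0, -⟩ := exists_contMDiffMap_one_nhds_of_subset_interior (n := 1)
    (modelWithCornersSelf ℝ ℂ) hK.isClosed hKL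
  have hs : tsupport (fun x => (f x : ℂ)) ⊆ L := by
    apply closure_minimal _ hL.isClosed
    intro x hx
    by_contra h
    exact hx (by simp [h0 x h])
  refine ⟨fun x => (f x : ℂ), ofRealCLM.contDiff.comp f.contMDiff.contDiff,
    HasCompactSupport.of_support_subset_isCompact hL ((subset_tsupport _).trans hs),
    hs.trans hLU, ?_⟩
  filter_upwards [h1] with x hx
  simp [hx]

/-- **Runge's theorem** for polynomial approximation. -/
theorem exists_polynomial_near_of_differentiableOn {K U : Set ℂ} (hK : IsCompact K) (hU : IsOpen U)
    (hKU : K ⊆ U) (hb : ∀ ζ ∉ K, ¬ Bornology.IsBounded (connectedComponentIn Kᶜ ζ))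
    {F : ℂ → ℂ} (hF : DifferentiableOn ℂ F U) {ε : ℝ} (hε : 0 < ε) :
    ∃ q : ℂ[X], ∀ x ∈ K, ‖q.eval x - F x‖ < ε := by
  obtain ⟨χ, hχ, hχc, hχs, hχ1⟩ := exists_contDiff_cutoff hK hU hKU
  obtain ⟨c, hc0, hc⟩ := exists_cauchyPompeiu
  have : CompactSpace K := isCompact_iff_compactSpace.mp hK
  -- `S` is the uniform closure of the polynomials on `K`. Passing from `C(K, ℂ)` to a closed
  -- subalgebra enlarges a spectrum only by bounded components of its complement, and here there are
  -- none; so `ζ - x` is invertible in `S` for every `ζ ∉ K`.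
  let S : Subalgebra ℂ C(K, ℂ) := (polynomialFunctions K).topologicalClosure
  have hS : IsClosed (S : Set C(K, ℂ)) := (polynomialFunctions K).isClosed_topologicalClosure
  have hSc : CompleteSpace S := hS.completeSpace_coe
  let x : S := ⟨(X : ℂ[X]).toContinuousMapOn K, by
    apply (polynomialFunctions K).le_topologicalClosure
    exact ⟨X, by simp, rfl⟩⟩
  have hspec : spectrum ℂ (x : C(K, ℂ)) = K := by
    rw [ContinuousMap.spectrum_eq_range]
    ext y
    simp [x]
  have hunit : ∀ ζ ∉ K, IsUnit (algebraMap ℂ S ζ - x) := by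
    intro ζ hζ
    rw [← spectrum.notMem_iff]
    intro h
    have h2 := Subalgebra.spectrum_isBounded_connectedComponentIn S x h
    rw [hspec] at h2
    exact hb ζ hζ h2
  let k : ℂ → ℂ := fun ζ => dbar χ ζ * F ζ
  have hdts : tsupport (dbar χ) ⊆ tsupport χ :=
    closure_minimal (support_dbar_subset χ) (isClosed_tsupport _)
  have hdK : ∀ ζ ∈ tsupport (dbar χ), ζ ∉ K := by
    intro ζ hζ hK'
    have h1 : ∀ᶠ y in 𝓝 ζ, χ y = 1 := hχ1.filter_mono (nhds_le_nhdsSet hK')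
    rw [← not_not (a := ζ ∈ tsupport _), notMem_tsupport_iff_eventuallyEq] at hζ
    apply hζ
    filter_upwards [h1.eventually_nhds] with y hy
    have : χ =ᶠ[𝓝 y] fun _ => 1 := hy
    rw [this.dbar_eq]
    simp [dbar]
  -- This is the Cauchy–Pompeiu integrand as an `S`-valued function. Its Bochner integral stays in
  -- the complete space `S`, and evaluation at a point of `K` gives a multiple of `F`; hence `F` is
  -- a uniform limit of polynomials.
  let Φ : ℂ → S := fun ζ => k ζ • Ring.inverse (algebraMap ℂ S ζ - x)
  have hΦs : Function.support Φ ⊆ tsupport (dbar χ) := by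
    intro ζ hζ
    apply subset_tsupport
    intro h
    apply hζ
    simp [Φ, k, h]
  have hΦc : HasCompactSupport Φ :=
    HasCompactSupport.of_support_subset_isCompact
      (HasCompactSupport.of_support_subset_isCompact hχc (support_dbar_subset χ)) hΦs
  have hΦcont : ContinuousOn Φ (tsupport (dbar χ)) := by
    apply ContinuousOn.fun_smul
    · exact (continuous_dbar hχ).continuousOn.mul (hF.continuousOn.mono (hdts.trans hχs))
    · intro ζ hζ
      apply ContinuousAt.continuousWithinAt
      obtain ⟨u, hu⟩ := hunit ζ (hdK ζ hζ)
      have h1 : ContinuousAt Ring.inverse (algebraMap ℂ S ζ - x) := by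
        rw [← hu]; exact NormedRing.inverse_continuousAt u
      exact ContinuousAt.comp (f := fun ζ => algebraMap ℂ S ζ - x) h1
        ((continuous_algebraMap ℂ S).sub continuous_const).continuousAt
  have hΦi : Integrable Φ := by
    have := hΦcont.integrableOn_compact (μ := volume)
      (HasCompactSupport.of_support_subset_isCompact hχc (support_dbar_subset χ))
    rwa [integrableOn_iff_integrable_of_support_subset hΦs] at this
  -- evaluation
  have hev : ∀ w : K, ((∫ ζ, Φ ζ : S) : C(K, ℂ)) w = c * F w := by
    intro w
    let ev : S →L[ℂ] ℂ := (ContinuousMap.evalCLM ℂ w).comp S.toSubmodule.subtypeL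
    have h1 : ev (∫ ζ, Φ ζ) = ∫ ζ, ev (Φ ζ) := (ev.integral_comp_comm hΦi).symm
    have h2 : ev (∫ ζ, Φ ζ) = ((∫ ζ, Φ ζ : S) : C(K, ℂ)) w := rfl
    rw [← h2, h1, ← hc hχ hχc hU hχs hF (hKU w.2) (hχ1.filter_mono (nhds_le_nhdsSet w.2))]
    congr 1
    ext ζ
    by_cases hζ : ζ ∈ tsupport (dbar χ)
    · have hu := hunit ζ (hdK ζ hζ)
      have h3 : ev (Φ ζ) = k ζ * ev (Ring.inverse (algebraMap ℂ S ζ - x)) := by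
        simp [Φ]
      have h4 : ev (algebraMap ℂ S ζ - x) * ev (Ring.inverse (algebraMap ℂ S ζ - x)) = 1 := by
        have h5 : (algebraMap ℂ S ζ - x) * Ring.inverse (algebraMap ℂ S ζ - x) = 1 :=
          Ring.mul_inverse_cancel _ hu
        have h6 := congrArg (fun s : S => (s : C(K, ℂ)) w) h5
        exact h6
      have h7 : ev (algebraMap ℂ S ζ - x) = ζ - w := by
        have : (((algebraMap ℂ S ζ - x : S)) : C(K, ℂ)) w = ζ - w := by
          simp [x]
        exact this
      rw [h3, eq_inv_of_mul_eq_one_right h4, h7]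
    · have h0 : dbar χ ζ = 0 := by
        by_contra h
        exact hζ (subset_tsupport _ h)
      simp [Φ, k, h0]
  let f : S := c⁻¹ • ∫ ζ, Φ ζ
  have hf : (f : C(K, ℂ)) ∈ closure ((polynomialFunctions K : Subalgebra ℂ C(K, ℂ)) :
      Set C(K, ℂ)) := f.2
  obtain ⟨g, hg, hgd⟩ := Metric.mem_closure_iff.mp hf ε hε
  obtain ⟨q, -, rfl⟩ := hg
  refine ⟨q, fun w hw => ?_⟩
  have h1 := (ContinuousMap.dist_lt_iff hε).mp hgd ⟨w, hw⟩
  have h2 : (f : C(K, ℂ)) ⟨w, hw⟩ = F w := by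
    have : (f : C(K, ℂ)) ⟨w, hw⟩ = c⁻¹ * ((∫ ζ, Φ ζ : S) : C(K, ℂ)) ⟨w, hw⟩ := by
      simp [f]
    rw [this, hev, inv_mul_cancel_left₀ hc0]
  rw [h2, dist_comm, dist_eq_norm] at h1
  simpa using h1

/-! ### Primitives and square roots on domains without holes -/

theorem Polynomial.exists_derivative_eq (q : ℂ[X]) : ∃ Q : ℂ[X], derivative Q = q := by
  induction q using Polynomial.induction_on' with
  | add p q hp hq =>
    obtain ⟨P, rfl⟩ := hp
    obtain ⟨Q, rfl⟩ := hq
    exact ⟨P + Q, by simp⟩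
  | monomial n a =>
    refine ⟨monomial (n + 1) (a / (n + 1)), ?_⟩
    rw [derivative_monomial]
    have : (n : ℂ) + 1 ≠ 0 := Nat.cast_add_one_ne_zero n
    simp [div_mul_cancel₀ _ this]

/-- Every compact subset of `U` lies in a compact subset of `U` whose complement has no bounded
component. -/
def HasFullExhaustion (U : Set ℂ) : Prop :=
  ∀ K ⊆ U, IsCompact K → ∃ L, IsCompact L ∧ K ⊆ L ∧ L ⊆ U ∧
    ∀ ζ ∉ L, ¬ Bornology.IsBounded (connectedComponentIn Lᶜ ζ)

/-- Polynomials have primitives. By Runge's theorem `F` is a locally uniform limit of polynomials,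
and their primitives, normalized at `z`, converge on the connected set `U` to a primitive of `F`. -/
theorem HasFullExhaustion.exists_hasDerivAt {U : Set ℂ} (hU : IsOpen U) (hconn : IsPreconnected U)
    (hfull : HasFullExhaustion U) {z : ℂ} (hz : z ∈ U) {F : ℂ → ℂ} (hF : DifferentiableOn ℂ F U) :
    ∃ G : ℂ → ℂ, ∀ x ∈ U, HasDerivAt G (F x) x := by
  let ι := {K : Set ℂ // K ⊆ U ∧ IsCompact K} × {ε : ℝ // 0 < ε}
  let good : ι → Set ℂ[X] := fun i => {q | ∀ x ∈ i.1.1, ‖q.eval x - F x‖ < i.2}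
  -- Approximation on all compact sets at once is expressed by a filter on polynomials instead of a
  -- sequence along an exhaustion; Runge's theorem says that this filter is proper.
  let l : Filter ℂ[X] := ⨅ i, 𝓟 (good i)
  have hne : Nonempty ι := ⟨⟨∅, by simp⟩, ⟨1, one_pos⟩⟩
  have hl : l.NeBot := by
    apply iInf_neBot_of_directed
    · rintro ⟨⟨K, hK, hKc⟩, ⟨ε, hε⟩⟩ ⟨⟨K', hK', hKc'⟩, ⟨ε', hε'⟩⟩
      refine ⟨⟨⟨K ∪ K', Set.union_subset hK hK', hKc.union hKc'⟩, ⟨min ε ε', lt_min hε hε'⟩⟩,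
        ?_, ?_⟩
      · simp only [ge_iff_le, le_principal_iff, mem_principal]
        intro q hq x hx
        exact (hq x (Or.inl hx)).trans_le (min_le_left _ _)
      · simp only [ge_iff_le, le_principal_iff, mem_principal]
        intro q hq x hx
        exact (hq x (Or.inr hx)).trans_le (min_le_right _ _)
    · rintro ⟨⟨K, hK, hKc⟩, ⟨ε, hε⟩⟩
      rw [principal_neBot_iff]
      obtain ⟨L, hL, hKL, hLU, hb⟩ := hfull K hK hKc
      obtain ⟨q, hq⟩ := exists_polynomial_near_of_differentiableOn hL hU hLU hb hF hε
      exact ⟨q, fun x hx => hq x (hKL hx)⟩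
  have hunif : ∀ K ⊆ U, IsCompact K → TendstoUniformlyOn (fun (q : ℂ[X]) x => q.eval x) F l K := by
    intro K hK hKc
    rw [Metric.tendstoUniformlyOn_iff]
    intro ε hε
    have : good ⟨⟨K, hK, hKc⟩, ⟨ε, hε⟩⟩ ∈ l := mem_iInf_of_mem _ (mem_principal_self _)
    filter_upwards [this] with q hq x hx
    rw [dist_comm, dist_eq_norm]
    exact hq x hx
  have hloc : TendstoLocallyUniformlyOn (fun (q : ℂ[X]) x => q.eval x) F l U :=
    (tendstoLocallyUniformlyOn_iff_forall_isCompact hU).mpr hunif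
  choose P hP using Polynomial.exists_derivative_eq
  let Q : ℂ[X] → ℂ → ℂ := fun q x => (P q).eval x - (P q).eval z
  have hQ : ∀ q x, HasDerivAt (Q q) (q.eval x) x := by
    intro q x
    have := ((P q).hasDerivAt x).sub_const ((P q).eval z)
    rwa [hP] at this
  -- The set where the normalized primitives are Cauchy contains `z`. By `A`, convergence at the
  -- center of a ball spreads over the ball, so this set is open and closed in `U`.
  let t := {y | y ∈ U ∧ Cauchy (map (fun q => Q q y) l)}
  have A : ∀ x ε, x ∈ t → Metric.closedBall x ε ⊆ U → Metric.ball x ε ⊆ t := by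
    intro x ε hx hε y hy
    refine ⟨hε (Metric.ball_subset_closedBall hy), ?_⟩
    exact (uniformCauchySeqOn_ball_of_deriv (f := Q) (f' := fun q x => q.eval x)
      ((hunif _ hε (isCompact_closedBall x ε)).mono Metric.ball_subset_closedBall).uniformCauchySeqOn
      (fun n y hy => hQ n y) hx.2).cauchy_map hy
  have hzt : z ∈ t := by
    refine ⟨hz, ?_⟩
    simp only [Q, sub_self]
    exact (tendsto_const_nhds (x := (0 : ℂ)) (f := l)).cauchy_map
  have hUt : U ⊆ t := by
    have open_t : IsOpen t := by
      rw [Metric.isOpen_iff]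
      intro x hx
      obtain ⟨ε, hε, h⟩ := Metric.nhds_basis_closedBall.mem_iff.mp (hU.mem_nhds hx.1)
      exact ⟨ε, hε, A x ε hx h⟩
    refine hconn.subset_of_closure_inter_subset open_t ⟨z, hz, hzt⟩ ?_
    rintro x ⟨xt, xs⟩
    obtain ⟨ε, hε, h⟩ := Metric.nhds_basis_closedBall.mem_iff.mp (hU.mem_nhds xs)
    obtain ⟨y, yt, hxy⟩ := Metric.mem_closure_iff.1 xt _ (half_pos hε)
    have B : Metric.closedBall y (ε / 2) ⊆ Metric.closedBall x ε := by
      apply Metric.closedBall_subset_closedBall'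
      rw [dist_comm]; linarith
    exact A y (ε / 2) yt (B.trans h) (Metric.mem_ball.2 hxy)
  choose! G hG using fun x (hx : x ∈ U) => cauchy_map_iff_exists_tendsto.mp (hUt hx).2
  exact ⟨G, fun x hx => hasDerivAt_of_tendstoLocallyUniformlyOn hU hloc
    (Eventually.of_forall fun q y _ => hQ q y) hG hx⟩

/-- Holomorphic square roots exist on `U`. -/
def HasSqrts (U : Set ℂ) : Prop :=
  ∀ f : ℂ → ℂ, DifferentiableOn ℂ f U → (∀ x ∈ U, f x ≠ 0) →
    ∃ s : ℂ → ℂ, DifferentiableOn ℂ s U ∧ ∀ x ∈ U, s x ^ 2 = f x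

/-- A primitive `G` of `f' / f` makes `f * exp (-G)` constant, equal to some `a`. With `b ^ 2 = a`,
the function `b * exp (G / 2)` is a square root of `f`. -/
theorem HasFullExhaustion.hasSqrts {U : Set ℂ} (hU : IsOpen U) (hconn : IsPreconnected U)
    (hfull : HasFullExhaustion U) {z : ℂ} (hz : z ∈ U) : HasSqrts U := by
  intro f hf h0
  obtain ⟨G, hG⟩ := hfull.exists_hasDerivAt hU hconn hz
    (F := fun x => deriv f x / f x) ((hf.deriv hU).div hf h0)
  have hd : ∀ x ∈ U, HasDerivAt (fun x => f x * exp (-G x)) 0 x := by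
    intro x hx
    have h1 := (hf.differentiableAt (hU.mem_nhds hx)).hasDerivAt.fun_mul (hG x hx).fun_neg.cexp
    refine h1.congr_deriv ?_
    have e : f x * (deriv f x / f x) = deriv f x := mul_div_cancel₀ _ (h0 x hx)
    linear_combination -exp (-G x) * e
  obtain ⟨a, ha⟩ := hU.exists_is_const_of_deriv_eq_zero hconn
    (fun x hx => (hd x hx).differentiableAt.differentiableWithinAt) (fun x hx => (hd x hx).deriv)
  obtain ⟨b, hb⟩ := IsAlgClosed.exists_pow_nat_eq a two_pos
  refine ⟨fun x => b * exp (G x / 2), ?_, ?_⟩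
  · intro x hx
    exact (((hG x hx).differentiableAt.div_const 2).cexp.const_mul b).differentiableWithinAt
  · intro x hx
    rw [mul_pow, hb, ← ha x hx, ← Complex.exp_nat_mul, mul_assoc, ← Complex.exp_add]
    push_cast
    rw [show -G x + 2 * (G x / 2) = 0 by ring]
    simp

end

/-! ### Blaschke factors, normal families and the Riemann mapping theorem -/

noncomputable section

open Complex Filter Metric Set

/-- The Blaschke factor with zero `a`. -/
def blaschkeFactor (a ζ : ℂ) : ℂ := (ζ - a) / (1 - (starRingEnd ℂ) a * ζ)

/-- All modulus estimates for Blaschke factors come from this identity: when `‖a‖ < 1`, the sign of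
the right side depends only on the position of `ζ` relative to the unit circle. -/
theorem normSq_one_sub_conj_mul (a ζ : ℂ) :
    normSq (1 - (starRingEnd ℂ) a * ζ) - normSq (ζ - a) = (1 - normSq a) * (1 - normSq ζ) := by
  simp [normSq_apply]
  ring

theorem one_sub_conj_mul_ne_zero {a ζ : ℂ} (ha : ‖a‖ < 1) (hζ : ‖ζ‖ ≤ 1) :
    1 - (starRingEnd ℂ) a * ζ ≠ 0 := by
  intro h
  have h1 : ‖(starRingEnd ℂ) a * ζ‖ = 1 := by
    rw [← sub_eq_zero.mp h]; simp
  rw [norm_mul, RCLike.norm_conj] at h1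
  nlinarith [norm_nonneg a, norm_nonneg ζ]

theorem norm_blaschkeFactor_lt_one {a ζ : ℂ} (ha : ‖a‖ < 1) (hζ : ‖ζ‖ < 1) :
    ‖blaschkeFactor a ζ‖ < 1 := by
  have h0 := one_sub_conj_mul_ne_zero ha hζ.le
  rw [blaschkeFactor, norm_div, div_lt_one (norm_pos_iff.mpr h0)]
  rw [← abs_of_nonneg (norm_nonneg (ζ - a)), ← abs_of_nonneg (norm_nonneg (1 - _)), ← sq_lt_sq,
    ← normSq_eq_norm_sq, ← normSq_eq_norm_sq, ← sub_pos, normSq_one_sub_conj_mul,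
    normSq_eq_norm_sq, normSq_eq_norm_sq]
  apply mul_pos <;> nlinarith [norm_nonneg a, norm_nonneg ζ]

theorem norm_blaschkeFactor_eq_one {a ζ : ℂ} (ha : ‖a‖ < 1) (hζ : ‖ζ‖ = 1) :
    ‖blaschkeFactor a ζ‖ = 1 := by
  have h0 := one_sub_conj_mul_ne_zero ha hζ.le
  rw [blaschkeFactor, norm_div, div_eq_one_iff_eq (norm_ne_zero_iff.mpr h0)]
  have h := normSq_one_sub_conj_mul a ζ
  rw [normSq_eq_norm_sq, normSq_eq_norm_sq, normSq_eq_norm_sq, normSq_eq_norm_sq, hζ] at h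
  rw [← abs_of_nonneg (norm_nonneg (ζ - a)), ← abs_of_nonneg (norm_nonneg (1 - _)), ← sq_eq_sq_iff_abs_eq_abs]
  linarith

theorem differentiableAt_blaschkeFactor {a ζ : ℂ} (h : 1 - (starRingEnd ℂ) a * ζ ≠ 0) :
    DifferentiableAt ℂ (blaschkeFactor a) ζ := by
  unfold blaschkeFactor
  fun_prop (disch := exact h)

/-- **Montel's theorem**: ultrafilter limits of bounded families of holomorphic functions. -/
theorem exists_tendstoLocallyUniformlyOn_of_bounded {ι : Type*} {U : Set ℂ} (hU : IsOpen U)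
    {F : ι → ℂ → ℂ} (hF : ∀ i, DifferentiableOn ℂ (F i) U) (hb : ∀ i, ∀ x ∈ U, ‖F i x‖ ≤ 1)
    (l : Ultrafilter ι) :
    ∃ f : ℂ → ℂ, (∀ x ∈ U, Tendsto (fun i => F i x) l (𝓝 (f x))) ∧
      TendstoLocallyUniformlyOn F f l U := by
  have h1 : ∀ x ∈ U, ∃ y, Tendsto (fun i => F i x) l (𝓝 y) := by
    intro x hx
    obtain ⟨y, -, hy⟩ := (isCompact_closedBall (0 : ℂ) 1).ultrafilter_le_nhds
      (l.map fun i => F i x) (by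
        simp only [le_principal_iff, Ultrafilter.coe_map, mem_map]
        filter_upwards with i
        simpa using hb i x hx)
    exact ⟨y, hy⟩
  choose! f hf using h1
  refine ⟨f, hf, ?_⟩
  rw [Metric.tendstoLocallyUniformlyOn_iff]
  intro ε hε x hx
  obtain ⟨r, hr, hrU⟩ := Metric.isOpen_iff.mp hU x hx
  -- Schwarz's lemma gives a Lipschitz constant at `x` that is the same for all `i`, since the ball
  -- goes into the closed ball of radius 2 about `F i x`. This equicontinuity makes the pointwise
  -- limit locally uniform.
  have hlip : ∀ i, ∀ y ∈ ball x r, dist (F i y) (F i x) ≤ 2 / r * dist y x := by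
    intro i y hy
    refine dist_le_div_mul_dist_of_mapsTo_ball ((hF i).mono hrU) ?_ hy
    intro w hw
    rw [mem_closedBall, dist_eq_norm]
    have := norm_sub_le (F i w) (F i x)
    linarith [hb i w (hrU hw), hb i x hx]
  have hlipf : ∀ y ∈ ball x r, dist (f y) (f x) ≤ 2 / r * dist y x := by
    intro y hy
    refine le_of_tendsto ((hf y (hrU hy)).dist (hf x hx)) ?_
    filter_upwards with i using hlip i y hy
  obtain ⟨δ, hδ, hδr, hδε⟩ : ∃ δ > 0, δ ≤ r ∧ 2 / r * δ ≤ ε / 3 := by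
    refine ⟨min r (ε / 3 / (2 / r)), lt_min hr (by positivity), min_le_left _ _, ?_⟩
    calc 2 / r * min r (ε / 3 / (2 / r)) ≤ 2 / r * (ε / 3 / (2 / r)) := by
          gcongr; exact min_le_right _ _
      _ = ε / 3 := by field_simp
  refine ⟨ball x δ, mem_nhdsWithin_of_mem_nhds (ball_mem_nhds x hδ), ?_⟩
  filter_upwards [Metric.tendsto_nhds.mp (hf x hx) (ε / 3) (by positivity)] with i hi y hy
  have hyr : y ∈ ball x r := ball_subset_ball hδr hy
  have h3 : 2 / r * dist y x ≤ ε / 3 := by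
    refine le_trans ?_ hδε
    gcongr
    exact (mem_ball.mp hy).le
  have h4 := hlip i y hyr
  have h5 := hlipf y hyr
  have t1 := dist_triangle4 (f y) (f x) (F i x) (F i y)
  rw [dist_comm (f x), dist_comm (F i x) (F i y)] at t1
  linarith

/-- **Hurwitz's theorem**: nonconstant limits of injective holomorphic functions are injective. -/
theorem TendstoLocallyUniformlyOn.injOn_of_injOn {ι : Type*} {l : Filter ι} [l.NeBot] {U : Set ℂ}
    (hU : IsOpen U) (hconn : IsPreconnected U) {F : ι → ℂ → ℂ} {f : ℂ → ℂ}
    (hF : ∀ i, DifferentiableOn ℂ (F i) U) (hinj : ∀ i, InjOn (F i) U)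
    (hf : TendstoLocallyUniformlyOn F f l U) {x₀ y₀ : ℂ} (hx₀ : x₀ ∈ U) (hy₀ : y₀ ∈ U)
    (hne : f x₀ ≠ f y₀) : InjOn f U := by
  have hfd : DifferentiableOn ℂ f U := hf.differentiableOn (Eventually.of_forall hF) hU
  have hfa : AnalyticOnNhd ℂ f U := hfd.analyticOnNhd hU
  intro a ha b hb hab
  by_contra hneab
  have hiso : ∀ᶠ y in 𝓝[≠] b, f y ≠ f b := by
    rcases (hfa b hb).eventually_eq_or_eventually_ne (analyticAt_const (v := f b)) with h | h
    · exfalso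
      have := hfa.eqOn_of_preconnected_of_eventuallyEq analyticOnNhd_const hconn hb h
      exact hne ((this hx₀).trans (this hy₀).symm)
    · exact h
  rw [eventually_nhdsWithin_iff] at hiso
  have hnear : ∀ᶠ y in 𝓝 b, y ∈ U ∧ y ≠ a ∧ (y ∈ ({b}ᶜ : Set ℂ) → f y ≠ f b) := by
    filter_upwards [hU.mem_nhds hb, isOpen_ne.mem_nhds (Ne.symm hneab), hiso] with y h1 h2 h3
    exact ⟨h1, h2, h3⟩
  obtain ⟨r, hr, hrb⟩ := Metric.nhds_basis_closedBall.eventually_iff.mp hnear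
  have hcont : ContinuousOn (fun y => ‖f y - f b‖) (sphere b r) := by
    refine (ContinuousOn.sub (hfd.continuousOn.mono ?_) continuousOn_const).norm
    exact fun y hy => (hrb (sphere_subset_closedBall hy)).1
  obtain ⟨y₁, hy₁, hmin⟩ := (isCompact_sphere b r).exists_isMinOn
    (NormedSpace.sphere_nonempty.mpr hr.le) hcont
  have hε : 0 < ‖f y₁ - f b‖ := by
    rw [norm_pos_iff, sub_ne_zero]
    refine (hrb (sphere_subset_closedBall hy₁)).2.2 ?_
    rintro rfl
    simp at hy₁
    exact hr.ne hy₁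
  set ε := ‖f y₁ - f b‖
  have hcb : closedBall b r ⊆ U := fun y hy => (hrb hy).1
  have hu := (tendstoLocallyUniformlyOn_iff_forall_isCompact hU).mp hf _
    (union_subset hcb (singleton_subset_iff.mpr ha))
    ((isCompact_closedBall b r).union isCompact_singleton)
  rw [Metric.tendstoUniformlyOn_iff] at hu
  -- With tolerance `ε / 10`, on the circle `F i` stays at distance at least `ε / 2` from `F i b`,
  -- so the image of the closed disk contains the ball of radius `ε / 4` about `F i b`. As `f a = f
  -- b`, this ball contains `F i a`, although `a` is outside the disk.
  obtain ⟨i, hi⟩ := (hu (ε / 10) (by positivity)).exists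
  have hib := hi b (Or.inl (mem_closedBall_self hr.le))
  have hia := hi a (Or.inr rfl)
  rw [dist_eq_norm] at hib hia
  have hball := DiffContOnCl.ball_subset_image_closedBall (f := F i) (z₀ := b) (r := r)
    (ε := ε / 2) (((hF i).mono (by rwa [closure_ball _ hr.ne'])).diffContOnCl) hr (by
      intro y hy
      have h1 : ε ≤ ‖f y - f b‖ := hmin hy
      have h2 := hi y (Or.inl (sphere_subset_closedBall hy))
      rw [dist_eq_norm] at h2
      have h3 : f y - f b = (f y - F i y) + (F i y - F i b) - (f b - F i b) := by ring
      have h4 := norm_sub_le ((f y - F i y) + (F i y - F i b)) (f b - F i b)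
      have h5 := norm_add_le (f y - F i y) (F i y - F i b)
      rw [← h3] at h4
      linarith) (by
      have h1 : ∀ᶠ y in 𝓝[≠] b, F i y ≠ F i b := by
        filter_upwards [self_mem_nhdsWithin, mem_nhdsWithin_of_mem_nhds (hU.mem_nhds hb)] with
          y hy hyU h
        exact hy (hinj i hyU hb h)
      exact h1.frequently.filter_mono nhdsWithin_le_nhds)
  have hmem : F i a ∈ ball (F i b) (ε / 2 / 2) := by
    rw [mem_ball, dist_eq_norm]
    have h3 : F i a - F i b = (f b - F i b) - (f a - F i a) := by rw [hab]; ring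
    rw [h3]
    have := norm_sub_le (f b - F i b) (f a - F i a)
    linarith
  obtain ⟨y, hy, hya⟩ := hball hmem
  exact (hrb hy).2.1 (hinj i (hcb hy) ha hya)

theorem InjOn.image_mem_nhds_of_differentiableOn {U : Set ℂ} (hU : IsOpen U) {f : ℂ → ℂ}
    (hf : DifferentiableOn ℂ f U) (hinj : InjOn f U) {x : ℂ} (hx : x ∈ U) :
    𝓝 (f x) ≤ map f (𝓝 x) := by
  rcases (hf.analyticAt (hU.mem_nhds hx)).eventually_constant_or_nhds_le_map_nhds with h | h
  · exfalso
    have h1 : ∀ᶠ y in 𝓝[≠] x, False := by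
      filter_upwards [self_mem_nhdsWithin, mem_nhdsWithin_of_mem_nhds (hU.mem_nhds hx),
        mem_nhdsWithin_of_mem_nhds h] with y hy hyU hyf
      exact hy (hinj hyU hx hyf)
    exact h1.exists.elim fun _ h => h
  · exact h

/-- The inverse of an injective holomorphic function is holomorphic. -/
theorem differentiableOn_of_leftInvOn {U V : Set ℂ} (hU : IsOpen U) (hV : IsOpen V) {f g : ℂ → ℂ}
    (hf : DifferentiableOn ℂ f U) (hgV : MapsTo g V U) (hgf : LeftInvOn g f U)
    (hfg : LeftInvOn f g V) : DifferentiableOn ℂ g V := by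
  have hinj : InjOn f U := hgf.injOn
  have hcont : ∀ y ∈ V, ContinuousAt g y := by
    intro y hy
    have h1 := InjOn.image_mem_nhds_of_differentiableOn hU hf hinj (hgV hy)
    rw [hfg hy] at h1
    refine (Tendsto.mono_left ?_ h1)
    rw [tendsto_map'_iff]
    refine tendsto_id.congr' ?_
    filter_upwards [hU.mem_nhds (hgV hy)] with x hx
    exact (hgf hx).symm
  have hd : ∀ y ∈ V, deriv f (g y) ≠ 0 → DifferentiableAt ℂ g y := by
    intro y hy h0
    refine (HasDerivAt.of_local_left_inverse (hcont y hy)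
      (hf.differentiableAt (hU.mem_nhds (hgV hy))).hasDerivAt h0 ?_).differentiableAt
    filter_upwards [hV.mem_nhds hy] with w hw using hfg hw
  intro y hy
  -- The zeros of `f'` are isolated, so the continuous map `g` is differentiable in a punctured
  -- neighborhood of `y`, and the singularity is removable. There is no need to know beforehand that
  -- `f'` has no zeros.
  refine (analyticAt_of_differentiable_on_punctured_nhds_of_continuousAt ?_
    (hcont y hy)).differentiableAt.differentiableWithinAt
  have hxU := hgV hy
  have hda : AnalyticAt ℂ (deriv f) (g y) := (hf.analyticAt (hU.mem_nhds hxU)).deriv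
  have hne : ∀ᶠ x in 𝓝[≠] (g y), deriv f x ≠ 0 := by
    rcases hda.eventually_eq_zero_or_eventually_ne_zero with h | h
    · exfalso
      obtain ⟨r, hr, hrb⟩ := Metric.eventually_nhds_iff_ball.mp (h.and (hU.mem_nhds hxU))
      have hc := (convex_ball (g y) r).isPreconnected
      obtain ⟨a, ha⟩ := isOpen_ball.exists_is_const_of_deriv_eq_zero hc
        (hf.mono fun w hw => (hrb w hw).2) (fun w hw => (hrb w hw).1)
      have h2 : g y + (r / 2 : ℝ) ∈ ball (g y) r := by
        rw [mem_ball, dist_eq_norm, add_sub_cancel_left, norm_real, Real.norm_of_nonneg] <;> linarith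
      have h3 := hinj (hrb _ h2).2 hxU ((ha _ h2).trans (ha _ (mem_ball_self hr)).symm)
      have : (r / 2 : ℝ) = 0 := by simpa using h3
      linarith
    · exact h
  have htend : Tendsto g (𝓝[≠] y) (𝓝[≠] (g y)) := by
    refine tendsto_nhdsWithin_iff.mpr ⟨(hcont y hy).mono_left nhdsWithin_le_nhds, ?_⟩
    filter_upwards [self_mem_nhdsWithin, mem_nhdsWithin_of_mem_nhds (hV.mem_nhds hy)] with
      w hw hwV h
    apply hw
    rw [mem_singleton_iff, ← hfg hwV, ← hfg hy, h]
  filter_upwards [htend.eventually hne, mem_nhdsWithin_of_mem_nhds (hV.mem_nhds hy)] with w h1 h2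
  exact hd w h2 h1

/-- Normalized injective holomorphic maps from `U` to the unit disk. -/
structure IsSchlichtAt (U : Set ℂ) (z : ℂ) (f : ℂ → ℂ) : Prop where
  differentiableOn : DifferentiableOn ℂ f U
  mapsTo : MapsTo f U (ball 0 1)
  injOn : InjOn f U
  map_base : f z = 0

/-- Koebe's square root construction. -/
theorem IsSchlichtAt.exists_norm_lt {U : Set ℂ} (hs : HasSqrts U) {z w₁ : ℂ} (hz : z ∈ U)
    (hw₁ : w₁ ∈ U) (hne : w₁ ≠ z) {f : ℂ → ℂ} (hf : IsSchlichtAt U z f) {a : ℂ}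
    (ha : a ∈ ball (0 : ℂ) 1) (haf : a ∉ f '' U) :
    ∃ g, IsSchlichtAt U z g ∧ ‖f w₁‖ < ‖g w₁‖ := by
  have ha1 : ‖a‖ < 1 := by simpa using ha
  have hf1 : ∀ x ∈ U, ‖f x‖ < 1 := fun x hx => by simpa using hf.mapsTo hx
  have hden : ∀ x ∈ U, 1 - (starRingEnd ℂ) a * f x ≠ 0 := fun x hx =>
    one_sub_conj_mul_ne_zero ha1 (hf1 x hx).le
  obtain ⟨s, hsd, hsq⟩ := hs (fun x => blaschkeFactor a (f x))
    (fun x hx => (differentiableAt_blaschkeFactor (hden x hx)).comp_differentiableWithinAt x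
      (hf.differentiableOn x hx)) (by
      intro x hx
      rw [blaschkeFactor]
      refine div_ne_zero ?_ (hden x hx)
      rw [sub_ne_zero]
      rintro rfl
      exact haf ⟨x, hx, rfl⟩)
  have hs1 : ∀ x ∈ U, ‖s x‖ < 1 := by
    intro x hx
    have h1 := norm_blaschkeFactor_lt_one ha1 (hf1 x hx)
    rw [← hsq x hx, norm_pow] at h1
    nlinarith [norm_nonneg (s x)]
  have hb : ‖s z‖ < 1 := hs1 z hz
  have hsinj : InjOn s U := by
    intro x hx y hy hxy
    apply hf.injOn hx hy
    have h1 : blaschkeFactor a (f x) = blaschkeFactor a (f y) := by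
      rw [← hsq x hx, ← hsq y hy, hxy]
    have h2 : 1 - (starRingEnd ℂ) a * a ≠ 0 := one_sub_conj_mul_ne_zero ha1 ha1.le
    rw [blaschkeFactor, blaschkeFactor, div_eq_div_iff (hden x hx) (hden y hy)] at h1
    have h3 : (1 - (starRingEnd ℂ) a * a) * (f x - f y) = 0 := by linear_combination h1
    exact sub_eq_zero.mp ((mul_eq_zero.mp h3).resolve_left h2)
  have hden2 : ∀ x ∈ U, 1 - (starRingEnd ℂ) (s z) * s x ≠ 0 := fun x hx =>
    one_sub_conj_mul_ne_zero hb (hs1 x hx).le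
  have hdet : 1 - (starRingEnd ℂ) (s z) * s z ≠ 0 := hden2 z hz
  have hbinj : ∀ x ∈ U, ∀ y ∈ U,
      blaschkeFactor (s z) (s x) = blaschkeFactor (s z) (s y) → x = y := by
    intro x hx y hy h1
    rw [blaschkeFactor, blaschkeFactor, div_eq_div_iff (hden2 x hx) (hden2 y hy)] at h1
    have h3 : (1 - (starRingEnd ℂ) (s z) * s z) * (s x - s y) = 0 := by linear_combination h1
    exact hsinj hx hy (sub_eq_zero.mp ((mul_eq_zero.mp h3).resolve_left hdet))
  have hbase : blaschkeFactor (s z) (s z) = 0 := by simp [blaschkeFactor]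
  refine ⟨fun x => blaschkeFactor (s z) (s x), ⟨?_, ?_, ?_, hbase⟩, ?_⟩
  · exact fun x hx => (differentiableAt_blaschkeFactor (hden2 x hx)).comp_differentiableWithinAt x
      (hsd x hx)
  · intro x hx
    simpa using norm_blaschkeFactor_lt_one hb (hs1 x hx)
  · exact fun x hx y hy h => hbinj x hx y hy h
  · have hx := hw₁
    set x := w₁
    have hg0 : blaschkeFactor (s z) (s x) ≠ 0 := by
      rw [← hbase]
      exact fun h => hne (hbinj x hx z hz h)
    have hm : ‖blaschkeFactor (-s z) (s x)‖ < 1 :=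
      norm_blaschkeFactor_lt_one (by simpa using hb) (hs1 x hx)
    have hden3 : 1 - (starRingEnd ℂ) (-s z) * s x ≠ 0 :=
      one_sub_conj_mul_ne_zero (by simpa using hb) (hs1 x hx).le
    have hsz : s z ^ 2 = -a := by
      rw [hsq z hz, hf.map_base]
      simp [blaschkeFactor]
    have hsx : s x ^ 2 * (1 - (starRingEnd ℂ) a * f x) = f x - a := by
      rw [hsq x hx, blaschkeFactor, div_mul_cancel₀ _ (hden x hx)]
    have hconj : (starRingEnd ℂ) (s z) ^ 2 = -(starRingEnd ℂ) a := by
      rw [← map_pow, hsz, map_neg]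
    -- Undoing the square root expresses `f` as the product of the new map and a second Blaschke
    -- factor of modulus less than 1, so the new map is larger at `w₁`.
    have hfac : f x = blaschkeFactor (s z) (s x) * blaschkeFactor (-s z) (s x) := by
      rw [blaschkeFactor, blaschkeFactor, div_mul_div_comm, eq_div_iff (mul_ne_zero (hden2 x hx) hden3)]
      rw [map_neg]
      linear_combination (-s x ^ 2 * f x) * hconj - hsx + hsz
    rw [hfac, norm_mul]
    exact mul_lt_of_lt_one_right (norm_pos_iff.mpr hg0) hm

/-- The **Riemann mapping theorem**. -/
theorem exists_riemannMap {U : Set ℂ} (hU : IsOpen U) (hconn : IsPreconnected U)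
    (hbdd : Bornology.IsBounded U) (hs : HasSqrts U) {z : ℂ} (hz : z ∈ U) :
    ∃ ξ g : ℂ → ℂ, DifferentiableOn ℂ ξ U ∧ DifferentiableOn ℂ g (ball 0 1) ∧
      MapsTo ξ U (ball 0 1) ∧ MapsTo g (ball 0 1) U ∧ LeftInvOn g ξ U ∧
      LeftInvOn ξ g (ball 0 1) ∧ ξ z = 0 := by
  obtain ⟨w₁, hw₁, hne⟩ : ∃ w₁ ∈ U, w₁ ≠ z := by
    have h1 : ∀ᶠ y in 𝓝[≠] z, y ∈ U ∧ y ≠ z := by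
      filter_upwards [self_mem_nhdsWithin, mem_nhdsWithin_of_mem_nhds (hU.mem_nhds hz)] with
        y hy hyU
      exact ⟨hyU, hy⟩
    exact h1.exists
  obtain ⟨R, hR⟩ := hbdd.subset_ball z
  have hRpos : 0 < R := by
    have := hR hz
    simpa using this
  have hne0 : {t : ℝ | ∃ f, IsSchlichtAt U z f ∧ ‖f w₁‖ = t}.Nonempty := by
    refine ⟨_, fun x => (x - z) / R, ⟨by fun_prop, ?_, ?_, by simp⟩, rfl⟩
    · intro x hx
      have h1 := hR hx
      rw [mem_ball, dist_eq_norm] at h1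
      rw [mem_ball_zero_iff, norm_div, norm_real, Real.norm_of_nonneg hRpos.le, div_lt_one hRpos]
      exact h1
    · intro x _ y _ hxy
      have : (R : ℂ) ≠ 0 := by exact_mod_cast hRpos.ne'
      simpa [div_left_inj' this] using hxy
  have hbdd' : BddAbove {t : ℝ | ∃ f, IsSchlichtAt U z f ∧ ‖f w₁‖ = t} := by
    refine ⟨1, ?_⟩
    rintro t ⟨f, hf, rfl⟩
    have := hf.mapsTo hw₁
    rw [mem_ball_zero_iff] at this
    exact this.le
  set M := sSup {t : ℝ | ∃ f, IsSchlichtAt U z f ∧ ‖f w₁‖ = t}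
  obtain ⟨t, -, ht, htmem⟩ := exists_seq_tendsto_sSup hne0 hbdd'
  choose F hF hFt using htmem
  have hMpos : 0 < M := by
    refine lt_of_lt_of_le ?_ (le_csSup hbdd' ⟨F 0, hF 0, rfl⟩)
    rw [norm_pos_iff, ← (hF 0).map_base]
    exact fun h => hne ((hF 0).injOn hw₁ hz h)
  have hF1 : ∀ i, ∀ x ∈ U, ‖F i x‖ ≤ 1 := fun i x hx =>
    (mem_ball_zero_iff.mp ((hF i).mapsTo hx)).le
  -- A limit along an ultrafilter replaces the choice of a convergent subsequence of the maximizing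
  -- sequence. The limit is nonconstant because `‖f w₁‖ = M > 0` while `f z = 0`.
  obtain ⟨f, hfp, hfu⟩ := exists_tendstoLocallyUniformlyOn_of_bounded hU
    (fun i => (hF i).differentiableOn) hF1 (hyperfilter ℕ)
  have hfz : f z = 0 := by
    refine tendsto_nhds_unique (hfp z hz) ?_
    simp_rw [(hF _).map_base]
    exact tendsto_const_nhds
  have hfw : ‖f w₁‖ = M := by
    refine tendsto_nhds_unique (hfp w₁ hw₁).norm ?_
    simp_rw [hFt]
    exact ht.mono_left Nat.hyperfilter_le_atTop
  have hfne : f w₁ ≠ f z := by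
    rw [hfz, ← norm_pos_iff, hfw]; exact hMpos
  have hfd : DifferentiableOn ℂ f U :=
    hfu.differentiableOn (Eventually.of_forall fun i => (hF i).differentiableOn) hU
  have hfinj : InjOn f U := hfu.injOn_of_injOn hU hconn (fun i => (hF i).differentiableOn)
    (fun i => (hF i).injOn) hw₁ hz hfne
  have hfmaps : MapsTo f U (ball 0 1) := by
    have hcl : f '' U ⊆ closedBall 0 1 := by
      rintro _ ⟨x, hx, rfl⟩
      rw [mem_closedBall_zero_iff]
      exact le_of_tendsto (hfp x hx).norm (Eventually.of_forall fun i => hF1 i x hx)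
    rcases (hfd.analyticOnNhd hU).is_constant_or_isOpen hconn with ⟨c, hc⟩ | h
    · exact absurd ((hc w₁ hw₁).trans (hc z hz).symm) hfne
    · have h2 := (h U subset_rfl hU).subset_interior_iff.mpr hcl
      rw [interior_closedBall _ one_ne_zero] at h2
      exact mapsTo_iff_image_subset.mpr h2
  have hfS : IsSchlichtAt U z f := ⟨hfd, hfmaps, hfinj, hfz⟩
  have hsurj : SurjOn f U (ball 0 1) := by
    intro a ha
    by_contra haf
    obtain ⟨g, hg, hlt⟩ := hfS.exists_norm_lt hs hz hw₁ hne ha haf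
    have := le_csSup hbdd' ⟨g, hg, rfl⟩
    rw [hfw] at hlt
    exact absurd this (not_le.mpr hlt)
  have hright : LeftInvOn f (Function.invFunOn f U) (ball 0 1) := hsurj.rightInvOn_invFunOn
  have hleft : LeftInvOn (Function.invFunOn f U) f U := hfinj.leftInvOn_invFunOn
  have hgm : MapsTo (Function.invFunOn f U) (ball 0 1) U := hsurj.mapsTo_invFunOn
  exact ⟨f, Function.invFunOn f U, hfd, differentiableOn_of_leftInvOn hU isOpen_ball hfd hgm hleft hright,
    hfmaps, hgm, hleft, hright, hfz⟩

/-! ### The filled Julia set and attracting fixed points -/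

/-- Write `p = divX p * X + p(0)`. For large `x` the first factor has modulus at least 3, and
`‖p(0)‖ ≤ ‖x‖`. -/
theorem Polynomial.exists_two_mul_norm_le_norm_eval {p : ℂ[X]} (hp : 2 ≤ p.natDegree) :
    ∃ R : ℝ, 0 < R ∧ ∀ x : ℂ, R < ‖x‖ → 2 * ‖x‖ ≤ ‖p.eval x‖ := by
  have hdeg : 0 < p.divX.degree := by
    rw [← natDegree_pos_iff_degree_pos, natDegree_divX_eq_natDegree_tsub_one]
    omega
  have h1 : Tendsto (fun x : ℂ => ‖p.divX.eval x‖) (comap norm atTop) atTop :=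
    p.divX.tendsto_norm_atTop hdeg tendsto_comap
  have h2 := (h1.eventually_ge_atTop 3).and
    (tendsto_comap.eventually (eventually_ge_atTop ‖p.coeff 0‖))
  obtain ⟨t, ht, htx⟩ := (eventually_comap.mp h2).exists_forall_of_atTop.imp fun a h =>
    (⟨trivial, h⟩ : True ∧ _)
  refine ⟨max t 1, by positivity, fun x hx => ?_⟩
  obtain ⟨h3, h4⟩ := htx ‖x‖ ((le_max_left _ _).trans hx.le) x rfl
  have h5 : p.eval x = p.divX.eval x * x + p.coeff 0 := by
    conv_lhs => rw [← divX_mul_X_add p]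
    simp
  have h6 := norm_sub_le (p.eval x) (p.coeff 0)
  rw [h5, add_sub_cancel_right, norm_mul, ← h5] at h6
  nlinarith [norm_nonneg x]

theorem two_pow_mul_norm_le_of_escape {f : ℂ → ℂ} {R : ℝ} 
    (hf : ∀ x, R < ‖x‖ → 2 * ‖x‖ ≤ ‖f x‖) {x : ℂ} (hx : R < ‖x‖) (k : ℕ) :
    2 ^ k * ‖x‖ ≤ ‖f^[k] x‖ := by
  induction k with
  | zero => simp
  | succ k ih =>
    rw [Function.iterate_succ_apply']
    have h1 : ‖x‖ ≤ 2 ^ k * ‖x‖ := le_mul_of_one_le_left (norm_nonneg x) (one_le_pow₀ one_le_two)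
    have := hf _ (hx.trans_le (h1.trans ih))
    rw [pow_succ]
    linarith

/-- An orbit that leaves the disk of radius `R` doubles its modulus at each step from then on. So
one closed bound characterizes bounded orbits, which makes the filled Julia set compact. -/
theorem exists_filledJuliaSet_eq {p : ℂ[X]} (hp : 2 ≤ p.natDegree) :
    ∃ R : ℝ, 0 < R ∧ filledJuliaSet p = {x | ∀ k, ‖(fun y => p.eval y)^[k] x‖ ≤ R} := by
  obtain ⟨R, hR, h⟩ := p.exists_two_mul_norm_le_norm_eval hp
  refine ⟨R, hR, ?_⟩
  ext x
  rw [filledJuliaSet, mem_ofPred_eq, mem_ofPred_eq]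
  constructor
  · intro hx k
    by_contra hk
    push Not at hk
    obtain ⟨C, hC⟩ := isBounded_iff_forall_norm_le.mp hx
    obtain ⟨m, hm⟩ := pow_unbounded_of_one_lt (C / R) one_lt_two
    have h1 := two_pow_mul_norm_le_of_escape h hk m
    rw [← Function.iterate_add_apply] at h1
    have h2 := hC _ ⟨m + k, rfl⟩
    rw [div_lt_iff₀ hR] at hm
    have h3 : (2 : ℝ) ^ m * R ≤ 2 ^ m * ‖(fun y => p.eval y)^[k] x‖ := by gcongr
    simp only at h2
    linarith
  · intro hx
    refine isBounded_iff_forall_norm_le.mpr ⟨R, ?_⟩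
    rintro _ ⟨k, rfl⟩
    exact hx k

theorem isClosed_filledJuliaSet {p : ℂ[X]} (hp : 2 ≤ p.natDegree) :
    IsClosed (filledJuliaSet p) := by
  obtain ⟨R, -, h⟩ := exists_filledJuliaSet_eq hp
  rw [h, ofPred_forall]
  exact isClosed_iInter fun k => isClosed_le
    ((Continuous.iterate p.continuous k).norm) continuous_const

theorem isBounded_filledJuliaSet {p : ℂ[X]} (hp : 2 ≤ p.natDegree) :
    Bornology.IsBounded (filledJuliaSet p) := by
  obtain ⟨R, -, h⟩ := exists_filledJuliaSet_eq hp
  rw [h]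
  exact isBounded_iff_forall_norm_le.mpr ⟨R, fun x hx => hx 0⟩

theorem eval_mem_filledJuliaSet_iff {p : ℂ[X]} {x : ℂ} :
    p.eval x ∈ filledJuliaSet p ↔ x ∈ filledJuliaSet p := by
  have h1 : (range fun k : ℕ => (fun y => p.eval y)^[k] x) =
      insert x (range fun k : ℕ => (fun y => p.eval y)^[k] (p.eval x)) := by
    ext y
    simp only [mem_insert_iff, mem_range]
    constructor
    · rintro ⟨k, rfl⟩
      cases k with
      | zero => left; rfl
      | succ k => right; exact ⟨k, rfl⟩
    · rintro (rfl | ⟨k, rfl⟩)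
      · exact ⟨0, rfl⟩
      · exact ⟨k + 1, rfl⟩
  simp only [filledJuliaSet, mem_ofPred_eq]
  rw [h1, Bornology.isBounded_insert]

/-- The filled Julia set is completely invariant; its interior inherits this from the continuity of
`p` in one direction and its openness in the other. -/
theorem eval_mem_interior_filledJuliaSet_iff {p : ℂ[X]} (hp : 2 ≤ p.natDegree) {x : ℂ} :
    p.eval x ∈ interior (filledJuliaSet p) ↔ x ∈ interior (filledJuliaSet p) := by
  constructor
  · intro h
    rw [mem_interior_iff_mem_nhds]
    filter_upwards [p.continuous.continuousAt.preimage_mem_nhds (isOpen_interior.mem_nhds h)] with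
      y hy
    exact (eval_mem_filledJuliaSet_iff).mp (interior_subset hy)
  · intro h
    have h1 : IsOpen ((fun y => p.eval y) '' interior (filledJuliaSet p)) :=
      (p.isOpenQuotientMap_eval (by omega)).isOpenMap _ isOpen_interior
    have h2 : (fun y => p.eval y) '' interior (filledJuliaSet p) ⊆ filledJuliaSet p := by
      rintro _ ⟨y, hy, rfl⟩
      exact (eval_mem_filledJuliaSet_iff).mpr (interior_subset hy)
    exact interior_maximal h2 h1 ⟨x, h, rfl⟩

theorem Polynomial.exists_contracting_ball {p : ℂ[X]} {z : ℂ} (hfix : p.eval z = z)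
    (hattr : ‖(derivative p).eval z‖ < 1) :
    ∃ r > 0, ∃ c < 1, 0 ≤ c ∧ ∀ x ∈ ball z r, dist (p.eval x) z ≤ c * dist x z := by
  obtain ⟨c, hc1, hc2⟩ := exists_between hattr
  have h := (p.hasDerivAt z).isLittleO.def (sub_pos.mpr hc1)
  obtain ⟨r, hr, hb⟩ := Metric.eventually_nhds_iff_ball.mp h
  refine ⟨r, hr, c, hc2, (norm_nonneg _).trans hc1.le, fun x hx => ?_⟩
  have h1 := hb x hx
  rw [hfix] at h1
  rw [dist_eq_norm, dist_eq_norm]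
  have h2 := norm_add_le (p.eval x - z - (x - z) • (derivative p).eval z)
    ((x - z) • (derivative p).eval z)
  rw [sub_add_cancel, norm_smul] at h2
  nlinarith

theorem dist_iterate_le_of_contracting {f : ℂ → ℂ} {z : ℂ} {r c : ℝ} (hc1 : c < 1) (hc0 : 0 ≤ c)
    (h : ∀ x ∈ ball z r, dist (f x) z ≤ c * dist x z) {x : ℂ} (hx : x ∈ ball z r) (k : ℕ) :
    f^[k] x ∈ ball z r ∧ dist (f^[k] x) z ≤ c ^ k * dist x z := by
  induction k with
  | zero => simpa using hx
  | succ k ih =>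
    rw [Function.iterate_succ_apply']
    have h1 := h _ ih.1
    have h2 := mem_ball.mp ih.1
    refine ⟨?_, ?_⟩
    · rw [mem_ball]
      nlinarith [dist_nonneg (x := f^[k] x) (y := z)]
    · calc _ ≤ c * dist (f^[k] x) z := h1
        _ ≤ c * (c ^ k * dist x z) := by gcongr; exact ih.2
        _ = _ := by ring

theorem mem_interior_filledJuliaSet {p : ℂ[X]} {z : ℂ} (hfix : p.eval z = z)
    (hattr : ‖(derivative p).eval z‖ < 1) : z ∈ interior (filledJuliaSet p) := by
  obtain ⟨r, hr, c, hc1, hc0, h⟩ := exists_contracting_ball hfix hattr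
  rw [mem_interior_iff_mem_nhds]
  filter_upwards [ball_mem_nhds z hr] with x hx
  refine isBounded_ball.subset (t := ball z r) ?_
  rintro _ ⟨k, rfl⟩
  exact (dist_iterate_le_of_contracting hc1 hc0 h hx k).1

theorem interior_filledJuliaSet_subset (p : ℂ[X]) :
    interior (filledJuliaSet p) ⊆ (juliaSet p)ᶜ :=
  fun _ hx h => h.2 hx

theorem isPreconnected_compl_closedBall (R : ℝ) :
    IsPreconnected (closedBall (0 : ℂ) R)ᶜ := by
  have h : (closedBall (0 : ℂ) R)ᶜ =
      (fun x : ℝ × ℝ => (x.1 : ℂ) * exp (x.2 * I)) '' (Ioi R ×ˢ univ) := by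
    ext ζ
    simp only [mem_compl_iff, mem_closedBall_zero_iff, not_le, mem_image, Prod.exists]
    constructor
    · intro h
      exact ⟨‖ζ‖, ζ.arg, ⟨h, trivial⟩, norm_mul_exp_arg_mul_I ζ⟩
    · rintro ⟨t, θ, ⟨ht, -⟩, rfl⟩
      rw [norm_mul, norm_exp_ofReal_mul_I, norm_real, mul_one]
      exact lt_of_lt_of_le ht (le_abs_self t)
  rw [h]
  exact (isPreconnected_Ioi.prod isPreconnected_univ).image _ (by fun_prop)

/-! ### Topology of the immediate basin -/

section Basin

variable {p : ℂ[X]} {z : ℂ}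

theorem isOpen_immediateBasin : IsOpen (immediateBasin p z) :=
  IsOpen.connectedComponentIn isClosed_frontier.isOpen_compl

theorem isPreconnected_immediateBasin : IsPreconnected (immediateBasin p z) :=
  isPreconnected_connectedComponentIn

theorem mem_immediateBasin (hz : z ∈ interior (filledJuliaSet p)) : z ∈ immediateBasin p z :=
  mem_connectedComponentIn (interior_filledJuliaSet_subset p hz)

/-- The complement of the Julia set is the disjoint union of two open sets, the interior and the
complement of the filled Julia set, and a connected set meeting the first lies in it. -/
theorem immediateBasin_subset (hp : 2 ≤ p.natDegree) (hz : z ∈ interior (filledJuliaSet p)) :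
    immediateBasin p z ⊆ interior (filledJuliaSet p) := by
  have hcl := isClosed_filledJuliaSet hp
  refine (isPreconnected_immediateBasin (p := p) (z := z)).subset_left_of_subset_union
    isOpen_interior hcl.isOpen_compl ?_ ?_ ⟨z, mem_immediateBasin hz, hz⟩
  · exact disjoint_compl_right.mono_left interior_subset
  · intro x hx
    have h1 : x ∉ frontier (filledJuliaSet p) := connectedComponentIn_subset _ _ hx
    by_cases h : x ∈ filledJuliaSet p
    · left
      by_contra h2
      exact h1 ⟨subset_closure h, h2⟩
    · right; exact h

theorem IsPreconnected.subset_immediateBasin {S : Set ℂ} (hS : IsPreconnected S)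
    (hSK : S ⊆ interior (filledJuliaSet p)) (hne : (S ∩ immediateBasin p z).Nonempty) :
    S ⊆ immediateBasin p z := by
  obtain ⟨y, hyS, hy⟩ := hne
  have h := hS.subset_connectedComponentIn hyS (hSK.trans (interior_filledJuliaSet_subset p))
  rw [immediateBasin, connectedComponentIn_eq hy]
  exact h

theorem closure_immediateBasin_inter :
    closure (immediateBasin p z) ∩ interior (filledJuliaSet p) ⊆ immediateBasin p z := by
  rintro x ⟨hx, hxK⟩
  have h1 : connectedComponentIn (interior (filledJuliaSet p)) x ⊆ immediateBasin p z := by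
    apply isPreconnected_connectedComponentIn.subset_immediateBasin
    · exact connectedComponentIn_subset _ _
    · exact mem_closure_iff.mp hx _ isOpen_interior.connectedComponentIn
        (mem_connectedComponentIn hxK)
  exact h1 (mem_connectedComponentIn hxK)

theorem mapsTo_immediateBasin (hp : 2 ≤ p.natDegree) (hz : z ∈ interior (filledJuliaSet p))
    (hfix : p.eval z = z) :
    MapsTo (fun x => p.eval x) (immediateBasin p z) (immediateBasin p z) := by
  rw [mapsTo_iff_image_subset]
  apply (isPreconnected_immediateBasin.image _ p.continuous.continuousOn).subset_immediateBasin
  · rintro _ ⟨x, hx, rfl⟩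
    exact (eval_mem_interior_filledJuliaSet_iff hp).mpr (immediateBasin_subset hp hz hx)
  · exact ⟨z, ⟨z, mem_immediateBasin hz, hfix⟩, mem_immediateBasin hz⟩

theorem iterate_mem_interior_iff (hp : 2 ≤ p.natDegree) (i : ℕ) {x : ℂ} :
    (fun y => p.eval y)^[i] x ∈ interior (filledJuliaSet p) ↔
      x ∈ interior (filledJuliaSet p) := by
  induction i generalizing x with
  | zero => rfl
  | succ i ih =>
    rw [Function.iterate_succ_apply, ih]
    exact eval_mem_interior_filledJuliaSet_iff hp

/-- By complete invariance the preimage stays in the interior of the filled Julia set, of which the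
basin is already a full component; conversely the basin maps into itself. The distinguished
component thus reduces to the histories inside the basin. -/
theorem connectedComponentIn_preimage_immediateBasin (hp : 2 ≤ p.natDegree)
    (hz : z ∈ interior (filledJuliaSet p)) (hfix : p.eval z = z) (i : ℕ) :
    connectedComponentIn ((fun x => p.eval x)^[i] ⁻¹' immediateBasin p z) z =
      immediateBasin p z := by
  have hsub : immediateBasin p z ⊆ (fun x => p.eval x)^[i] ⁻¹' immediateBasin p z :=
    (mapsTo_immediateBasin hp hz hfix).iterate i
  have hzm := mem_immediateBasin hz
  apply subset_antisymm
  · apply isPreconnected_connectedComponentIn.subset_immediateBasin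
    · refine (connectedComponentIn_subset _ _).trans fun x hx => ?_
      exact (iterate_mem_interior_iff hp i).mp (immediateBasin_subset hp hz hx)
    · exact ⟨z, mem_connectedComponentIn (hsub hzm), hzm⟩
  · exact isPreconnected_immediateBasin.subset_connectedComponentIn hzm hsub

theorem mem_distinguishedComponent_iff (hp : 2 ≤ p.natDegree)
    (hz : z ∈ interior (filledJuliaSet p)) (hfix : p.eval z = z) {w : ℕ → ℂ} :
    w ∈ distinguishedComponent p z ↔
      w ∈ historySpace (fun x => p.eval x) ∧ ∀ i, w i ∈ immediateBasin p z := by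
  simp only [distinguishedComponent, connectedComponentIn_preimage_immediateBasin hp hz hfix,
    mem_ofPred_eq, historiesOver]
  exact ⟨fun h => ⟨h.1.1, h.2⟩, fun h => ⟨⟨h.1, h.2 0⟩, h.2⟩⟩

/-- This is the properness of `p` on the basin. A point of the closure that maps into `C` lies in
the interior of the filled Julia set, hence in the basin, so passing to the bounded closure adds no
points. -/
theorem isCompact_preimage_immediateBasin (hp : 2 ≤ p.natDegree)
    (hz : z ∈ interior (filledJuliaSet p)) {C : Set ℂ} (hC : IsCompact C)
    (hCΩ : C ⊆ immediateBasin p z) :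
    IsCompact (immediateBasin p z ∩ (fun x => p.eval x) ⁻¹' C) := by
  have h1 : immediateBasin p z ∩ (fun x => p.eval x) ⁻¹' C =
      closure (immediateBasin p z) ∩ (fun x => p.eval x) ⁻¹' C := by
    apply subset_antisymm
    · exact inter_subset_inter_left _ subset_closure
    · rintro x ⟨hx, hxC⟩
      refine ⟨closure_immediateBasin_inter ⟨hx, ?_⟩, hxC⟩
      exact (eval_mem_interior_filledJuliaSet_iff hp).mp (immediateBasin_subset hp hz (hCΩ hxC))
  rw [h1]
  apply IsCompact.inter_right
  · exact ((isBounded_filledJuliaSet hp).subset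
      ((immediateBasin_subset hp hz).trans interior_subset)).isCompact_closure
  · exact hC.isClosed.preimage p.continuous

/-- Fill in the bounded components `V` of the complement of `C`. On the frontier of `V`, which is in
`C`, all iterates are bounded by the same `R`; by the maximum principle they are so on `V`. Thus `V`
lies in the interior of the filled Julia set and, being connected and touching the basin, in the
basin. -/
theorem hasFullExhaustion_immediateBasin (hp : 2 ≤ p.natDegree)
    (hz : z ∈ interior (filledJuliaSet p)) : HasFullExhaustion (immediateBasin p z) := by
  intro C hCΩ hC
  have hCo : IsOpen Cᶜ := hC.isClosed.isOpen_compl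
  let L : Set ℂ := {ζ | ζ ∉ C → Bornology.IsBounded (connectedComponentIn Cᶜ ζ)}
  have hsub : ∀ ζ ∉ L, connectedComponentIn Cᶜ ζ ⊆ Lᶜ := by
    intro ζ hζ y hy hyL
    simp only [L, mem_ofPred_eq, Classical.not_imp] at hζ
    apply hζ.2
    rw [connectedComponentIn_eq hy]
    exact hyL (connectedComponentIn_subset _ _ hy)
  have hmem : ∀ ζ ∉ L, ζ ∈ connectedComponentIn Cᶜ ζ := by
    intro ζ hζ
    simp only [L, mem_ofPred_eq, Classical.not_imp] at hζ
    exact mem_connectedComponentIn hζ.1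
  have hLclosed : IsClosed L := by
    rw [← isOpen_compl_iff, isOpen_iff_mem_nhds]
    intro ζ hζ
    exact mem_of_superset (hCo.connectedComponentIn.mem_nhds (hmem ζ hζ)) (hsub ζ hζ)
  have hLbdd : Bornology.IsBounded L := by
    obtain ⟨R, hR⟩ := hC.isBounded.subset_closedBall (0 : ℂ)
    refine isBounded_closedBall.subset (t := closedBall (0 : ℂ) (max R 0)) ?_
    intro ζ hζ
    by_contra hζR
    have hCR : C ⊆ closedBall 0 (max R 0) :=
      hR.trans (closedBall_subset_closedBall (le_max_left _ _))
    have hpre : IsPreconnected (closedBall (0 : ℂ) (max R 0))ᶜ :=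
      isPreconnected_compl_closedBall _
    have h1 := hpre.subset_connectedComponentIn hζR (compl_subset_compl.mpr hCR)
    have h2 := (hζ fun h => hζR (hCR h)).subset h1
    have h3 : Bornology.IsBounded (univ : Set ℂ) := by
      rw [← union_compl_self (closedBall (0 : ℂ) (max R 0))]
      exact isBounded_closedBall.union h2
    exact NormedSpace.unbounded_univ ℝ ℂ h3
  refine ⟨L, isCompact_of_isClosed_isBounded hLclosed hLbdd, fun x hx h => absurd hx h, ?_, ?_⟩
  · intro ζ hζ
    by_cases hζC : ζ ∈ C
    · exact hCΩ hζC
    set V := connectedComponentIn Cᶜ ζ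
    have hVb : Bornology.IsBounded V := hζ hζC
    have hVo : IsOpen V := hCo.connectedComponentIn
    have hζV : ζ ∈ V := mem_connectedComponentIn hζC
    have hfr : frontier V ⊆ C := by
      intro x hx
      by_contra hxC
      have hx1 : x ∈ connectedComponentIn Cᶜ x := mem_connectedComponentIn hxC
      obtain ⟨y, hy1, hy2⟩ := mem_closure_iff.mp hx.1 _ hCo.connectedComponentIn hx1
      rw [connectedComponentIn_eq hy1, ← connectedComponentIn_eq hy2] at hx1
      exact hx.2 (hVo.interior_eq.symm ▸ hx1)
    obtain ⟨R, hR, hK⟩ := exists_filledJuliaSet_eq hp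
    have hVK : V ⊆ filledJuliaSet p := by
      intro x hx
      rw [hK]
      intro k
      have hd : Differentiable ℂ ((fun y => p.eval y)^[k]) := p.differentiable.iterate k
      refine norm_le_of_forall_mem_frontier_norm_le hVb hd.diffContOnCl ?_ (subset_closure hx)
      intro y hy
      have h1 := interior_subset (immediateBasin_subset hp hz (hCΩ (hfr hy)))
      rw [hK] at h1
      exact h1 k
    have hfrne : (frontier V).Nonempty := by
      rw [nonempty_frontier_iff]
      refine ⟨⟨ζ, hζV⟩, ?_⟩
      intro h
      rw [h] at hVb
      exact NormedSpace.unbounded_univ ℝ ℂ hVb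
    obtain ⟨x, hx⟩ := hfrne
    have hxΩ := hCΩ (hfr hx)
    obtain ⟨y, hyΩ, hyV⟩ := mem_closure_iff.mp hx.1 _ isOpen_immediateBasin hxΩ
    exact (isPreconnected_connectedComponentIn.subset_immediateBasin
      (interior_maximal hVK hVo) ⟨y, hyV, hyΩ⟩) hζV
  · intro ζ hζ hb
    have h1 := hb.subset
      (isPreconnected_connectedComponentIn.subset_connectedComponentIn (hmem ζ hζ) (hsub ζ hζ))
    simp only [L, mem_ofPred_eq, Classical.not_imp] at hζ
    exact hζ.2 h1

end Basin

/-! ### Proper self-maps of the disk are finite Blaschke products -/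

/-- `‖f ζ‖ → 1` as `‖ζ‖ → 1` within the unit disk. -/
def IsUnimodularAtBoundary (f : ℂ → ℂ) : Prop :=
  Tendsto (fun ζ => ‖f ζ‖) (comap norm (𝓝[<] (1 : ℝ))) (𝓝 1)

/-- Circles of radius close to 1 carry the bound `1 + ε`; the maximum principle takes it inside. -/
theorem IsUnimodularAtBoundary.norm_le_one {f : ℂ → ℂ} (hf : DifferentiableOn ℂ f (ball 0 1))
    (hb : IsUnimodularAtBoundary f) {ζ : ℂ} (hζ : ζ ∈ ball (0 : ℂ) 1) : ‖f ζ‖ ≤ 1 := by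
  apply le_of_forall_pos_le_add
  intro ε hε
  have h1 : ∀ᶠ x in comap norm (𝓝[<] (1 : ℝ)), ‖f x‖ ≤ 1 + ε :=
    hb.eventually_le_const (by linarith)
  obtain ⟨S, hS, hSf⟩ := mem_comap.mp h1
  have h2 : ∀ᶠ r in 𝓝[<] (1 : ℝ), r ∈ S ∧ ‖ζ‖ < r ∧ r < 1 := by
    filter_upwards [hS, Ioo_mem_nhdsLT (mem_ball_zero_iff.mp hζ)] with r h1 h2
    exact ⟨h1, h2⟩
  obtain ⟨r, hrS, hr1, hr2⟩ := h2.exists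
  have hr0 : r ≠ 0 := ((norm_nonneg ζ).trans_lt hr1).ne'
  refine norm_le_of_forall_mem_frontier_norm_le (isBounded_ball (x := (0 : ℂ)) (r := r)) ?_ ?_
    (subset_closure (mem_ball_zero_iff.mpr hr1))
  · apply DifferentiableOn.diffContOnCl
    rw [closure_ball _ hr0]
    exact hf.mono (closedBall_subset_ball hr2)
  · intro x hx
    rw [frontier_ball _ hr0, mem_sphere_zero_iff_norm] at hx
    exact hSf (by rw [mem_preimage, hx]; exact hrS)

/-- Without zeros the previous bound applies to `f` and to its inverse, so the modulus is
identically 1. -/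
theorem IsUnimodularAtBoundary.exists_eq_const {f : ℂ → ℂ} (hf : DifferentiableOn ℂ f (ball 0 1))
    (hb : IsUnimodularAtBoundary f) (h0 : ∀ ζ ∈ ball (0 : ℂ) 1, f ζ ≠ 0) :
    ∃ c : ℂ, ‖c‖ = 1 ∧ ∀ ζ ∈ ball (0 : ℂ) 1, f ζ = c := by
  have h1 : ∀ ζ ∈ ball (0 : ℂ) 1, ‖f ζ‖ = 1 := by
    intro ζ hζ
    refine le_antisymm (hb.norm_le_one hf hζ) ?_
    have hb' : IsUnimodularAtBoundary (fun x => (f x)⁻¹) := by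
      have := hb.inv₀ one_ne_zero
      simpa [IsUnimodularAtBoundary] using this
    have := hb'.norm_le_one (hf.inv h0) hζ
    rw [Pi.inv_apply, norm_inv] at this
    exact (inv_le_one₀ (norm_pos_iff.mpr (h0 ζ hζ))).mp this
  have hz : (0 : ℂ) ∈ ball (0 : ℂ) 1 := mem_ball_self one_pos
  refine ⟨f 0, h1 0 hz, fun ζ hζ => ?_⟩
  exact eqOn_of_isPreconnected_of_isMaxOn_norm (convex_ball (0 : ℂ) 1).isPreconnected isOpen_ball hf
    hz (fun y hy => by simp [h1 y hy, h1 0 hz]) hζ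

/-- Uniform continuity on the closed disk compares `ζ` with `ζ / ‖ζ‖`, where the factor has modulus
1. -/
theorem isUnimodularAtBoundary_blaschkeFactor {a : ℂ} (ha : ‖a‖ < 1) :
    IsUnimodularAtBoundary (blaschkeFactor a) := by
  have hcont : ContinuousOn (blaschkeFactor a) (closedBall 0 1) := fun ζ hζ =>
    (differentiableAt_blaschkeFactor (one_sub_conj_mul_ne_zero ha
      (mem_closedBall_zero_iff.mp hζ))).continuousAt.continuousWithinAt
  have hu := (isCompact_closedBall (0 : ℂ) 1).uniformContinuousOn_of_continuous hcont
  rw [Metric.uniformContinuousOn_iff] at hu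
  rw [IsUnimodularAtBoundary, Metric.tendsto_nhds]
  intro ε hε
  obtain ⟨δ, hδ, h⟩ := hu ε hε
  have h1 : Ioo (max (1 - δ) 0) 1 ∈ 𝓝[<] (1 : ℝ) := Ioo_mem_nhdsLT (max_lt (by linarith) one_pos)
  filter_upwards [preimage_mem_comap h1] with ζ hζ
  obtain ⟨h2, h3⟩ := hζ
  have h4 : 0 < ‖ζ‖ := (le_max_right _ _).trans_lt h2
  have h5 : 1 - δ < ‖ζ‖ := (le_max_left _ _).trans_lt h2
  have h0 : (‖ζ‖ : ℂ) ≠ 0 := by exact_mod_cast h4.ne'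
  have h6 : ‖ζ / ‖ζ‖‖ = 1 := by
    rw [norm_div, norm_real, norm_norm, div_self h4.ne']
  have h7 : dist ζ (ζ / ‖ζ‖) < δ := by
    rw [dist_eq_norm]
    have : ζ - ζ / ‖ζ‖ = ((‖ζ‖ - 1 : ℝ) : ℂ) * (ζ / ‖ζ‖) := by
      push_cast
      field_simp
    rw [this, norm_mul, h6, mul_one, norm_real, Real.norm_eq_abs, abs_sub_comm, abs_of_pos]
    · linarith
    · linarith
  have h8 := h ζ (mem_closedBall_zero_iff.mpr h3.le) _ (mem_closedBall_zero_iff.mpr h6.le) h7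
  have h9 := norm_blaschkeFactor_eq_one ha h6
  rw [Real.dist_eq, ← h9]
  exact (abs_norm_sub_norm_le _ _).trans_lt (by rwa [dist_eq_norm] at h8)

/-- The finite Blaschke product with the given zeros. -/
def blaschkeProduct (s : Multiset ℂ) (ζ : ℂ) : ℂ := (s.map fun a => blaschkeFactor a ζ).prod

theorem blaschkeProduct_cons (a : ℂ) (s : Multiset ℂ) (ζ : ℂ) :
    blaschkeProduct (a ::ₘ s) ζ = blaschkeFactor a ζ * blaschkeProduct s ζ := by
  simp [blaschkeProduct]

theorem norm_blaschkeProduct_eq_one {s : Multiset ℂ} (hs : ∀ a ∈ s, ‖a‖ < 1) {ζ : ℂ}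
    (hζ : ‖ζ‖ = 1) : ‖blaschkeProduct s ζ‖ = 1 := by
  induction s using Multiset.induction with
  | empty => simp [blaschkeProduct]
  | cons a s ih =>
    rw [blaschkeProduct_cons, norm_mul, ih fun b hb => hs b (Multiset.mem_cons_of_mem hb),
      norm_blaschkeFactor_eq_one (hs a (Multiset.mem_cons_self a s)) hζ, one_mul]

theorem differentiableAt_blaschkeProduct {s : Multiset ℂ} (hs : ∀ a ∈ s, ‖a‖ < 1) {ζ : ℂ}
    (hζ : ‖ζ‖ ≤ 1) : DifferentiableAt ℂ (blaschkeProduct s) ζ := by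
  induction s using Multiset.induction with
  | empty =>
    have : blaschkeProduct 0 = fun _ => 1 := by ext; simp [blaschkeProduct]
    rw [this]
    exact differentiableAt_const _
  | cons a s ih =>
    have : blaschkeProduct (a ::ₘ s) = fun ζ => blaschkeFactor a ζ * blaschkeProduct s ζ := by
      ext ζ; exact blaschkeProduct_cons a s ζ
    rw [this]
    exact (differentiableAt_blaschkeFactor (one_sub_conj_mul_ne_zero
      (hs a (Multiset.mem_cons_self a s)) hζ)).fun_mul
      (ih fun b hb => hs b (Multiset.mem_cons_of_mem hb))

theorem norm_blaschkeProduct_le_pow {s : Multiset ℂ} {ζ : ℂ} {τ : ℝ}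
    (h : ∀ a ∈ s, ‖blaschkeFactor a ζ‖ ≤ τ) (hτ : 0 ≤ τ) :
    ‖blaschkeProduct s ζ‖ ≤ τ ^ s.card := by
  induction s using Multiset.induction with
  | empty => simp [blaschkeProduct]
  | cons a s ih =>
    rw [blaschkeProduct_cons, norm_mul, Multiset.card_cons, pow_succ']
    exact mul_le_mul (h a (Multiset.mem_cons_self a s))
      (ih fun b hb => h b (Multiset.mem_cons_of_mem hb)) (norm_nonneg _) hτ

theorem IsUnimodularAtBoundary.exists_eq_blaschkeFactor_mul {f : ℂ → ℂ}
    (hf : DifferentiableOn ℂ f (ball 0 1)) (hb : IsUnimodularAtBoundary f) {a : ℂ} (ha : ‖a‖ < 1)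
    (hfa : f a = 0) :
    ∃ g : ℂ → ℂ, DifferentiableOn ℂ g (ball 0 1) ∧ IsUnimodularAtBoundary g ∧
      ∀ ζ ∈ ball (0 : ℂ) 1, f ζ = blaschkeFactor a ζ * g ζ := by
  have heq : ∀ ζ ∈ ball (0 : ℂ) 1,
      f ζ = blaschkeFactor a ζ * (dslope f a ζ * (1 - (starRingEnd ℂ) a * ζ)) := by
    intro ζ hζ
    have h1 := one_sub_conj_mul_ne_zero ha (mem_ball_zero_iff.mp hζ).le
    have h2 := sub_smul_dslope f a ζ
    rw [hfa, sub_zero, smul_eq_mul] at h2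
    rw [blaschkeFactor, ← h2, div_mul_eq_mul_div, eq_div_iff h1]
    ring
  refine ⟨_, ?_, ?_, heq⟩
  · exact ((differentiableOn_dslope (isOpen_ball.mem_nhds (mem_ball_zero_iff.mpr ha))).mpr hf).mul
      (by fun_prop)
  · have h1 := hb.div (isUnimodularAtBoundary_blaschkeFactor ha) one_ne_zero
    rw [div_one] at h1
    refine h1.congr' ?_
    have h2 : Ioo ‖a‖ 1 ∈ 𝓝[<] (1 : ℝ) := Ioo_mem_nhdsLT ha
    filter_upwards [preimage_mem_comap h2] with ζ hζ
    have h3 := one_sub_conj_mul_ne_zero ha hζ.2.le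
    have h4 : blaschkeFactor a ζ ≠ 0 := by
      rw [blaschkeFactor]
      refine div_ne_zero ?_ h3
      rw [sub_ne_zero]
      rintro rfl
      exact lt_irrefl _ hζ.1
    simp only [Pi.div_apply]
    rw [heq ζ (mem_ball_zero_iff.mpr hζ.2), norm_mul,
      mul_div_cancel_left₀ _ (norm_ne_zero_iff.mpr h4)]

/-- Proper holomorphic self-maps of the unit disk are finite Blaschke products. -/
theorem IsUnimodularAtBoundary.exists_eq_blaschkeProduct {f : ℂ → ℂ}
    (hf : DifferentiableOn ℂ f (ball 0 1)) (hb : IsUnimodularAtBoundary f) :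
    ∃ s : Multiset ℂ, (∀ a ∈ s, ‖a‖ < 1) ∧ ∃ c : ℂ, ‖c‖ = 1 ∧
      ∀ ζ ∈ ball (0 : ℂ) 1, f ζ = c * blaschkeProduct s ζ := by
  by_contra hcon
  -- If `f` is not a Blaschke product, zeros can be divided out without end: once the quotient had
  -- no zeros, it would be a unimodular constant.
  have hk : ∀ k : ℕ, ∃ s : Multiset ℂ, s.card = k ∧ (∀ a ∈ s, ‖a‖ < 1) ∧ ∃ g : ℂ → ℂ,
      DifferentiableOn ℂ g (ball 0 1) ∧ IsUnimodularAtBoundary g ∧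
      ∀ ζ ∈ ball (0 : ℂ) 1, f ζ = blaschkeProduct s ζ * g ζ := by
    intro k
    induction k with
    | zero => exact ⟨0, rfl, by simp, f, hf, hb, by simp [blaschkeProduct]⟩
    | succ k ih =>
      obtain ⟨s, hsk, hs, g, hg, hgb, hfg⟩ := ih
      by_cases h0 : ∀ ζ ∈ ball (0 : ℂ) 1, g ζ ≠ 0
      · obtain ⟨c, hc, hgc⟩ := hgb.exists_eq_const hg h0
        exact absurd ⟨s, hs, c, hc, fun ζ hζ => by rw [hfg ζ hζ, hgc ζ hζ, mul_comm]⟩ hcon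
      · push Not at h0
        obtain ⟨a, ha, hga⟩ := h0
        rw [mem_ball_zero_iff] at ha
        obtain ⟨g', hg', hgb', hgg'⟩ := hgb.exists_eq_blaschkeFactor_mul hg ha hga
        refine ⟨a ::ₘ s, by simp [hsk], ?_, g', hg', hgb', ?_⟩
        · intro b hb
          rcases Multiset.mem_cons.mp hb with rfl | h
          · exact ha
          · exact hs b h
        · intro ζ hζ
          rw [hfg ζ hζ, hgg' ζ hζ, blaschkeProduct_cons]
          ring
  -- zeros stay away from the boundary
  have h1 : ∀ᶠ x in comap norm (𝓝[<] (1 : ℝ)), 0 < ‖f x‖ := hb.eventually_const_lt one_pos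
  obtain ⟨S, hS, hSf⟩ := mem_comap.mp h1
  obtain ⟨ρ, hρ, hρS⟩ := (mem_nhdsLT_iff_exists_Ioo_subset' (zero_lt_one (α := ℝ))).mp hS
  rw [mem_Iio] at hρ
  obtain ⟨t, ht1, ht2⟩ := exists_between (max_lt hρ one_pos)
  have ht0 : 0 < t := (le_max_right _ _).trans_lt ht1
  have htn : ‖(t : ℂ)‖ = t := by rw [norm_real, Real.norm_of_nonneg ht0.le]
  have hft : f t ≠ 0 := by
    rw [← norm_pos_iff]
    exact hSf (hρS (by rw [htn]; exact ⟨(le_max_left _ _).trans_lt ht1, ht2⟩))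
  -- All zeros of `f` lie in a fixed smaller disk, so at the fixed point `t` each Blaschke factor is
  -- bounded by one constant `τ < 1`. Dividing out `k` zeros gives `‖f t‖ ≤ τ ^ k`, which
  -- contradicts `f t ≠ 0` for large `k`.
  have hcont : ContinuousOn (fun a : ℂ => ‖blaschkeFactor a t‖) (closedBall 0 (max ρ 0)) := by
    apply ContinuousOn.norm
    unfold blaschkeFactor
    refine ContinuousOn.div (by fun_prop) ?_ ?_
    · have := continuous_conj
      fun_prop
    · intro a ha
      rw [mem_closedBall_zero_iff] at ha
      exact one_sub_conj_mul_ne_zero (ha.trans_lt (max_lt hρ one_pos)) (htn.le.trans ht2.le)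
  obtain ⟨a₀, ha₀, hmax⟩ := (isCompact_closedBall (0 : ℂ) (max ρ 0)).exists_isMaxOn
    ⟨0, by simp⟩ hcont
  set τ := ‖blaschkeFactor a₀ t‖
  have hτ1 : τ < 1 := norm_blaschkeFactor_lt_one
    ((mem_closedBall_zero_iff.mp ha₀).trans_lt (max_lt hρ one_pos)) (by rw [htn]; exact ht2)
  obtain ⟨k, hk'⟩ := exists_pow_lt_of_lt_one (norm_pos_iff.mpr hft) hτ1
  obtain ⟨s, hsk, hs, g, hg, hgb, hfg⟩ := hk k
  have htb : (t : ℂ) ∈ ball (0 : ℂ) 1 := by rw [mem_ball_zero_iff, htn]; exact ht2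
  have h2 : ∀ a ∈ s, ‖blaschkeFactor a t‖ ≤ τ := by
    intro a ha
    apply hmax
    rw [mem_closedBall_zero_iff]
    by_contra hρa
    push Not at hρa
    have h3 : 0 < ‖f a‖ := hSf (hρS ⟨(le_max_left _ _).trans_lt hρa, hs a ha⟩)
    obtain ⟨s', rfl⟩ := Multiset.exists_cons_of_mem ha
    rw [hfg a (mem_ball_zero_iff.mpr (hs a ha)), blaschkeProduct_cons] at h3
    simp [blaschkeFactor] at h3
  have h4 := norm_blaschkeProduct_le_pow h2 (norm_nonneg _)
  have h5 := hgb.norm_le_one hg htb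
  rw [hfg t htb, norm_mul] at hk'
  rw [hsk] at h4
  have := mul_le_of_le_one_right (norm_nonneg (blaschkeProduct s t)) h5
  linarith

/-! ### Counting the solutions of a Blaschke equation -/

/-- The polynomial whose roots are the solutions of `c * blaschkeProduct s ζ = w`. -/
def blaschkePolynomial (s : Multiset ℂ) (c w : ℂ) : ℂ[X] :=
  C c * (s.map fun a => X - C a).prod - C w * (s.map fun a => 1 - C ((starRingEnd ℂ) a) * X).prod

theorem eval_blaschkePolynomial (s : Multiset ℂ) (c w ζ : ℂ) :
    (blaschkePolynomial s c w).eval ζ = c * (s.map fun a => ζ - a).prod -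
      w * (s.map fun a => 1 - (starRingEnd ℂ) a * ζ).prod := by
  simp [blaschkePolynomial, eval_multiset_prod, Multiset.map_map]

theorem prod_one_sub_conj_mul_ne_zero {s : Multiset ℂ} (hs : ∀ a ∈ s, ‖a‖ < 1) {ζ : ℂ}
    (hζ : ‖ζ‖ ≤ 1) : (s.map fun a => 1 - (starRingEnd ℂ) a * ζ).prod ≠ 0 := by
  refine Multiset.prod_ne_zero fun hx => ?_
  obtain ⟨a, ha, ha0⟩ := Multiset.mem_map.mp hx
  revert ha0
  exact one_sub_conj_mul_ne_zero (hs a ha) hζ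

theorem eval_blaschkePolynomial_of_norm_le {s : Multiset ℂ} (hs : ∀ a ∈ s, ‖a‖ < 1) (c w : ℂ)
    {ζ : ℂ} (hζ : ‖ζ‖ ≤ 1) : (blaschkePolynomial s c w).eval ζ =
      (s.map fun a => 1 - (starRingEnd ℂ) a * ζ).prod * (c * blaschkeProduct s ζ - w) := by
  have h1 : (s.map fun a => 1 - (starRingEnd ℂ) a * ζ).prod * blaschkeProduct s ζ =
      (s.map fun a => ζ - a).prod := by
    rw [blaschkeProduct, ← Multiset.prod_map_mul]
    congr 1
    apply Multiset.map_congr rfl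
    intro a ha
    rw [blaschkeFactor, mul_div_cancel₀ _ (one_sub_conj_mul_ne_zero (hs a ha) hζ)]
  rw [eval_blaschkePolynomial, ← h1]
  ring

theorem norm_prod_one_sub_conj_mul_le {s : Multiset ℂ} (hs : ∀ a ∈ s, ‖a‖ < 1) {ζ : ℂ}
    (hζ : 1 ≤ ‖ζ‖) : ‖(s.map fun a => 1 - (starRingEnd ℂ) a * ζ).prod‖ ≤
      ‖(s.map fun a => ζ - a).prod‖ := by
  induction s using Multiset.induction with
  | empty => simp
  | cons a s ih =>
    simp only [Multiset.map_cons, Multiset.prod_cons, norm_mul]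
    refine mul_le_mul ?_ (ih fun b hb => hs b (Multiset.mem_cons_of_mem hb)) (norm_nonneg _)
      (norm_nonneg _)
    have h := normSq_one_sub_conj_mul a ζ
    have ha := hs a (Multiset.mem_cons_self a s)
    rw [← abs_of_nonneg (norm_nonneg (ζ - a)), ← abs_of_nonneg (norm_nonneg (1 - _)), ← sq_le_sq]
    rw [normSq_eq_norm_sq, normSq_eq_norm_sq, normSq_eq_norm_sq, normSq_eq_norm_sq] at h
    have h1 : (1 - ‖a‖ ^ 2) * (1 - ‖ζ‖ ^ 2) ≤ 0 :=
      mul_nonpos_of_nonneg_of_nonpos (by nlinarith [norm_nonneg a]) (by nlinarith)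
    linarith

/-- Outside the open disk the product of the numerators dominates that of the denominators and is
nonzero, so it cannot equal the latter multiplied by a number of modulus `‖w‖ < 1`. -/
theorem norm_lt_one_of_isRoot_blaschkePolynomial {s : Multiset ℂ} (hs : ∀ a ∈ s, ‖a‖ < 1)
    {c w : ℂ} (hc : ‖c‖ = 1) (hw : ‖w‖ < 1) {ζ : ℂ} (h : (blaschkePolynomial s c w).eval ζ = 0) :
    ‖ζ‖ < 1 := by
  by_contra hζ
  push Not at hζ
  rw [eval_blaschkePolynomial, sub_eq_zero] at h
  have h1 := congrArg norm h
  rw [norm_mul, norm_mul, hc, one_mul] at h1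
  have h2 := norm_prod_one_sub_conj_mul_le hs hζ
  have h3 : 0 < ‖(s.map fun a => ζ - a).prod‖ := by
    rw [norm_pos_iff]
    refine Multiset.prod_ne_zero fun hx => ?_
    obtain ⟨a, ha, ha0⟩ := Multiset.mem_map.mp hx
    rw [sub_eq_zero] at ha0
    subst ha0
    exact absurd (hs _ ha) (not_lt.mpr hζ)
  nlinarith [norm_nonneg w]

theorem natDegree_and_coeff_prod_one_sub (s : Multiset ℂ) (hs : ∀ a ∈ s, ‖a‖ < 1) :
    (s.map fun a => 1 - C ((starRingEnd ℂ) a) * X).prod.natDegree ≤ s.card ∧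
    ‖(s.map fun a => 1 - C ((starRingEnd ℂ) a) * X).prod.coeff s.card‖ ≤ 1 := by
  induction s using Multiset.induction with
  | empty => simp
  | cons a s ih =>
    obtain ⟨h1, h2⟩ := ih fun b hb => hs b (Multiset.mem_cons_of_mem hb)
    have hlin : (1 - C ((starRingEnd ℂ) a) * X).natDegree ≤ 1 := by
      compute_degree
    simp only [Multiset.map_cons, Multiset.prod_cons, Multiset.card_cons]
    refine ⟨(natDegree_mul_le).trans (by omega), ?_⟩
    rw [add_comm, coeff_mul_add_eq_of_natDegree_le hlin h1, norm_mul]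
    refine mul_le_one₀ ?_ (norm_nonneg _) h2
    have : (1 - C ((starRingEnd ℂ) a) * X : ℂ[X]).coeff 1 = -(starRingEnd ℂ) a := by
      simp [coeff_one]
    rw [this, norm_neg, RCLike.norm_conj]
    exact (hs a (Multiset.mem_cons_self a s)).le

/-- The degree does not drop: the top coefficient is `c` minus `w` times a number of modulus at most
1, and `‖w‖ < ‖c‖`. -/
theorem card_roots_blaschkePolynomial {s : Multiset ℂ} (hs : ∀ a ∈ s, ‖a‖ < 1)
    {c w : ℂ} (hc : ‖c‖ = 1) (hw : ‖w‖ < 1) :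
    (blaschkePolynomial s c w).roots.card = s.card := by
  rw [← (IsAlgClosed.splits _).natDegree_eq_card_roots]
  obtain ⟨h1, h2⟩ := natDegree_and_coeff_prod_one_sub s hs
  have h3 : (s.map fun a => X - C a).prod.natDegree = s.card :=
    natDegree_multiset_prod_X_sub_C_eq_card s
  have h4 : (s.map fun a => X - C a).prod.Monic := monic_multiset_prod_of_monic _ _ fun a _ =>
    monic_X_sub_C a
  apply natDegree_eq_of_le_of_coeff_ne_zero
  · refine (natDegree_sub_le _ _).trans (max_le ?_ ?_)
    · exact (natDegree_C_mul_le _ _).trans h3.le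
    · exact (natDegree_C_mul_le _ _).trans h1
  · rw [blaschkePolynomial, coeff_sub, coeff_C_mul, coeff_C_mul]
    nth_rewrite 1 [← h3]
    rw [h4.coeff_natDegree, mul_one, sub_ne_zero]
    intro h
    have h5 := congrArg norm h
    rw [hc, norm_mul] at h5
    nlinarith [norm_nonneg w]

/-! ### Lifting a Blaschke product to a strip -/

/-- The logarithmic lift of `blaschkeFactor a` through `x ↦ exp (-x)`. -/
def blaschkeLift (a x : ℂ) : ℂ :=
  x - log (1 - a * exp x) + log (1 - (starRingEnd ℂ) a * exp (-x))

theorem one_sub_ne_zero_of_norm_lt_one {w : ℂ} (hw : ‖w‖ < 1) : 1 - w ≠ 0 := by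
  intro h
  rw [sub_eq_zero] at h
  rw [← h, norm_one] at hw
  exact lt_irrefl _ hw

theorem one_sub_mem_slitPlane {w : ℂ} (hw : ‖w‖ < 1) : 1 - w ∈ slitPlane := by
  left
  have := (abs_le.mp (abs_re_le_norm w)).2
  simp only [sub_re, one_re]
  linarith

theorem exp_neg_blaschkeLift {a x : ℂ} (h1 : ‖a * exp x‖ < 1)
    (h2 : ‖(starRingEnd ℂ) a * exp (-x)‖ < 1) :
    exp (-blaschkeLift a x) = blaschkeFactor a (exp (-x)) := by
  have h1' := one_sub_ne_zero_of_norm_lt_one h1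
  have h2' := one_sub_ne_zero_of_norm_lt_one h2
  rw [blaschkeLift, blaschkeFactor, show -(x - log (1 - a * exp x) +
    log (1 - (starRingEnd ℂ) a * exp (-x))) = -x + log (1 - a * exp x) -
    log (1 - (starRingEnd ℂ) a * exp (-x)) by ring, exp_sub, exp_add, exp_log h1', exp_log h2']
  congr 1
  have : exp (-x) * exp x = 1 := by rw [← exp_add]; simp
  linear_combination (-a) * this

theorem hasDerivAt_blaschkeLift {a x : ℂ} (h1 : ‖a * exp x‖ < 1)
    (h2 : ‖(starRingEnd ℂ) a * exp (-x)‖ < 1) :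
    HasDerivAt (blaschkeLift a)
      ((1 - a * exp x)⁻¹ + (1 - (starRingEnd ℂ) a * exp (-x))⁻¹ - 1) x := by
  have h1' := one_sub_ne_zero_of_norm_lt_one h1
  have h2' := one_sub_ne_zero_of_norm_lt_one h2
  have d1 : HasDerivAt (fun x => 1 - a * exp x) (-(a * exp x)) x := by
    simpa using ((hasDerivAt_exp x).const_mul a).const_sub 1
  have d2 : HasDerivAt (fun x => 1 - (starRingEnd ℂ) a * exp (-x))
      ((starRingEnd ℂ) a * exp (-x)) x := by
    have := (((hasDerivAt_neg x).cexp).const_mul ((starRingEnd ℂ) a)).const_sub 1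
    simpa using this
  have := ((hasDerivAt_id x).sub (d1.clog (one_sub_mem_slitPlane h1))).add
    (d2.clog (one_sub_mem_slitPlane h2))
  refine HasDerivAt.congr_deriv this ?_
  field_simp
  ring

theorem le_re_inv_one_sub {w : ℂ} (hw : ‖w‖ < 1) : (1 + ‖w‖)⁻¹ ≤ ((1 - w)⁻¹).re := by
  have h1 := one_sub_ne_zero_of_norm_lt_one hw
  have h2 : 0 < normSq (1 - w) := normSq_pos.mpr h1
  have h3 : 0 < 1 + ‖w‖ := by positivity
  rw [inv_re, inv_eq_one_div, div_le_div_iff₀ h3 h2]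
  have h4 : normSq (1 - w) = 1 - 2 * w.re + ‖w‖ ^ 2 := by
    rw [← normSq_eq_norm_sq, normSq_apply, normSq_apply]
    simp only [sub_re, one_re, sub_im, one_im]
    ring
  have h5 := abs_le.mp (abs_re_le_norm w)
  rw [h4]
  simp only [sub_re, one_re]
  nlinarith [norm_nonneg w]

/-- On the imaginary axis the derivative of the lift is the Poisson kernel `(1 - ‖a‖ ^ 2) / ‖1 - a *
exp x‖ ^ 2`, which is positive; this persists on a strip. The width is chosen so that `‖a * exp x‖ ≤
ρ`, which amounts to `4 * ‖a‖ ≤ (1 + ‖a‖) ^ 2`, and `δ > 0` amounts to `ρ * ‖a‖ < 1`. -/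
theorem exists_blaschkeLift_estimates {a : ℂ} (ha : ‖a‖ < 1) :
    ∃ T > 0, ∃ δ > 0, ∃ M : ℝ, ∀ x : ℂ, 0 ≤ x.re → x.re ≤ T →
      ‖a * exp x‖ < 1 ∧ ‖(starRingEnd ℂ) a * exp (-x)‖ < 1 ∧
      δ ≤ ((1 - a * exp x)⁻¹ + (1 - (starRingEnd ℂ) a * exp (-x))⁻¹ - 1).re ∧
      ‖blaschkeLift a x - x‖ ≤ M := by
  set ρ : ℝ := (1 + ‖a‖) / 2 with hρ
  have hρ1 : ρ < 1 := by rw [hρ]; linarith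
  have hρa : ‖a‖ ≤ ρ := by rw [hρ]; linarith
  have hρ0 : 0 ≤ ρ := (norm_nonneg a).trans hρa
  have ha1 : 0 < 1 + ‖a‖ := by positivity
  have hT : 1 < 2 / (1 + ‖a‖) := by rw [lt_div_iff₀ ha1]; linarith
  have hcont : ContinuousOn (fun w : ℂ => log (1 - w)) (closedBall 0 ρ) := by
    refine ContinuousOn.clog (by fun_prop) fun w hw => one_sub_mem_slitPlane ?_
    exact (mem_closedBall_zero_iff.mp hw).trans_lt hρ1
  obtain ⟨M, hM⟩ := (isCompact_closedBall (0 : ℂ) ρ).exists_bound_of_continuousOn hcont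
  refine ⟨Real.log (2 / (1 + ‖a‖)), Real.log_pos hT, (1 + ρ)⁻¹ + (1 + ‖a‖)⁻¹ - 1, ?_, M + M, ?_⟩
  · have h1 : 0 < 1 + ρ := by positivity
    have : (1 + ρ)⁻¹ + (1 + ‖a‖)⁻¹ - 1 = (1 - ρ * ‖a‖) / ((1 + ρ) * (1 + ‖a‖)) := by
      field_simp
      ring
    rw [this]
    apply div_pos _ (by positivity)
    nlinarith [norm_nonneg a]
  · intro x hx0 hxT
    have h1 : ‖a * exp x‖ ≤ ρ := by
      rw [norm_mul, norm_exp]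
      have : Real.exp x.re ≤ 2 / (1 + ‖a‖) := by
        rw [← Real.exp_log (show 0 < 2 / (1 + ‖a‖) by positivity)]
        exact Real.exp_le_exp.mpr hxT
      refine (mul_le_mul_of_nonneg_left this (norm_nonneg a)).trans ?_
      rw [hρ, ← mul_div_assoc, div_le_div_iff₀ ha1 two_pos]
      nlinarith [sq_nonneg (1 - ‖a‖)]
    have h2 : ‖(starRingEnd ℂ) a * exp (-x)‖ ≤ ‖a‖ := by
      rw [norm_mul, norm_exp, RCLike.norm_conj]
      refine mul_le_of_le_one_right (norm_nonneg a) (Real.exp_le_one_iff.mpr ?_)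
      simpa using hx0
    have h1' := h1.trans_lt hρ1
    have h2' := h2.trans_lt ha
    refine ⟨h1', h2', ?_, ?_⟩
    · have h3 := le_re_inv_one_sub h1'
      have h4 := le_re_inv_one_sub h2'
      have h5 : (1 + ρ)⁻¹ ≤ (1 + ‖a * exp x‖)⁻¹ :=
        inv_anti₀ (by positivity) (by linarith)
      have h6 : (1 + ‖a‖)⁻¹ ≤ (1 + ‖(starRingEnd ℂ) a * exp (-x)‖)⁻¹ :=
        inv_anti₀ (by positivity) (by linarith)
      simp only [sub_re, add_re, one_re]
      linarith
    · rw [show blaschkeLift a x - x = log (1 - (starRingEnd ℂ) a * exp (-x)) -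
        log (1 - a * exp x) by rw [blaschkeLift]; ring]
      refine (norm_sub_le _ _).trans (add_le_add ?_ ?_)
      · exact hM _ (mem_closedBall_zero_iff.mpr (h2.trans hρa))
      · exact hM _ (mem_closedBall_zero_iff.mpr h1)

theorem blaschkeLift_add_two_pi_mul_I (a x : ℂ) :
    blaschkeLift a (x + 2 * Real.pi * I) = blaschkeLift a x + 2 * Real.pi * I := by
  have h1 : exp (x + 2 * Real.pi * I) = exp x := exp_periodic x
  have h2 : exp (-(x + 2 * Real.pi * I)) = exp (-x) := by rw [exp_neg, h1, exp_neg]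
  rw [blaschkeLift, blaschkeLift, h1, h2]
  ring

/-- `P` is a lift of a degree `n` map `f` of the annulus `exp (-T) ≤ ‖ζ‖ ≤ 1` through
`x ↦ exp (-x)`, whose derivative has real part at least `δ`. -/
structure IsStripLift (f P : ℂ → ℂ) (n : ℕ) (T δ M : ℝ) : Prop where
  pos : 0 < T
  exp_neg : ∀ x : ℂ, 0 ≤ x.re → x.re ≤ T → exp (-P x) = f (exp (-x))
  deriv : ∀ x : ℂ, 0 ≤ x.re → x.re ≤ T → ∃ d : ℂ, HasDerivAt P d x ∧ δ ≤ d.re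
  periodic : ∀ x : ℂ, P (x + 2 * Real.pi * I) = P x + n * (2 * Real.pi * I)
  bound : ∀ x : ℂ, 0 ≤ x.re → x.re ≤ T → ‖P x - n * x‖ ≤ M

/-- Products lift to sums: the derivative bounds add up and the strip shrinks to the narrowest one.
The empty product has a constant lift, for which only `δ = 0` is possible. -/
theorem exists_isStripLift_blaschkeProduct (s : Multiset ℂ) (hs : ∀ a ∈ s, ‖a‖ < 1) {c : ℂ}
    (hc : ‖c‖ = 1) : ∃ P T δ M, (s ≠ 0 → 0 < δ) ∧ 0 ≤ δ ∧
      IsStripLift (fun ζ => c * blaschkeProduct s ζ) P s.card T δ M := by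
  induction s using Multiset.induction with
  | empty =>
    have hc0 : c ≠ 0 := by rw [← norm_pos_iff, hc]; exact one_pos
    refine ⟨fun _ => -log c, 1, 0, ‖log c‖, by simp, le_rfl, one_pos, ?_, ?_, ?_, ?_⟩
    · intro x _ _
      simp [blaschkeProduct, exp_log hc0]
    · intro x _ _
      exact ⟨0, hasDerivAt_const _ _, by simp⟩
    · simp
    · simp
  | cons a s ih =>
    obtain ⟨P, T, δ, M, -, hδ, hP⟩ := ih fun b hb => hs b (Multiset.mem_cons_of_mem hb)
    obtain ⟨T', hT', δ', hδ', M', h⟩ :=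
      exists_blaschkeLift_estimates (hs a (Multiset.mem_cons_self a s))
    refine ⟨fun x => P x + blaschkeLift a x, min T T', δ + δ', M + M', fun _ => by linarith,
      by linarith, lt_min hP.pos hT', ?_, ?_, ?_, ?_⟩
    · intro x h0 hT
      obtain ⟨h1, h2, -⟩ := h x h0 (hT.trans (min_le_right _ _))
      have h3 := hP.exp_neg x h0 (hT.trans (min_le_left _ _))
      rw [neg_add, exp_add, h3, exp_neg_blaschkeLift h1 h2, blaschkeProduct_cons]
      ring
    · intro x h0 hT
      obtain ⟨h1, h2, h3, -⟩ := h x h0 (hT.trans (min_le_right _ _))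
      obtain ⟨d, hd, hdδ⟩ := hP.deriv x h0 (hT.trans (min_le_left _ _))
      exact ⟨_, hd.add (hasDerivAt_blaschkeLift h1 h2), by rw [add_re]; linarith⟩
    · intro x
      rw [hP.periodic, blaschkeLift_add_two_pi_mul_I, Multiset.card_cons]
      push_cast
      ring
    · intro x h0 hT
      obtain ⟨-, -, -, h4⟩ := h x h0 (hT.trans (min_le_right _ _))
      have h5 := hP.bound x h0 (hT.trans (min_le_left _ _))
      rw [Multiset.card_cons, show P x + blaschkeLift a x - ((s.card + 1 : ℕ) : ℂ) * x =
        (P x - s.card * x) + (blaschkeLift a x - x) by push_cast; ring]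
      exact (norm_add_le _ _).trans (add_le_add h5 h4)

theorem blaschkeFactor_zero (ζ : ℂ) : blaschkeFactor 0 ζ = ζ := by simp [blaschkeFactor]

/-- The factor with zero 0 lifts to the identity and contributes exactly 1 to the derivative. At
least one more factor contributes a positive amount, whence the expansion `δ > 1`. -/
theorem exists_isStripLift_of_zero_mem {s : Multiset ℂ} (hs : ∀ a ∈ s, ‖a‖ < 1) (h0 : 0 ∈ s)
    (hcard : 2 ≤ s.card) {c : ℂ} (hc : ‖c‖ = 1) : ∃ P T δ M, 1 < δ ∧
      IsStripLift (fun ζ => c * blaschkeProduct s ζ) P s.card T δ M := by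
  obtain ⟨t, rfl⟩ := Multiset.exists_cons_of_mem h0
  rw [Multiset.card_cons] at hcard
  obtain ⟨P, T, δ, M, hδ, -, hP⟩ := exists_isStripLift_blaschkeProduct t
    (fun b hb => hs b (Multiset.mem_cons_of_mem hb)) hc
  have ht : t ≠ 0 := by rw [← Multiset.card_pos]; omega
  refine ⟨fun x => P x + x, T, δ + 1, M, by linarith [hδ ht], hP.pos, ?_, ?_, ?_, ?_⟩
  · intro x h0 hT
    have h3 := hP.exp_neg x h0 hT
    rw [neg_add, exp_add, h3, blaschkeProduct_cons, blaschkeFactor_zero]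
    ring
  · intro x h0 hT
    obtain ⟨d, hd, hdδ⟩ := hP.deriv x h0 hT
    exact ⟨_, hd.add (hasDerivAt_id x), by rw [add_re, one_re]; linarith⟩
  · intro x
    rw [hP.periodic, Multiset.card_cons]
    push_cast
    ring
  · intro x h0 hT
    have h5 := hP.bound x h0 hT
    rwa [Multiset.card_cons, show P x + x - ((t.card + 1 : ℕ) : ℂ) * x =
        P x - t.card * x by push_cast; ring]

theorem IsStripLift.mono {f P : ℂ → ℂ} {n : ℕ} {T δ δ' M : ℝ} (hP : IsStripLift f P n T δ M)
    (h : δ' ≤ δ) : IsStripLift f P n T δ' M where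
  __ := hP
  deriv x h0 hT := by
    obtain ⟨d, hd, hdδ⟩ := hP.deriv x h0 hT
    exact ⟨d, hd, h.trans hdδ⟩

/-- Along the segment from `x` to `y`, which stays in the convex strip, the derivative of the right
side is `‖y - x‖ ^ 2` times the real part of the derivative of `P`. Injectivity of `P` for `δ > 0`
follows. -/
theorem IsStripLift.le_re_conj_mul {f P : ℂ → ℂ} {n : ℕ} {T δ M : ℝ}
    (hP : IsStripLift f P n T δ M) {x y : ℂ} (hx0 : 0 ≤ x.re) (hxT : x.re ≤ T)
    (hy0 : 0 ≤ y.re) (hyT : y.re ≤ T) :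
    δ * ‖y - x‖ ^ 2 ≤ ((starRingEnd ℂ) (y - x) * (P y - P x)).re := by
  set γ : ℝ → ℂ := fun u => x + u * (y - x)
  have hγ : ∀ u ∈ Icc (0 : ℝ) 1, 0 ≤ (γ u).re ∧ (γ u).re ≤ T := by
    intro u hu
    obtain ⟨h0, h1⟩ := hu
    have : (γ u).re = (1 - u) * x.re + u * y.re := by
      simp only [γ, add_re, re_ofReal_mul, sub_re]
      ring
    rw [this]
    constructor
    · nlinarith
    · nlinarith
  set F : ℝ → ℝ := fun u => ((starRingEnd ℂ) (y - x) * P (γ u)).re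
  have hF : ∀ u ∈ Icc (0 : ℝ) 1, ∃ d, HasDerivAt F d u ∧ δ * ‖y - x‖ ^ 2 ≤ d := by
    intro u hu
    obtain ⟨d, hd, hdδ⟩ := hP.deriv (γ u) (hγ u hu).1 (hγ u hu).2
    have h1 : HasDerivAt γ (y - x) u := by
      exact (((hasDerivAt_id u).ofReal_comp.mul_const (y - x)).const_add x).congr_deriv (by simp)
    have h2 : HasDerivAt (fun u => P (γ u)) (d * (y - x)) u := hd.comp u h1
    have h3 := h2.const_mul ((starRingEnd ℂ) (y - x))
    refine ⟨_, (reCLM.hasFDerivAt.comp_hasDerivAt u h3), ?_⟩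
    have h4 : (starRingEnd ℂ) (y - x) * (d * (y - x)) = ((‖y - x‖ ^ 2 : ℝ) : ℂ) * d := by
      rw [← normSq_eq_norm_sq, normSq_eq_conj_mul_self]
      ring
    rw [h4, reCLM_apply, re_ofReal_mul, mul_comm]
    exact mul_le_mul_of_nonneg_left hdδ (sq_nonneg _)
  have h := (convex_Icc (0 : ℝ) 1).mul_sub_le_image_sub_of_le_deriv
    (f := F) (C := δ * ‖y - x‖ ^ 2) ?_ ?_ ?_ 0 (by simp) 1 (by simp) zero_le_one
  · simp only [F, γ, sub_zero, mul_one, ofReal_one, one_mul, add_sub_cancel, ofReal_zero, zero_mul,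
      add_zero, ← sub_re, ← mul_sub] at h
    exact h
  · intro u hu
    obtain ⟨d, hd, -⟩ := hF u hu
    exact hd.continuousAt.continuousWithinAt
  · intro u hu
    obtain ⟨d, hd, -⟩ := hF u (interior_subset hu)
    exact hd.differentiableAt.differentiableWithinAt
  · intro u hu
    obtain ⟨d, hd, hdδ⟩ := hF u (interior_subset hu)
    rwa [hd.deriv]

/-! ### Extending a strip lift to a homeomorphism of the plane -/

/-- A continuous family of increasing bijections of the line has a continuous family of
inverses. -/
theorem exists_continuous_inverse_of_strictMono {Y : Type*} [TopologicalSpace Y] (F : ℝ → Y → ℝ)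
    (hF : Continuous fun q : ℝ × Y => F q.1 q.2) (hmono : ∀ y, StrictMono fun t => F t y)
    (hsurj : ∀ y, Function.Surjective fun t => F t y) :
    ∃ G : ℝ → Y → ℝ, (Continuous fun q : ℝ × Y => G q.1 q.2) ∧ (∀ s y, F (G s y) y = s) ∧
      ∀ t y, G (F t y) y = t := by
  choose G hG using fun s y => hsurj y s
  refine ⟨G, ?_, hG, fun t y => (hmono y).injective (hG _ y)⟩
  rw [continuous_iff_continuousAt]
  rintro ⟨s, y⟩
  rw [ContinuousAt, Metric.tendsto_nhds]
  intro ε hε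
  have h1 : F (G s y - ε) y < s := by
    conv_rhs => rw [← hG s y]
    exact hmono y (by linarith)
  have h2 : s < F (G s y + ε) y := by
    conv_lhs => rw [← hG s y]
    exact hmono y (by linarith)
  have c1 : Continuous fun q : ℝ × Y => F (G s y - ε) q.2 :=
    hF.comp (continuous_const.prodMk continuous_snd)
  have c2 : Continuous fun q : ℝ × Y => F (G s y + ε) q.2 :=
    hF.comp (continuous_const.prodMk continuous_snd)
  have e1 : ∀ᶠ q : ℝ × Y in 𝓝 (s, y), F (G s y - ε) q.2 < q.1 :=
    (isOpen_lt c1 continuous_fst).mem_nhds h1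
  have e2 : ∀ᶠ q : ℝ × Y in 𝓝 (s, y), q.1 < F (G s y + ε) q.2 :=
    (isOpen_lt continuous_fst c2).mem_nhds h2
  filter_upwards [e1, e2] with q h3 h4
  have h5 := hG q.1 q.2
  rw [← h5] at h3 h4
  have h6 := (hmono q.2).lt_iff_lt.mp h3
  have h7 := (hmono q.2).lt_iff_lt.mp h4
  rw [Real.dist_eq, abs_lt]
  constructor <;> linarith

theorem surjective_of_tendsto {f : ℝ → ℝ} (hf : Continuous f) {g₁ g₂ : ℝ → ℝ}
    (h₁ : Tendsto g₁ atTop atTop) (h₂ : Tendsto g₂ atBot atBot) (hg₁ : ∀ t, 0 ≤ t → g₁ t ≤ f t)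
    (hg₂ : ∀ t ≤ 0, f t ≤ g₂ t) : Function.Surjective f :=
  hf.surjective (tendsto_atTop_mono' _ ((eventually_ge_atTop 0).mono hg₁) h₁)
    (tendsto_atBot_mono' _ ((eventually_le_atBot 0).mono hg₂) h₂)

/-- The nearest point of `[0, T]`. -/
def clampTo (T t : ℝ) : ℝ := max 0 (min t T)

theorem clampTo_nonneg (T t : ℝ) : 0 ≤ clampTo T t := le_max_left _ _

theorem clampTo_le {T : ℝ} (hT : 0 ≤ T) (t : ℝ) : clampTo T t ≤ T :=
  max_le hT (min_le_right _ _)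

theorem clampTo_eq {T t : ℝ} (h0 : 0 ≤ t) (hT : t ≤ T) : clampTo T t = t := by
  rw [clampTo, min_eq_left hT, max_eq_right h0]

theorem continuous_clampTo (T : ℝ) : Continuous (clampTo T) := by
  unfold clampTo
  fun_prop

theorem clampTo_mono (T : ℝ) : Monotone (clampTo T) := fun s t h => by
  unfold clampTo
  gcongr

theorem clampTo_add {T : ℝ} (hT : 0 ≤ T) (t : ℝ) :
    clampTo T t + min t 0 + max (t - T) 0 = t := by
  unfold clampTo
  rcases le_total t 0 with h | h
  · rw [min_eq_left (h.trans hT), max_eq_left h, min_eq_left h, max_eq_right (by linarith)]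
    ring
  · rcases le_total t T with h' | h'
    · rw [min_eq_left h', max_eq_right h, min_eq_right h, max_eq_right (by linarith)]
      ring
    · rw [min_eq_right h', max_eq_right hT, min_eq_right h, max_eq_left (by linarith)]
      ring

/-- The radial part of a strip lift, extended to the whole plane such that it is `n * t` for
large `t`. -/
def radialExtension (P : ℂ → ℂ) (n : ℕ) (T δ t θ : ℝ) : ℝ :=
  max ((P ⟨clampTo T t, θ⟩).re + min t 0 + δ * max (t - T) 0) (min (n * t) ((n + 1) * (t - T)))

section
variable {f P : ℂ → ℂ} {n : ℕ} {T δ M : ℝ}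

theorem IsStripLift.re_eq_zero (hP : IsStripLift f P n T δ M) (hf : ∀ ζ, ‖ζ‖ = 1 → ‖f ζ‖ = 1)
    (θ : ℝ) : (P ⟨0, θ⟩).re = 0 := by
  have h1 := hP.exp_neg ⟨0, θ⟩ le_rfl hP.pos.le
  have h2 := hf (exp (-⟨0, θ⟩)) (by simp [norm_exp])
  rw [← h1, norm_exp, neg_re, Real.exp_eq_one_iff] at h2
  linarith

theorem IsStripLift.continuousOn (hP : IsStripLift f P n T δ M) :
    ContinuousOn P {x | 0 ≤ x.re ∧ x.re ≤ T} := fun x hx => by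
  obtain ⟨d, hd, -⟩ := hP.deriv x hx.1 hx.2
  exact hd.continuousAt.continuousWithinAt

theorem IsStripLift.mul_sub_le (hP : IsStripLift f P n T δ M) {s t : ℝ} (θ : ℝ) (hs : 0 ≤ s)
    (hst : s ≤ t) (ht : t ≤ T) : δ * (t - s) ≤ (P ⟨t, θ⟩).re - (P ⟨s, θ⟩).re := by
  rcases hst.eq_or_lt with rfl | hlt
  · simp
  have h := hP.le_re_conj_mul (x := ⟨s, θ⟩) (y := ⟨t, θ⟩) hs (hst.trans ht) (hs.trans hst) ht
  have h1 : (⟨t, θ⟩ - ⟨s, θ⟩ : ℂ) = ((t - s : ℝ) : ℂ) := by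
    apply Complex.ext <;> simp
  rw [h1, conj_ofReal, re_ofReal_mul, sub_re, norm_real, Real.norm_eq_abs, sq_abs] at h
  have h2 : 0 < t - s := by linarith
  nlinarith

theorem IsStripLift.injOn (hP : IsStripLift f P n T δ M) (hδ : 0 < δ) :
    InjOn P {x | 0 ≤ x.re ∧ x.re ≤ T} := by
  intro x hx y hy h
  have := hP.le_re_conj_mul hx.1 hx.2 hy.1 hy.2
  rw [h, sub_self, mul_zero, zero_re] at this
  have h1 : ‖y - x‖ ^ 2 ≤ 0 := by
    by_contra h2
    push Not at h2
    nlinarith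
  have h2 : ‖y - x‖ = 0 := by nlinarith [sq_nonneg ‖y - x‖]
  exact (sub_eq_zero.mp (norm_eq_zero.mp h2)).symm

theorem continuous_complex_mk : Continuous fun q : ℝ × ℝ => (⟨q.1, q.2⟩ : ℂ) :=
  equivRealProdCLM.symm.continuous

theorem IsStripLift.continuous_clampTo (hP : IsStripLift f P n T δ M) :
    Continuous fun q : ℝ × ℝ => P ⟨clampTo T q.1, q.2⟩ := by
  refine hP.continuousOn.comp_continuous
    (continuous_complex_mk.comp (((_root_.continuous_clampTo T).comp continuous_fst).prodMk
      continuous_snd)) fun q => ⟨clampTo_nonneg _ _, clampTo_le hP.pos.le _⟩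

theorem IsStripLift.continuous_radialExtension (hP : IsStripLift f P n T δ M) :
    Continuous fun q : ℝ × ℝ => radialExtension P n T δ q.1 q.2 := by
  have := continuous_re.comp hP.continuous_clampTo
  exact ((this.add (by fun_prop)).add (by fun_prop)).max (by fun_prop)

theorem IsStripLift.mul_le_radialExtension (hP : IsStripLift f P n T δ M)
    (hf : ∀ ζ, ‖ζ‖ = 1 → ‖f ζ‖ = 1) {t : ℝ} (ht : 0 ≤ t) (θ : ℝ) :
    δ * t ≤ radialExtension P n T δ t θ := by
  refine le_trans ?_ (le_max_left _ _)
  have h1 := hP.mul_sub_le θ le_rfl (clampTo_nonneg T t) (clampTo_le hP.pos.le t)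
  rw [hP.re_eq_zero hf] at h1
  have h2 := clampTo_add hP.pos.le t
  rw [min_eq_right ht] at h2 ⊢
  have : δ * t = δ * clampTo T t + δ * max (t - T) 0 := by
    rw [← mul_add]; congr 1; linarith
  linarith

/-- For `t ≤ T` the second branch of the maximum is at most `(n + 1) * (t - T) ≤ 0`, while the real
part of `P` is at least `δ * t ≥ 0`, so the first branch wins. -/
theorem IsStripLift.radialExtension_eq (hP : IsStripLift f P n T δ M)
    (hf : ∀ ζ, ‖ζ‖ = 1 → ‖f ζ‖ = 1) (hδ : 0 < δ) {t : ℝ} (h0 : 0 ≤ t) (ht : t ≤ T) (θ : ℝ) :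
    radialExtension P n T δ t θ = (P ⟨t, θ⟩).re := by
  have h1 := hP.mul_sub_le θ le_rfl h0 ht
  rw [hP.re_eq_zero hf] at h1
  rw [radialExtension, clampTo_eq h0 ht, min_eq_right h0, max_eq_right (by linarith : t - T ≤ 0),
    mul_zero, add_zero, add_zero, max_eq_left]
  refine (min_le_right _ _).trans ?_
  have : ((n : ℝ) + 1) * (t - T) ≤ 0 := mul_nonpos_of_nonneg_of_nonpos (by positivity) (by linarith)
  nlinarith

theorem IsStripLift.radialExtension_of_nonpos (hP : IsStripLift f P n T δ M)
    (hf : ∀ ζ, ‖ζ‖ = 1 → ‖f ζ‖ = 1) {t : ℝ} (h0 : t ≤ 0) (θ : ℝ) :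
    radialExtension P n T δ t θ = t := by
  have hT := hP.pos
  rw [radialExtension, clampTo, min_eq_left (h0.trans hT.le), max_eq_left h0, hP.re_eq_zero hf,
    min_eq_left h0, max_eq_right (by linarith : t - T ≤ 0), mul_zero, add_zero, zero_add,
    max_eq_left]
  refine (min_le_right _ _).trans ?_
  nlinarith [(Nat.cast_nonneg n : (0 : ℝ) ≤ n)]

theorem IsStripLift.strictMono_radialExtension (hP : IsStripLift f P n T δ M) (hδ : 0 < δ)
    (hn : 0 < n) (θ : ℝ) : StrictMono fun t => radialExtension P n T δ t θ := by
  have hn' : (0 : ℝ) < n := by exact_mod_cast hn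
  intro s t hst
  refine max_lt_max ?_ (min_lt_min ?_ ?_)
  · have h1 := hP.mul_sub_le θ (clampTo_nonneg T s) (clampTo_mono T hst.le)
      (clampTo_le hP.pos.le t)
    have h2 := clampTo_add hP.pos.le t
    have h3 := clampTo_add hP.pos.le s
    have h4 : min s 0 ≤ min t 0 := min_le_min_right 0 hst.le
    have h5 : max (s - T) 0 ≤ max (t - T) 0 := max_le_max_right 0 (by linarith)
    have h6 := clampTo_mono T hst.le
    have h7 : 0 < (1 + δ) * (clampTo T t - clampTo T s) + (1 + δ) * (min t 0 - min s 0) +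
      (1 + δ) * (max (t - T) 0 - max (s - T) 0) := by
      rw [← mul_add, ← mul_add]
      apply mul_pos (by linarith)
      linarith
    rcases h6.eq_or_lt with e | e
    · rcases h4.eq_or_lt with e' | e'
      · have : max (s - T) 0 < max (t - T) 0 := by linarith
        rw [e, e']
        nlinarith
      · nlinarith
    · nlinarith
  · exact mul_lt_mul_of_pos_left hst hn'
  · exact mul_lt_mul_of_pos_left (by linarith) (by linarith)

theorem IsStripLift.radialExtension_le (hP : IsStripLift f P n T δ M) (hM : 0 ≤ M) {t : ℝ}
    (ht : 0 ≤ t) (hδn : δ ≤ n) (θ : ℝ) : radialExtension P n T δ t θ ≤ n * t + M := by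
  refine max_le ?_ ((min_le_left _ _).trans (by linarith))
  have h1 := hP.bound ⟨clampTo T t, θ⟩ (clampTo_nonneg _ _) (clampTo_le hP.pos.le _)
  have h2 := (abs_le.mp ((abs_re_le_norm _).trans h1)).2
  simp only [sub_re, mul_re, natCast_re, natCast_im, zero_mul, sub_zero] at h2
  have h3 := clampTo_add hP.pos.le t
  rw [min_eq_right ht] at h3 ⊢
  have h4 : (n : ℝ) * t = n * clampTo T t + n * max (t - T) 0 := by
    rw [← mul_add]; congr 1; linarith
  have h5 : δ * max (t - T) 0 ≤ n * max (t - T) 0 :=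
    mul_le_mul_of_nonneg_right hδn (le_max_right _ _)
  linarith

/-- Beyond `(n + 1) * T` the minimum in the second branch is `n * t`, and `htM` says that the first
branch, which grows only with slope `δ`, has been overtaken. -/
theorem IsStripLift.radialExtension_of_large (hP : IsStripLift f P n T δ M) {t : ℝ}
    (htT : (n + 1) * T ≤ t) (htM : M + n * T ≤ (n - δ) * (t - T)) (θ : ℝ) :
    radialExtension P n T δ t θ = n * t := by
  have hT := hP.pos
  have hn : (0 : ℝ) ≤ n := Nat.cast_nonneg n
  have htT' : T ≤ t := by nlinarith
  have h1 := hP.bound ⟨clampTo T t, θ⟩ (clampTo_nonneg _ _) (clampTo_le hP.pos.le _)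
  have h2 := (abs_le.mp ((abs_re_le_norm _).trans h1)).2
  simp only [sub_re, mul_re, natCast_re, natCast_im, zero_mul, sub_zero] at h2
  have h3 : clampTo T t = T := by rw [clampTo, min_eq_right htT', max_eq_right hT.le]
  rw [h3] at h2
  rw [radialExtension, h3, min_eq_right (hT.le.trans htT'), max_eq_left (by linarith : 0 ≤ t - T),
    min_eq_left (by linarith), max_eq_right]
  linarith [mul_nonneg hn hT.le]

theorem IsStripLift.surjective_radialExtension (hP : IsStripLift f P n T δ M)
    (hf : ∀ ζ, ‖ζ‖ = 1 → ‖f ζ‖ = 1) (hδ : 0 < δ) (θ : ℝ) :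
    Function.Surjective fun t => radialExtension P n T δ t θ := by
  refine surjective_of_tendsto (g₁ := fun t => δ * t) (g₂ := id) ?_ ?_ tendsto_id ?_ ?_
  · exact hP.continuous_radialExtension.comp (Continuous.prodMk_left θ)
  · exact tendsto_id.const_mul_atTop hδ
  · exact fun t h => hP.mul_le_radialExtension hf h θ
  · intro t h
    exact (hP.radialExtension_of_nonpos hf h θ).le

end

theorem StrictMono.weighted_add {μ : ℝ} (h0 : 0 ≤ μ) (h1 : μ ≤ 1) {u v : ℝ → ℝ}
    (hu : StrictMono u) (hv : StrictMono v) : StrictMono fun t => (1 - μ) * u t + μ * v t := by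
  intro s t hst
  have h2 := hu hst
  have h3 := hv hst
  show (1 - μ) * u s + μ * v s < (1 - μ) * u t + μ * v t
  rcases h0.eq_or_lt with rfl | h
  · linarith
  · nlinarith

/-- Properties of an extension `φ` of a strip lift `P` to a homeomorphism of the plane. -/
structure IsStripExtension (P : ℂ → ℂ) (n : ℕ) (T δ M K : ℝ) (φ : ℂ ≃ₜ ℂ) : Prop where
  periodic : ∀ x, φ (x + 2 * Real.pi * I) = φ x + n * (2 * Real.pi * I)
  mul_re_le : ∀ x : ℂ, 0 ≤ x.re → δ * x.re ≤ (φ x).re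
  re_nonpos : ∀ x : ℂ, x.re ≤ 0 → (φ x).re ≤ 0
  eq_mul : ∀ x : ℂ, K ≤ x.re → φ x = n * x
  re_le : ∀ x : ℂ, 0 ≤ x.re → (φ x).re ≤ n * x.re + M
  eq_lift : ∀ x : ℂ, 0 ≤ x.re → x.re ≤ T → (P x).re ≤ δ * T → φ x = P x
  re_eq : ∀ x : ℂ, 0 ≤ x.re → x.re ≤ T → (φ x).re = (P x).re

/-- The extension has the triangular form `(t, θ) ↦ (σ, η)`, where `σ` is increasing in `t` for
fixed `θ`, and `η` is increasing in `θ` for fixed `σ`. It is inverted by solving first for `θ` and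
then for `t`. -/
theorem IsStripLift.exists_isStripExtension {f P : ℂ → ℂ} {n : ℕ} {T δ M : ℝ}
    (hP : IsStripLift f P n T δ M) (hf : ∀ ζ, ‖ζ‖ = 1 → ‖f ζ‖ = 1) (hδ : 0 < δ) (hδn : δ < n) :
    ∃ φ : ℂ ≃ₜ ℂ, ∃ K > 0, IsStripExtension P n T δ M K φ := by
  have hT := hP.pos
  have hn' : (0 : ℝ) < n := hδ.trans hδn
  have hn : 0 < n := by exact_mod_cast hn'
  have hM : 0 ≤ M := (norm_nonneg _).trans (hP.bound 0 le_rfl hT.le)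
  have hδT : 0 ≤ δ * T := by positivity
  set R := radialExtension P n T δ
  obtain ⟨G, hGc, hRG, hGR⟩ := exists_continuous_inverse_of_strictMono R
    hP.continuous_radialExtension (hP.strictMono_radialExtension hδ hn)
    (hP.surjective_radialExtension hf hδ)
  have hG : ∀ σ θ, 0 ≤ σ → σ ≤ δ * T → 0 ≤ G σ θ ∧ G σ θ ≤ T := by
    intro σ θ h0 h1
    constructor
    · by_contra hneg
      push Not at hneg
      have := hP.radialExtension_of_nonpos hf hneg.le θ
      have h2 := hRG σ θ
      linarith
    · have h2 := hP.mul_le_radialExtension hf hT.le θ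
      rw [← (hP.strictMono_radialExtension hδ hn θ).le_iff_le]
      show R (G σ θ) θ ≤ R T θ
      rw [hRG]
      exact h1.trans h2
  have hPp : ∀ t θ : ℝ, P ⟨t, θ + 2 * Real.pi⟩ = P ⟨t, θ⟩ + n * (2 * Real.pi * I) := by
    intro t θ
    rw [← hP.periodic]
    congr 1
    apply Complex.ext <;> simp
  have hRp : ∀ t θ, R t (θ + 2 * Real.pi) = R t θ := by
    intro t θ
    simp only [R, radialExtension]
    rw [hPp]
    simp
  have hGp : ∀ σ θ, G σ (θ + 2 * Real.pi) = G σ θ := by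
    intro σ θ
    rw [← hGR (G σ θ) (θ + 2 * Real.pi), hRp, hRG]
  -- The imaginary part of `P` at the point over `θ` on the level curve where the real part of `P`
  -- is `σ`; clamping `σ` to `[0, δ * T]` keeps that curve inside the strip.
  set η₁ : ℝ → ℝ → ℝ := fun θ σ => (P ⟨clampTo T (G (clampTo (δ * T) σ) θ), θ⟩).im with hη₁
  have hη₁c : Continuous fun q : ℝ × ℝ => η₁ q.1 q.2 := by
    have h1 : Continuous fun q : ℝ × ℝ => (G (clampTo (δ * T) q.2) q.1, q.1) :=
      (hGc.comp (((_root_.continuous_clampTo _).comp continuous_snd).prodMk continuous_fst)).prodMk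
        continuous_fst
    exact continuous_im.comp (hP.continuous_clampTo.comp h1)
  have hη₁p : ∀ θ σ, η₁ (θ + 2 * Real.pi) σ = η₁ θ σ + n * (2 * Real.pi) := by
    intro θ σ
    simp only [hη₁]
    rw [hGp, hPp]
    simp
  have hη₁b : ∀ θ σ, |η₁ θ σ - n * θ| ≤ M := by
    intro θ σ
    have h1 := hP.bound ⟨clampTo T (G (clampTo (δ * T) σ) θ), θ⟩ (clampTo_nonneg _ _)
      (clampTo_le hT.le _)
    have h2 := (abs_im_le_norm _).trans h1
    simpa using h2
  -- Along a level curve the real part of `P` is constant, so injectivity of `P` makes the imaginary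
  -- part injective in `θ`. The gain of `2πn` over a period shows that it increases.
  have hη₁m : ∀ σ, StrictMono fun θ => η₁ θ σ := by
    intro σ
    have hc : Continuous fun θ => η₁ θ σ := hη₁c.comp (Continuous.prodMk_left σ)
    have hinj : Function.Injective fun θ => η₁ θ σ := by
      have key : ∀ θ, 0 ≤ G (clampTo (δ * T) σ) θ ∧ G (clampTo (δ * T) σ) θ ≤ T := fun θ =>
        hG _ θ (clampTo_nonneg _ _) (clampTo_le hδT _)
      intro θ θ' h
      simp only [hη₁] at h
      rw [clampTo_eq (key θ).1 (key θ).2, clampTo_eq (key θ').1 (key θ').2] at h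
      have hre : ∀ θ, (P ⟨G (clampTo (δ * T) σ) θ, θ⟩).re = clampTo (δ * T) σ := by
        intro θ
        rw [← hP.radialExtension_eq hf hδ (key θ).1 (key θ).2]
        exact hRG _ _
      have := hP.injOn hδ (key θ) (key θ') (Complex.ext ((hre θ).trans (hre θ').symm) h)
      exact congrArg Complex.im this
    rcases hc.strictMono_of_inj hinj with h | h
    · exact h
    · exfalso
      have h1 := h (show (0 : ℝ) < 0 + 2 * Real.pi by positivity)
      simp only [hη₁p] at h1
      have : 0 < n * (2 * Real.pi) := by positivity
      linarith
  -- Between the levels `δ * T` and `δ * T + 1` the angular part is blended into `n * θ`; a convex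
  -- combination of increasing functions is increasing.
  set μ : ℝ → ℝ := fun σ => clampTo 1 (σ - δ * T) with hμ
  have hμc : Continuous μ := (_root_.continuous_clampTo 1).comp (by fun_prop)
  have hμ0 : ∀ σ, 0 ≤ μ σ := fun σ => clampTo_nonneg _ _
  have hμ1 : ∀ σ, μ σ ≤ 1 := fun σ => clampTo_le zero_le_one _
  set η : ℝ → ℝ → ℝ := fun θ σ => (1 - μ σ) * η₁ θ σ + μ σ * (n * θ) with hη
  have hηc : Continuous fun q : ℝ × ℝ => η q.1 q.2 := by
    have := hμc.comp (continuous_snd (X := ℝ) (Y := ℝ))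
    exact ((continuous_const.sub this).mul hη₁c).add (this.mul (by fun_prop))
  have hηb : ∀ θ σ, |η θ σ - n * θ| ≤ M := by
    intro θ σ
    have h1 : η θ σ - n * θ = (1 - μ σ) * (η₁ θ σ - n * θ) := by simp only [hη]; ring
    rw [h1, abs_mul, abs_of_nonneg (by linarith [hμ1 σ])]
    exact (mul_le_of_le_one_left (abs_nonneg _) (by linarith [hμ0 σ])).trans (hη₁b θ σ)
  obtain ⟨Θ, hΘc, hηΘ, hΘη⟩ := exists_continuous_inverse_of_strictMono η hηc
    (fun σ => (hη₁m σ).weighted_add (hμ0 σ) (hμ1 σ)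
      (fun s t h => mul_lt_mul_of_pos_left h hn'))
    (fun σ => by
      refine surjective_of_tendsto (g₁ := fun θ => n * θ + -M) (g₂ := fun θ => n * θ + M)
        (hηc.comp (Continuous.prodMk_left σ)) ?_ ?_ ?_ ?_
      · exact tendsto_atTop_add_const_right _ _ (tendsto_id.const_mul_atTop hn')
      · exact tendsto_atBot_add_const_right _ _ (tendsto_id.const_mul_atBot hn')
      · intro θ _
        linarith [(abs_le.mp (hηb θ σ)).1]
      · intro θ _
        linarith [(abs_le.mp (hηb θ σ)).2])
  have hμ_zero : ∀ σ, σ ≤ δ * T → μ σ = 0 := by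
    intro σ h
    simp only [hμ, clampTo]
    exact max_eq_left ((min_le_left _ _).trans (by linarith))
  have hμ_one : ∀ σ, δ * T + 1 ≤ σ → μ σ = 1 := by
    intro σ h
    simp only [hμ, clampTo]
    rw [min_eq_right (by linarith), max_eq_right zero_le_one]
  let φ : ℂ ≃ₜ ℂ :=
    { toFun := fun x => ⟨R x.re x.im, η x.im (R x.re x.im)⟩
      invFun := fun y => ⟨G y.re (Θ y.im y.re), Θ y.im y.re⟩
      left_inv := fun x => by
        apply Complex.ext
        · simp only [hΘη, hGR]
        · simp only [hΘη]
      right_inv := fun y => by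
        apply Complex.ext
        · simp only [hRG]
        · simp only [hRG, hηΘ]
      continuous_toFun := by
        have h1 : Continuous fun x : ℂ => R x.re x.im :=
          hP.continuous_radialExtension.comp (continuous_re.prodMk continuous_im)
        exact continuous_complex_mk.comp (h1.prodMk (hηc.comp (continuous_im.prodMk h1)))
      continuous_invFun := by
        have h1 : Continuous fun x : ℂ => Θ x.im x.re :=
          hΘc.comp (continuous_im.prodMk continuous_re)
        exact continuous_complex_mk.comp ((hGc.comp (continuous_re.prodMk h1)).prodMk h1) }
  have hφ : ∀ x, φ x = ⟨R x.re x.im, η x.im (R x.re x.im)⟩ := fun x => rfl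
  -- The first two bounds put the radial part into the regime `n * t`; the third makes the blending
  -- complete.
  set K := max (max ((n + 1) * T) (T + (M + n * T) / (n - δ))) (δ * T + 1)
  have hK1 : δ * T + 1 ≤ K := le_max_right _ _
  refine ⟨φ, K, by linarith, ?_, ?_, ?_, ?_, ?_, ?_, ?_⟩
  · intro x
    rw [hφ, hφ]
    have h1 : (x + 2 * Real.pi * I).re = x.re := by simp
    have h2 : (x + 2 * Real.pi * I).im = x.im + 2 * Real.pi := by simp
    rw [h1, h2, hRp]
    simp only [hη, hη₁p]
    apply Complex.ext
    · simp
    · simp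
      ring
  · intro x h
    exact hP.mul_le_radialExtension hf h x.im
  · intro x h
    exact (hP.radialExtension_of_nonpos hf h x.im).le.trans h
  · intro x h
    have h1 : (n + 1) * T ≤ x.re := ((le_max_left _ _).trans (le_max_left _ _)).trans h
    have h2 : T + (M + n * T) / (n - δ) ≤ x.re :=
      ((le_max_right _ _).trans (le_max_left _ _)).trans h
    have h3 : M + n * T ≤ (n - δ) * (x.re - T) := by
      have h4 : (M + n * T) / (n - δ) ≤ x.re - T := by linarith
      rw [div_le_iff₀ (by linarith)] at h4
      linarith
    have h5 : R x.re x.im = n * x.re := hP.radialExtension_of_large h1 h3 x.im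
    have h6 : μ (n * x.re) = 1 := by
      apply hμ_one
      have : (1 : ℝ) ≤ n := by exact_mod_cast hn
      have h7 : δ * T + 1 ≤ x.re := hK1.trans h
      nlinarith
    rw [hφ, h5]
    simp only [hη, h6]
    apply Complex.ext <;> simp
  · intro x h
    exact hP.radialExtension_le hM h hδn.le x.im
  · intro x h0 hxT hx
    have h1 : R x.re x.im = (P x).re := hP.radialExtension_eq hf hδ h0 hxT x.im
    have h2 : 0 ≤ (P x).re := by
      rw [← h1]
      exact (mul_nonneg hδ.le h0).trans (hP.mul_le_radialExtension hf h0 x.im)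
    have h3 : G (P x).re x.im = x.re := by rw [← h1, hGR]
    rw [hφ, h1]
    simp only [hη, hμ_zero _ hx, hη₁, clampTo_eq h2 hx, h3, clampTo_eq h0 hxT]
    apply Complex.ext <;> simp
  · intro x h0 hxT
    exact hP.radialExtension_eq hf hδ h0 hxT x.im

/-! ### Linearization of the extended map -/

section
variable {P : ℂ → ℂ} {n : ℕ} {T δ M K : ℝ} {φ : ℂ ≃ₜ ℂ}

theorem IsStripExtension.pow_mul_re_le (h : IsStripExtension P n T δ M K φ) (hδ : 0 ≤ δ) {x : ℂ}
    (hx : 0 ≤ x.re) (k : ℕ) : δ ^ k * x.re ≤ (φ^[k] x).re := by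
  induction k with
  | zero => simp
  | succ k ih =>
    rw [Function.iterate_succ_apply', pow_succ', mul_assoc]
    exact (mul_le_mul_of_nonneg_left ih hδ).trans
      (h.mul_re_le _ ((mul_nonneg (pow_nonneg hδ k) hx).trans ih))

theorem IsStripExtension.iterate_re_nonpos (h : IsStripExtension P n T δ M K φ) {x : ℂ}
    (hx : x.re ≤ 0) (k : ℕ) : (φ^[k] x).re ≤ 0 := by
  induction k with
  | zero => exact hx
  | succ k ih =>
    rw [Function.iterate_succ_apply']
    exact h.re_nonpos _ ih

theorem IsStripExtension.iterate_eq_mul (h : IsStripExtension P n T δ M K φ) (hn : 1 ≤ n)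
    (hK : 0 < K) {x : ℂ} (hx : K ≤ x.re) (k : ℕ) : φ^[k] x = n ^ k * x := by
  induction k with
  | zero => simp
  | succ k ih =>
    rw [Function.iterate_succ_apply', ih, h.eq_mul, pow_succ']
    · ring
    · have h1 : ((n : ℂ) ^ k * x).re = (n : ℝ) ^ k * x.re := by
        rw [← ofReal_natCast, ← ofReal_pow, re_ofReal_mul]
      rw [h1]
      have h2 : (1 : ℝ) ≤ (n : ℝ) ^ k := one_le_pow₀ (by exact_mod_cast hn)
      nlinarith

theorem IsStripExtension.iterate_periodic (h : IsStripExtension P n T δ M K φ) (x : ℂ) (k : ℕ) :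
    φ^[k] (x + 2 * Real.pi * I) = φ^[k] x + (n ^ k : ℕ) * (2 * Real.pi * I) := by
  have hj : ∀ (j : ℕ) (x : ℂ), φ (x + j * (2 * Real.pi * I)) =
      φ x + (n * j : ℕ) * (2 * Real.pi * I) := by
    intro j
    induction j with
    | zero => simp
    | succ j ih =>
      intro x
      have : x + ((j + 1 : ℕ) : ℂ) * (2 * Real.pi * I) =
        (x + j * (2 * Real.pi * I)) + 2 * Real.pi * I := by push_cast; ring
      rw [this, h.periodic, ih]
      push_cast
      ring
  induction k with
  | zero => simp
  | succ k ih =>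
    rw [Function.iterate_succ_apply', Function.iterate_succ_apply', ih, hj, pow_succ']

theorem IsStripExtension.iterate_re_le (h : IsStripExtension P n T δ M K φ) (hn : 2 ≤ n)
    (hδ : 0 ≤ δ) (hM : 0 ≤ M) {x : ℂ} (hx : 0 ≤ x.re) (k : ℕ) :
    (φ^[k] x).re + M ≤ n ^ k * (x.re + M) := by
  have hn' : (2 : ℝ) ≤ n := by exact_mod_cast hn
  induction k with
  | zero => simp
  | succ k ih =>
    rw [Function.iterate_succ_apply', pow_succ', mul_assoc]
    have h1 := h.re_le _ ((mul_nonneg (pow_nonneg hδ k) hx).trans (h.pow_mul_re_le hδ hx k))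
    have h2 := mul_le_mul_of_nonneg_left ih (by linarith : (0 : ℝ) ≤ n)
    nlinarith

/-- A homeomorphism of the right half-plane, with inverse `G`, which conjugates `φ` to
multiplication by `n` and commutes with the translation by `2πi`. -/
structure IsLinearization (φ : ℂ → ℂ) (n : ℕ) (M : ℝ) (H G : ℂ → ℂ) : Prop where
  continuousOn : ContinuousOn H {x | 0 < x.re}
  continuousOn_inv : ContinuousOn G {x | 0 < x.re}
  re_pos : ∀ x : ℂ, 0 < x.re → 0 < (H x).re
  re_pos_inv : ∀ x : ℂ, 0 < x.re → 0 < (G x).re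
  left_inv : ∀ x : ℂ, 0 < x.re → G (H x) = x
  right_inv : ∀ x : ℂ, 0 < x.re → H (G x) = x
  conj : ∀ x : ℂ, 0 < x.re → H (φ x) = n * H x
  periodic : ∀ x : ℂ, 0 < x.re → H (x + 2 * Real.pi * I) = H x + 2 * Real.pi * I
  periodic_inv : ∀ x : ℂ, 0 < x.re → G (x + 2 * Real.pi * I) = G x + 2 * Real.pi * I
  re_le : ∀ x : ℂ, 0 < x.re → (H x).re ≤ x.re + M
  exists_le : ∀ a > 0, ∃ ε > 0, ∀ x : ℂ, a ≤ x.re → ε ≤ (H x).re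

/-- Since `δ > 1`, each orbit in the right half-plane reaches `K ≤ re`, where `φ` is multiplication
by `n`. From then on `n ^ (-k) * φ^k x` no longer depends on `k`; its value is `H x`. Pulling `n ^ k
* y` back by `φ^k` gives the inverse. -/
theorem IsStripExtension.exists_isLinearization (h : IsStripExtension P n T δ M K φ) (hn : 2 ≤ n)
    (hδ : 1 < δ) (hM : 0 ≤ M) (hK : 0 < K) : ∃ H G, IsLinearization φ n M H G := by
  have hn' : (2 : ℝ) ≤ n := by exact_mod_cast hn
  have hn0 : (n : ℂ) ≠ 0 := by
    have : n ≠ 0 := by omega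
    exact_mod_cast this
  have hnk : ∀ k : ℕ, (n : ℂ) ^ k ≠ 0 := fun k => pow_ne_zero k hn0
  have hnkpos : ∀ k : ℕ, (0 : ℝ) < (n : ℝ) ^ k := fun k => by positivity
  have hre : ∀ (k : ℕ) (x : ℂ), ((n : ℂ) ^ k * x).re = (n : ℝ) ^ k * x.re := fun k x => by
    rw [← ofReal_natCast, ← ofReal_pow, re_ofReal_mul]
  have hex : ∀ x : ℂ, ∃ k : ℕ, 0 < x.re → K < (φ^[k] x).re := by
    intro x
    by_cases hx : 0 < x.re
    · obtain ⟨k, hk⟩ := pow_unbounded_of_one_lt (K / x.re) hδ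
      rw [div_lt_iff₀ hx] at hk
      exact ⟨k, fun _ => hk.trans_le (h.pow_mul_re_le (by linarith) hx.le k)⟩
    · exact ⟨0, fun h => absurd h hx⟩
  choose N hN using hex
  have hex' : ∀ y : ℂ, ∃ k : ℕ, 0 < y.re → K < (n : ℝ) ^ k * y.re := by
    intro y
    by_cases hy : 0 < y.re
    · obtain ⟨k, hk⟩ := pow_unbounded_of_one_lt (K / y.re) (by linarith : (1 : ℝ) < n)
      rw [div_lt_iff₀ hy] at hk
      exact ⟨k, fun _ => hk⟩
    · exact ⟨0, fun h => absurd h hy⟩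
  choose N' hN' using hex'
  set H : ℂ → ℂ := fun x => ((n : ℂ) ^ N x)⁻¹ * φ^[N x] x with hH
  set G : ℂ → ℂ := fun y => φ.symm^[N' y] ((n : ℂ) ^ N' y * y) with hG
  have hmul : ∀ (x : ℂ) (k : ℕ), 0 < x.re → K ≤ (φ^[k] x).re →
      (n : ℂ) ^ k * H x = φ^[k] x := by
    intro x k hx hk
    have h1 := h.iterate_eq_mul (by omega) hK hk (N x)
    have h2 := h.iterate_eq_mul (by omega) hK (hN x hx).le k
    rw [← Function.iterate_add_apply] at h1 h2
    rw [add_comm, h1] at h2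
    simp only [hH]
    apply mul_left_cancel₀ (hnk (N x))
    rw [h2, mul_left_comm, mul_inv_cancel_left₀ (hnk _)]
  have hposH : ∀ x : ℂ, 0 < x.re → 0 < (H x).re := by
    intro x hx
    have h1 := congrArg re (hmul x (N x) hx (hN x hx).le)
    rw [hre] at h1
    have h2 := hN x hx
    rw [← h1] at h2
    exact pos_of_mul_pos_right (hK.trans h2) (hnkpos _).le
  have hinj : ∀ x x' : ℂ, 0 < x.re → 0 < x'.re → H x = H x' → x = x' := by
    intro x x' hx hx' he
    have key : ∀ (x : ℂ) (j : ℕ), 0 < x.re → K ≤ (φ^[j + N x] x).re := by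
      intro x j hx
      rw [Function.iterate_add_apply, h.iterate_eq_mul (by omega) hK (hN x hx).le, hre]
      have h2 : (1 : ℝ) ≤ (n : ℝ) ^ j := one_le_pow₀ (by linarith)
      nlinarith [hN x hx]
    have h1 := hmul x (N x' + N x) hx (key x _ hx)
    have h2 := hmul x' (N x + N x') hx' (key x' _ hx')
    rw [add_comm (N x)] at h2
    rw [he, h2] at h1
    exact (φ.injective.iterate _ h1).symm
  have hsymm : ∀ (k : ℕ) (y : ℂ), φ^[k] (φ.symm^[k] y) = y := fun k y =>
    Function.LeftInverse.iterate φ.apply_symm_apply k y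
  have hback : ∀ (k : ℕ) (y : ℂ), 0 < y.re → K < (n : ℝ) ^ k * y.re →
      0 < (φ.symm^[k] ((n : ℂ) ^ k * y)).re ∧ H (φ.symm^[k] ((n : ℂ) ^ k * y)) = y := by
    intro k y hy hk
    have h1 := hsymm k ((n : ℂ) ^ k * y)
    have h2 : 0 < (φ.symm^[k] ((n : ℂ) ^ k * y)).re := by
      by_contra hneg
      push Not at hneg
      have h3 := h.iterate_re_nonpos hneg k
      rw [h1, hre] at h3
      linarith
    refine ⟨h2, ?_⟩
    have h3 := hmul _ k h2 (by rw [h1, hre]; exact hk.le)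
    rw [h1] at h3
    exact mul_left_cancel₀ (hnk k) h3
  have hGpos : ∀ y : ℂ, 0 < y.re → 0 < (G y).re := fun y hy => (hback _ y hy (hN' y hy)).1
  have hHG : ∀ y : ℂ, 0 < y.re → H (G y) = y := fun y hy => (hback _ y hy (hN' y hy)).2
  have hGH : ∀ x : ℂ, 0 < x.re → G (H x) = x := fun x hx =>
    hinj _ _ (hGpos _ (hposH x hx)) hx (hHG _ (hposH x hx))
  have hperH : ∀ x : ℂ, 0 < x.re → H (x + 2 * Real.pi * I) = H x + 2 * Real.pi * I := by
    intro x hx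
    have hx' : 0 < (x + 2 * Real.pi * I).re := by simpa using hx
    have h1 := h.iterate_periodic x (N x)
    have hper0 : ∀ j : ℕ, ((j : ℂ) * (2 * Real.pi * I)).re = 0 := by intro j; simp
    have h2 := hmul _ (N x) hx' (by
      rw [h1, add_re, hper0, add_zero]; exact (hN x hx).le)
    rw [h1, ← hmul x (N x) hx (hN x hx).le] at h2
    apply mul_left_cancel₀ (hnk (N x))
    rw [h2]
    push_cast
    ring
  refine ⟨H, G, ?_, ?_, hposH, hGpos, hGH, hHG, ?_, hperH, ?_, ?_, ?_⟩
  · intro x hx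
    -- The exponent `N x` depends on the point without any continuity, but the exponent used at `x`
    -- also works at nearby points.
    refine ContinuousAt.continuousWithinAt ?_
    have hc := (φ.continuous.iterate (N x))
    have h1 : ∀ᶠ x' in 𝓝 x, 0 < x'.re ∧ K < (φ^[N x] x').re :=
      ((isOpen_lt continuous_const continuous_re).inter
        (isOpen_lt continuous_const (continuous_re.comp hc))).mem_nhds ⟨hx, hN x hx⟩
    have h2 : Continuous fun x' => ((n : ℂ) ^ N x)⁻¹ * φ^[N x] x' := continuous_const.mul hc
    refine h2.continuousAt.congr ?_
    filter_upwards [h1] with x' hx'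
    rw [← hmul x' (N x) hx'.1 hx'.2.le, inv_mul_cancel_left₀ (hnk _)]
  · intro y hy
    refine ContinuousAt.continuousWithinAt ?_
    have hc := (φ.symm.continuous.iterate (N' y))
    have h1 : ∀ᶠ y' in 𝓝 y, 0 < y'.re ∧ K < (n : ℝ) ^ N' y * y'.re :=
      ((isOpen_lt continuous_const continuous_re).inter
        (isOpen_lt continuous_const (continuous_const.mul continuous_re))).mem_nhds ⟨hy, hN' y hy⟩
    have h2 : Continuous fun y' => φ.symm^[N' y] ((n : ℂ) ^ N' y * y') :=
      hc.comp (continuous_const.mul continuous_id)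
    refine h2.continuousAt.congr ?_
    filter_upwards [h1] with y' hy'
    obtain ⟨h3, h4⟩ := hback (N' y) y' hy'.1 hy'.2
    conv_rhs => rw [← h4]
    rw [hGH _ h3]
  · intro x hx
    have hx' : 0 < (φ x).re := (by nlinarith : 0 < δ * x.re).trans_le (h.mul_re_le x hx.le)
    have h1 : K ≤ (φ^[N (φ x)] (φ x)).re := (hN _ hx').le
    have h2 := hmul _ _ hx' h1
    rw [← Function.iterate_succ_apply] at h1 h2
    rw [← hmul x _ hx h1, pow_succ, mul_assoc] at h2
    exact mul_left_cancel₀ (hnk _) h2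
  · intro y hy
    have hy' : 0 < (y + 2 * Real.pi * I).re := by simpa using hy
    apply hinj _ _ (hGpos _ hy') (by simpa using hGpos y hy)
    rw [hHG _ hy', hperH _ (hGpos y hy), hHG y hy]
  · intro x hx
    have h1 := congrArg re (hmul x (N x) hx (hN x hx).le)
    rw [hre] at h1
    have h2 := h.iterate_re_le hn (by linarith) hM hx.le (N x)
    rw [← h1] at h2
    have h3 : (n : ℝ) ^ N x * (H x).re ≤ (n : ℝ) ^ N x * (x.re + M) := by linarith
    exact le_of_mul_le_mul_left h3 (hnkpos _)
  · intro a ha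
    obtain ⟨k, hk⟩ := pow_unbounded_of_one_lt (K / a) hδ
    rw [div_lt_iff₀ ha] at hk
    refine ⟨K / (n : ℝ) ^ k, div_pos hK (hnkpos k), fun x hx => ?_⟩
    have hx0 : 0 < x.re := ha.trans_le hx
    have h1 := h.pow_mul_re_le (by linarith : 0 ≤ δ) hx0.le k
    have h2 : K ≤ (φ^[k] x).re := by
      refine (hk.le.trans ?_).trans h1
      exact mul_le_mul_of_nonneg_left hx (by positivity)
    rw [div_le_iff₀ (hnkpos k), mul_comm, ← hre, hmul x k hx0 h2]
    exact h2

end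

/-! ### Descent to the punctured disk and conjugacy near the circle -/

theorem map_add_int_mul_of_periodic {F : ℂ → ℂ}
    (h : ∀ x : ℂ, 0 < x.re → F (x + 2 * Real.pi * I) = F x + 2 * Real.pi * I) {x : ℂ}
    (hx : 0 < x.re) (k : ℤ) : F (x + k * (2 * Real.pi * I)) = F x + k * (2 * Real.pi * I) := by
  have hk : ∀ j : ℤ, 0 < (x + j * (2 * Real.pi * I)).re := fun j => by
    rw [add_re, show ((j : ℂ) * (2 * Real.pi * I)).re = 0 by simp, add_zero]
    exact hx
  induction k using Int.induction_on with
  | zero => simp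
  | succ i ih =>
    have h1 := h _ (hk i)
    rw [show x + ((i + 1 : ℤ) : ℂ) * (2 * Real.pi * I) =
      x + (i : ℤ) * (2 * Real.pi * I) + 2 * Real.pi * I by push_cast; ring, h1, ih]
    push_cast
    ring
  | pred i ih =>
    have h1 := h _ (hk (-i - 1))
    rw [show x + ((-i - 1 : ℤ) : ℂ) * (2 * Real.pi * I) + 2 * Real.pi * I =
      x + (-i : ℤ) * (2 * Real.pi * I) by push_cast; ring, ih] at h1
    push_cast at h1 ⊢
    linear_combination -h1

/-- The map of the punctured disk which lifts to `F` through `x ↦ exp (-x)`. -/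
def descend (F : ℂ → ℂ) (ζ : ℂ) : ℂ := exp (-F (-log ζ))

/-- The principal logarithm recovers `x` up to a multiple of `2πi`, which periodicity makes
harmless. So `descend F` does not depend on the branch. -/
theorem descend_exp_neg {F : ℂ → ℂ}
    (h : ∀ x : ℂ, 0 < x.re → F (x + 2 * Real.pi * I) = F x + 2 * Real.pi * I) {x : ℂ}
    (hx : 0 < x.re) : descend F (exp (-x)) = exp (-F x) := by
  have h1 : exp (log (exp (-x))) = exp (-x) := exp_log (exp_ne_zero _)
  obtain ⟨k, hk⟩ := exp_eq_exp_iff_exists_int.mp h1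
  rw [descend, show -log (exp (-x)) = x + (-k : ℤ) * (2 * Real.pi * I) by
    rw [hk]; push_cast; ring, map_add_int_mul_of_periodic h hx, exp_eq_exp_iff_exists_int]
  exact ⟨k, by push_cast; ring⟩

theorem exists_exp_neg_eq {ζ : ℂ} (h0 : ζ ≠ 0) (h1 : ‖ζ‖ < 1) :
    ∃ x : ℂ, 0 < x.re ∧ exp (-x) = ζ := by
  refine ⟨-log ζ, ?_, by rw [neg_neg, exp_log h0]⟩
  rw [neg_re, log_re, neg_pos]
  exact Real.log_neg (norm_pos_iff.mpr h0) h1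

/-- Near `exp (-x₀)` the branch `X` of `-log` with value `x₀` there is continuous, so the cut of the
principal branch plays no role. -/
theorem continuousOn_descend {F : ℂ → ℂ} (hF : ContinuousOn F {x | 0 < x.re})
    (h : ∀ x : ℂ, 0 < x.re → F (x + 2 * Real.pi * I) = F x + 2 * Real.pi * I) :
    ContinuousOn (descend F) {ζ | ζ ≠ 0 ∧ ‖ζ‖ < 1} := by
  rintro ζ₀ ⟨h0, h1⟩
  refine ContinuousAt.continuousWithinAt ?_
  obtain ⟨x₀, hx₀, rfl⟩ := exists_exp_neg_eq h0 h1
  have hopen : IsOpen {x : ℂ | 0 < x.re} := isOpen_lt continuous_const continuous_re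
  set X : ℂ → ℂ := fun ζ => x₀ - log (ζ / exp (-x₀)) with hX
  have hX0 : X (exp (-x₀)) = x₀ := by simp [hX]
  have hXc : ContinuousAt X (exp (-x₀)) := by
    refine continuousAt_const.sub (ContinuousAt.clog (by fun_prop) ?_)
    rw [div_self (exp_ne_zero _)]
    exact one_mem_slitPlane
  have hXe : ∀ ζ, ζ ≠ 0 → exp (-X ζ) = ζ := by
    intro ζ hζ
    rw [hX, neg_sub, sub_eq_add_neg, exp_add, exp_log (div_ne_zero hζ (exp_ne_zero _)),
      div_mul_cancel₀ _ (exp_ne_zero _)]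
  have h2 : ContinuousAt (fun ζ => exp (-F (X ζ))) (exp (-x₀)) := by
    have h3 : ContinuousAt F (X (exp (-x₀))) := by
      rw [hX0]; exact hF.continuousAt (hopen.mem_nhds hx₀)
    have h4 : ContinuousAt (fun ζ => F (X ζ)) (exp (-x₀)) := h3.comp hXc
    exact h4.neg.cexp
  refine h2.congr ?_
  have h5 : ∀ᶠ ζ in 𝓝 (exp (-x₀)), 0 < (X ζ).re :=
    hXc.eventually (by rw [hX0]; exact hopen.mem_nhds hx₀)
  filter_upwards [h5, isOpen_ne.mem_nhds h0] with ζ h6 h7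
  rw [← descend_exp_neg h h6, hXe ζ h7]

/-- A homeomorphism `h` of the punctured disk, with inverse `h'`, which conjugates `f` to
`ζ ↦ ζ ^ n` as far as the values of `f` are outside of the disk of radius `r`. -/
structure IsBoundaryConjugacy (f : ℂ → ℂ) (n : ℕ) (r : ℝ) (h h' : ℂ → ℂ) : Prop where
  pos : 0 < r
  continuousOn : ContinuousOn h {ζ | ζ ≠ 0 ∧ ‖ζ‖ < 1}
  continuousOn_inv : ContinuousOn h' {ζ | ζ ≠ 0 ∧ ‖ζ‖ < 1}
  mapsTo : ∀ ζ, ζ ≠ 0 → ‖ζ‖ < 1 → h ζ ≠ 0 ∧ ‖h ζ‖ < 1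
  mapsTo_inv : ∀ ζ, ζ ≠ 0 → ‖ζ‖ < 1 → h' ζ ≠ 0 ∧ ‖h' ζ‖ < 1
  left_inv : ∀ ζ, ζ ≠ 0 → ‖ζ‖ < 1 → h' (h ζ) = ζ
  right_inv : ∀ ζ, ζ ≠ 0 → ‖ζ‖ < 1 → h (h' ζ) = ζ
  conj : ∀ ζ, ‖ζ‖ < 1 → r < ‖f ζ‖ → r < ‖ζ‖ ∧ h (f ζ) = h ζ ^ n
  conj_inv : ∀ ζ, ζ ≠ 0 → ‖ζ‖ < 1 → r < ‖h' (ζ ^ n)‖ → r < ‖h' ζ‖ ∧ h' (ζ ^ n) = f (h' ζ)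
  lt_one : r < 1
  exists_norm_le : ∃ ρ < 1, 0 ≤ ρ ∧ ∀ ζ, ζ ≠ 0 → ‖ζ‖ < 1 → ‖h' ζ‖ ≤ r → ‖ζ‖ ≤ ρ
  exists_norm_inv_le : ∃ ε > 0, ∀ ζ, ζ ≠ 0 → ‖ζ‖ < ε → ‖h' ζ‖ ≤ r

theorem norm_exp_neg (x : ℂ) : ‖exp (-x)‖ = Real.exp (-x.re) := by rw [norm_exp, neg_re]

theorem norm_exp_neg_lt_one {x : ℂ} : ‖exp (-x)‖ < 1 ↔ 0 < x.re := by
  rw [norm_exp_neg, Real.exp_lt_one_iff]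
  exact neg_lt_zero

theorem IsStripLift.exists_isBoundaryConjugacy {f P : ℂ → ℂ} {n : ℕ} {T δ M : ℝ}
    (hP : IsStripLift f P n T δ M) (hf : ∀ ζ, ‖ζ‖ = 1 → ‖f ζ‖ = 1) (hδ : 1 < δ) (hn : 2 ≤ n)
    (hfd : DifferentiableOn ℂ f (ball 0 1)) :
    ∃ r h h', IsBoundaryConjugacy f n r h h' := by
  -- If `δ ≥ n`, the bound can be weakened to `3 / 2`, which lies strictly between 1 and `n`.
  wlog hδn : δ < n generalizing δ
  · have hn' : (2 : ℝ) ≤ n := by exact_mod_cast hn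
    push Not at hδn
    exact this (hP.mono (by linarith : (3 / 2 : ℝ) ≤ δ)) (by norm_num) (by linarith)
  have hT := hP.pos
  have hM : 0 ≤ M := (norm_nonneg _).trans (hP.bound 0 le_rfl hT.le)
  obtain ⟨φ, K, hK, hφ⟩ := hP.exists_isStripExtension hf (by linarith) hδn
  obtain ⟨H, G, hH⟩ := hφ.exists_isLinearization hn hδ hM hK
  have hTδ : T < δ * T := by nlinarith
  -- points of the inner disk have images of small modulus
  have hinner : ∀ ζ, ‖ζ‖ ≤ Real.exp (-T) → ‖f ζ‖ ≤ Real.exp (-(δ * T)) := by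
    intro ζ hζ
    have hpos : Real.exp (-T) ≠ 0 := (Real.exp_pos _).ne'
    have hlt : Real.exp (-T) < 1 := by rw [Real.exp_lt_one_iff]; linarith
    refine norm_le_of_forall_mem_frontier_norm_le
      (isBounded_ball (x := (0 : ℂ)) (r := Real.exp (-T))) ?_ ?_
      (by rw [closure_ball _ hpos]; exact mem_closedBall_zero_iff.mpr hζ)
    · apply DifferentiableOn.diffContOnCl
      rw [closure_ball _ hpos]
      exact hfd.mono (closedBall_subset_ball hlt)
    · intro w hw
      rw [frontier_ball _ hpos, mem_sphere_zero_iff_norm] at hw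
      obtain ⟨x, hx, rfl⟩ := exists_exp_neg_eq
        (norm_pos_iff.mp (by rw [hw]; exact Real.exp_pos _)) (by rw [hw]; exact hlt)
      rw [norm_exp_neg, Real.exp_eq_exp, neg_inj] at hw
      rw [← hP.exp_neg x hx.le hw.le, norm_exp_neg, Real.exp_le_exp, neg_le_neg_iff]
      have h1 := hφ.mul_re_le x hx.le
      rwa [hφ.re_eq x hx.le hw.le, hw] at h1
  have hdH := fun (x : ℂ) (hx : 0 < x.re) => descend_exp_neg hH.periodic hx
  have hdG := fun (x : ℂ) (hx : 0 < x.re) => descend_exp_neg hH.periodic_inv hx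
  -- By `hinner`, values of `f` outside this radius come only from the annulus `exp (-T) < ‖ζ‖`, and
  -- for such values `φ` coincides with `P` on the lift. So the linearization of `φ` conjugates `f`
  -- itself there.
  refine ⟨Real.exp (-(δ * T)), descend H, descend G, Real.exp_pos _,
    continuousOn_descend hH.continuousOn hH.periodic,
    continuousOn_descend hH.continuousOn_inv hH.periodic_inv, ?_, ?_, ?_, ?_, ?_, ?_, ?_, ?_, ?_⟩
  · intro ζ h0 h1
    obtain ⟨x, hx, rfl⟩ := exists_exp_neg_eq h0 h1
    rw [hdH x hx]
    exact ⟨exp_ne_zero _, norm_exp_neg_lt_one.mpr (hH.re_pos x hx)⟩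
  · intro ζ h0 h1
    obtain ⟨x, hx, rfl⟩ := exists_exp_neg_eq h0 h1
    rw [hdG x hx]
    exact ⟨exp_ne_zero _, norm_exp_neg_lt_one.mpr (hH.re_pos_inv x hx)⟩
  · intro ζ h0 h1
    obtain ⟨x, hx, rfl⟩ := exists_exp_neg_eq h0 h1
    rw [hdH x hx, hdG _ (hH.re_pos x hx), hH.left_inv x hx]
  · intro ζ h0 h1
    obtain ⟨x, hx, rfl⟩ := exists_exp_neg_eq h0 h1
    rw [hdG x hx, hdH _ (hH.re_pos_inv x hx), hH.right_inv x hx]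
  · intro ζ h1 h2
    have h3 : Real.exp (-T) < ‖ζ‖ := by
      by_contra h4
      push Not at h4
      exact absurd h2 (not_lt.mpr (hinner ζ h4))
    refine ⟨(Real.exp_lt_exp.mpr (by linarith)).trans h3, ?_⟩
    obtain ⟨x, hx, rfl⟩ := exists_exp_neg_eq (norm_pos_iff.mp ((Real.exp_pos _).trans h3)) h1
    rw [norm_exp_neg, Real.exp_lt_exp, neg_lt_neg_iff] at h3
    rw [← hP.exp_neg x hx.le h3.le, norm_exp_neg, Real.exp_lt_exp, neg_lt_neg_iff] at h2
    have h5 := hφ.eq_lift x hx.le h3.le h2.le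
    have h6 : 0 < (P x).re := by
      rw [← h5]
      exact (by nlinarith : 0 < δ * x.re).trans_le (hφ.mul_re_le x hx.le)
    rw [← hP.exp_neg x hx.le h3.le, hdH _ h6, hdH x hx, ← h5, hH.conj x hx, ← exp_nat_mul]
    congr 1
    ring
  · intro ζ h0 h1 h2
    obtain ⟨y, hy, rfl⟩ := exists_exp_neg_eq h0 h1
    obtain ⟨x, hx, rfl⟩ : ∃ x : ℂ, 0 < x.re ∧ H x = y :=
      ⟨G y, hH.re_pos_inv y hy, hH.right_inv y hy⟩
    have hφx : 0 < (φ x).re :=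
      (by nlinarith : 0 < δ * x.re).trans_le (hφ.mul_re_le x hx.le)
    have h3 : exp (-H x) ^ n = exp (-H (φ x)) := by
      rw [hH.conj x hx, ← exp_nat_mul]
      congr 1
      ring
    rw [h3, hdG _ (hH.re_pos _ hφx), hH.left_inv _ hφx] at h2 ⊢
    rw [hdG _ hy, hH.left_inv x hx]
    rw [norm_exp_neg, Real.exp_lt_exp, neg_lt_neg_iff] at h2
    have h4 : x.re < T := by
      have := hφ.mul_re_le x hx.le
      by_contra h5
      push Not at h5
      nlinarith
    rw [norm_exp_neg, Real.exp_lt_exp, neg_lt_neg_iff]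
    refine ⟨by linarith, ?_⟩
    have h5 := hφ.re_eq x hx.le h4.le
    rw [hφ.eq_lift x hx.le h4.le (by linarith), hP.exp_neg x hx.le h4.le]
  · rw [Real.exp_lt_one_iff]
    nlinarith
  · obtain ⟨ε, hε, hεH⟩ := hH.exists_le (δ * T) (by nlinarith)
    refine ⟨Real.exp (-ε), by rw [Real.exp_lt_one_iff]; linarith, (Real.exp_pos _).le, ?_⟩
    intro ζ h0 h1 h2
    obtain ⟨y, hy, rfl⟩ := exists_exp_neg_eq h0 h1
    rw [hdG _ hy, norm_exp_neg, Real.exp_le_exp, neg_le_neg_iff] at h2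
    have h3 := hεH _ h2
    rw [hH.right_inv y hy] at h3
    rw [norm_exp_neg, Real.exp_le_exp, neg_le_neg_iff]
    exact h3
  · refine ⟨Real.exp (-(δ * T + M)), Real.exp_pos _, fun ζ h0 h1 => ?_⟩
    have h2 : ‖ζ‖ < 1 := h1.trans (by rw [Real.exp_lt_one_iff]; nlinarith)
    obtain ⟨y, hy, rfl⟩ := exists_exp_neg_eq h0 h2
    rw [norm_exp_neg, Real.exp_lt_exp, neg_lt_neg_iff] at h1
    have h3 := hH.re_le _ (hH.re_pos_inv y hy)
    rw [hH.right_inv y hy] at h3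
    rw [hdG _ hy, norm_exp_neg, Real.exp_le_exp, neg_le_neg_iff]
    linarith

/-! ### Transporting histories by a conjugacy near the boundary -/

/-- `A` is a backward invariant relatively open subset of the basin `D` of a fixed point `z` of `f`,
outside of which the iterates of `f` converge uniformly to `z`. -/
structure IsBackwardInvariant {X : Type*} [TopologicalSpace X] (f : X → X) (D A : Set X) (z : X) :
    Prop where
  mapsTo : MapsTo f D D
  continuousOn : ContinuousOn f D
  subset : A ⊆ D
  isOpen : IsOpen A
  back : ∀ x ∈ D, f x ∈ A → x ∈ A
  shrink : ∀ N ∈ 𝓝 z, ∃ m, ∀ k ≥ m, ∀ x ∈ D \ A, f^[k] x ∈ N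
  mem : z ∈ D
  fixed : f z = z
  compl_mem : Aᶜ ∈ 𝓝 z

/-- The histories all of whose points are in `D`. -/
def historiesIn {X : Type*} (f : X → X) (D : Set X) : Set (ℕ → X) :=
  {w | w ∈ historySpace f ∧ ∀ i, w i ∈ D}

theorem iterate_history {X : Type*} {f : X → X} {w : ℕ → X} (hw : w ∈ historySpace f) (i k : ℕ) :
    f^[k] (w (i + k)) = w i := by
  induction k with
  | zero => rfl
  | succ k ih => rw [Function.iterate_succ_apply, ← add_assoc, hw, ih]

theorem mapsTo_historyMap {X : Type*} {f : X → X} {D : Set X} (hf : MapsTo f D D) :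
    MapsTo (historyMap f) (historiesIn f D) (historiesIn f D) := by
  intro w hw
  refine ⟨fun i => ?_, fun i => ?_⟩
  · cases i with
    | zero => rfl
    | succ i => exact hw.1 i
  · cases i with
    | zero => exact hf (hw.2 0)
    | succ i => exact hw.2 i

open Classical in
/-- The map of histories induced by a map `h` which conjugates `f` to `g` near the boundary. -/
def historyConj {X Y : Type*} (g : Y → Y) (A : Set X) (h : X → Y) (y : Y) (w : ℕ → X) (i : ℕ) : Y :=
  if hj : ∃ j, w (i + j) ∈ A then g^[Nat.find hj] (h (w (i + Nat.find hj))) else y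

theorem historyConj_of_forall_notMem {X Y : Type*} {g : Y → Y} {A : Set X} {h : X → Y} {y : Y}
    {w : ℕ → X} {i : ℕ} (hw : ∀ j, w (i + j) ∉ A) :
    historyConj g A h y w i = y := by
  rw [historyConj, dif_neg]
  push Not
  exact hw

section
variable {X Y : Type*} [TopologicalSpace X] [TopologicalSpace Y]
  {f : X → X} {D A : Set X} {z : X} {g : Y → Y} {E B : Set Y} {y : Y}

/-- The point `w i` is the image under `f^[k]` of `w (i + k)`, which lies outside `A`; these images
shrink to `z` as `k` grows. -/
theorem IsBackwardInvariant.eq_const [T1Space X] (hA : IsBackwardInvariant f D A z) {w : ℕ → X}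
    (hw : w ∈ historiesIn f D) {i : ℕ} (h : ∀ j, w (i + j) ∉ A) : w i = z := by
  by_contra hne
  obtain ⟨N, hN, hwN⟩ : ∃ N ∈ 𝓝 z, w i ∉ N :=
    ⟨{w i}ᶜ, isOpen_compl_singleton.mem_nhds (fun h => hne h.symm), by simp⟩
  obtain ⟨m, hm⟩ := hA.shrink N hN
  have := hm m le_rfl (w (i + m)) ⟨hw.2 _, h m⟩
  rw [iterate_history hw.1] at this
  exact hwN this

/-- `h` maps `A` homeomorphically onto `B`, with inverse `h'`, and conjugates `f` to `g`. -/
structure IsConjOn (f : X → X) (D A : Set X) (g : Y → Y) (E B : Set Y) (h : X → Y) (h' : Y → X) :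
    Prop where
  continuousOn : ContinuousOn h A
  continuousOn_inv : ContinuousOn h' B
  mapsTo : MapsTo h A B
  mapsTo_inv : MapsTo h' B A
  left_inv : LeftInvOn h' h A
  right_inv : LeftInvOn h h' B
  conj : ∀ x ∈ D, f x ∈ A → h (f x) = g (h x)
  conj_inv : ∀ x ∈ E, g x ∈ B → h' (g x) = f (h' x)

variable {h : X → Y} {h' : Y → X}

theorem IsConjOn.symm (H : IsConjOn f D A g E B h h') : IsConjOn g E B f D A h' h where
  continuousOn := H.continuousOn_inv
  continuousOn_inv := H.continuousOn
  mapsTo := H.mapsTo_inv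
  mapsTo_inv := H.mapsTo
  left_inv := H.right_inv
  right_inv := H.left_inv
  conj := H.conj_inv
  conj_inv := H.conj

/-- Backward invariance keeps all deeper points of the history in `A`, and by the conjugacy going
one step deeper costs exactly one more iterate of `g`. So any entry index may replace the least one.
-/
theorem IsConjOn.historyConj_eq (hA : IsBackwardInvariant f D A z)
    (H : IsConjOn f D A g E B h h') {w : ℕ → X} (hw : w ∈ historiesIn f D) {i j : ℕ}
    (hj : w (i + j) ∈ A) : historyConj g A h y w i = g^[j] (h (w (i + j))) := by
  classical
  have key : ∀ k d, w (i + k) ∈ A → w (i + (k + d)) ∈ A ∧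
      g^[k + d] (h (w (i + (k + d)))) = g^[k] (h (w (i + k))) := by
    intro k d hk
    induction d with
    | zero => exact ⟨hk, rfl⟩
    | succ d ih =>
      have h1 := hw.1 (i + (k + d))
      have h2 : w (i + (k + d) + 1) ∈ A := hA.back _ (hw.2 _) (by rw [h1]; exact ih.1)
      refine ⟨h2, ?_⟩
      rw [← ih.2, ← add_assoc k, Function.iterate_succ_apply]
      have h3 := H.conj _ (hw.2 (i + (k + d) + 1)) (by rw [h1]; exact ih.1)
      rw [h1] at h3
      rw [h3]
      rfl
  have hex : ∃ j, w (i + j) ∈ A := ⟨j, hj⟩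
  rw [historyConj, dif_pos hex]
  obtain ⟨d, rfl⟩ := Nat.exists_eq_add_of_le (Nat.find_min' hex hj)
  exact ((key _ d (Nat.find_spec hex)).2).symm

theorem IsConjOn.mapsTo_historyConj (hA : IsBackwardInvariant f D A z)
    (hB : IsBackwardInvariant g E B y) (H : IsConjOn f D A g E B h h') :
    MapsTo (historyConj g A h y) (historiesIn f D) (historiesIn g E) := by
  intro w hw
  refine ⟨fun i => ?_, fun i => ?_⟩
  · by_cases hj : ∃ j, w (i + 1 + j) ∈ A
    · obtain ⟨j, hj⟩ := hj
      have hj' : w (i + (j + 1)) ∈ A := by rwa [add_comm j, ← add_assoc]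
      rw [H.historyConj_eq hA hw hj, H.historyConj_eq hA hw hj', Function.iterate_succ_apply',
        add_assoc, add_comm 1 j]
    · push Not at hj
      have hj' : ∀ j, w (i + j) ∉ A := by
        intro j hjA
        refine hj j ?_
        have h1 := hw.1 (i + j)
        have := hA.back _ (hw.2 (i + j + 1)) (by rwa [h1])
        rwa [add_assoc, add_comm 1 j]
      rw [historyConj_of_forall_notMem hj, historyConj_of_forall_notMem hj', hB.fixed]
  · by_cases hj : ∃ j, w (i + j) ∈ A
    · obtain ⟨j, hj⟩ := hj
      rw [H.historyConj_eq hA hw hj]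
      exact hB.mapsTo.iterate j (hB.subset (H.mapsTo hj))
    · push Not at hj
      rw [historyConj_of_forall_notMem hj]
      exact hB.mem

/-- At an index where the history is in `A`, the two maps act as `h` and then `h'`, which cancel;
iterating `f` brings the result forward. -/
theorem IsConjOn.historyConj_historyConj [T1Space X] (hA : IsBackwardInvariant f D A z)
    (hB : IsBackwardInvariant g E B y) (H : IsConjOn f D A g E B h h') {w : ℕ → X}
    (hw : w ∈ historiesIn f D) :
    historyConj f B h' z (historyConj g A h y w) = w := by
  have hw' := H.mapsTo_historyConj hA hB hw
  ext i
  by_cases hj : ∃ j, w (i + j) ∈ A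
  · obtain ⟨j, hj⟩ := hj
    have h1 : historyConj g A h y w (i + j) = h (w (i + j)) := by
      rw [H.historyConj_eq hA hw (i := i + j) (j := 0) (by exact hj)]
      rfl
    rw [H.symm.historyConj_eq hB hw' (i := i) (j := j) (by rw [h1]; exact H.mapsTo hj), h1,
      H.left_inv hj, iterate_history hw.1]
  · push Not at hj
    rw [hA.eq_const hw hj, historyConj_of_forall_notMem]
    intro j
    have : ∀ l, w (i + j + l) ∉ A := fun l => by rw [add_assoc]; exact hj _
    rw [historyConj_of_forall_notMem this]
    exact mem_of_mem_nhds hB.compl_mem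

theorem IsConjOn.historyConj_historyMap (hA : IsBackwardInvariant f D A z)
    (hB : IsBackwardInvariant g E B y) (H : IsConjOn f D A g E B h h') {w : ℕ → X}
    (hw : w ∈ historiesIn f D) :
    historyConj g A h y (historyMap f w) = historyMap g (historyConj g A h y w) := by
  have hw' := mapsTo_historyMap hA.mapsTo hw
  have key : ∀ i, historyConj g A h y (historyMap f w) (i + 1) = historyConj g A h y w i := by
    intro i
    by_cases hj : ∃ j, w (i + j) ∈ A
    · obtain ⟨j, hj⟩ := hj
      have h1 : historyMap f w (i + 1 + j) = w (i + j) := by rw [add_right_comm]; rfl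
      rw [H.historyConj_eq hA hw hj, H.historyConj_eq hA hw' (by rwa [h1]), h1]
    · push Not at hj
      rw [historyConj_of_forall_notMem hj, historyConj_of_forall_notMem]
      intro j
      rw [add_right_comm]
      exact hj j
  ext i
  cases i with
  | zero =>
    rw [← (H.mapsTo_historyConj hA hB hw').1 0, key]
    rfl
  | succ i => exact key i

theorem IsConjOn.continuousOn_historyConj [T1Space X] (hA : IsBackwardInvariant f D A z)
    (hB : IsBackwardInvariant g E B y) (H : IsConjOn f D A g E B h h') :
    ContinuousOn (historyConj g A h y) (historiesIn f D) := by
  classical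
  rw [continuousOn_pi]
  intro i w hw
  by_cases hj : ∃ j, w (i + j) ∈ A
  · obtain ⟨j, hj⟩ := hj
    have h1 : ContinuousOn (fun w : ℕ → X => g^[j] (h (w (i + j)))) {w | w (i + j) ∈ A} :=
      ((hB.continuousOn.iterate hB.mapsTo j).comp H.continuousOn
        (H.mapsTo.mono_right hB.subset)).comp (continuous_apply (i + j)).continuousOn
        fun w hw => hw
    have h2 : {w : ℕ → X | w (i + j) ∈ A} ∈ 𝓝 w :=
      (continuous_apply (i + j)).continuousAt.preimage_mem_nhds (hA.isOpen.mem_nhds hj)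
    refine ((h1.continuousAt h2).continuousWithinAt (s := historiesIn f D)).congr_of_eventuallyEq
      ?_ (H.historyConj_eq hA hw hj)
    filter_upwards [self_mem_nhdsWithin, mem_nhdsWithin_of_mem_nhds h2] with v hv hv'
    exact H.historyConj_eq hA hv hv'
  · push Not at hj
    rw [ContinuousWithinAt, historyConj_of_forall_notMem hj, tendsto_def]
    intro N hN
    -- Here `w` is constant equal to `z` from index `i` on. A nearby history `v` avoids `A` at the
    -- first `m + 1` of these indices, so it enters `A` only at some `j > m`, if at all.
    obtain ⟨m, hm⟩ := hB.shrink N hN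
    have hwz : ∀ l, w (i + l) = z := fun l =>
      hA.eq_const hw (i := i + l) fun j => by rw [add_assoc]; exact hj _
    have h1 : ∀ᶠ v in 𝓝 w, ∀ l ∈ Finset.range (m + 1), v (i + l) ∈ Aᶜ := by
      rw [Filter.eventually_all_finset]
      intro l _
      refine (continuous_apply (i + l)).continuousAt.preimage_mem_nhds ?_
      rw [hwz]
      exact hA.compl_mem
    filter_upwards [self_mem_nhdsWithin, mem_nhdsWithin_of_mem_nhds h1] with v hv hv'
    by_cases hvj : ∃ j, v (i + j) ∈ A
    · have h2 := Nat.find_spec hvj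
      have h3 := fun l (hl : l < Nat.find hvj) => Nat.find_min hvj hl
      set j := Nat.find hvj
      have hmj : m < j := by
        by_contra hle
        push Not at hle
        exact hv' j (Finset.mem_range.mpr (by omega)) h2
      obtain ⟨k, hk⟩ : ∃ k, j = k + 1 := ⟨j - 1, by omega⟩
      rw [mem_preimage, H.historyConj_eq hA hv h2, hk, Function.iterate_succ_apply]
      rw [hk] at h2 h3
      -- One application of `g` takes this point out of `B`; otherwise `v (i + k)` would be in `A`,
      -- against the minimality of `j = k + 1`. The remaining `k ≥ m` iterates then land in `N`.
      have h5 : h (v (i + (k + 1))) ∈ E := hB.subset (H.mapsTo h2)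
      refine hm k (by omega) _ ⟨hB.mapsTo h5, fun h4 => ?_⟩
      have h6 := H.conj_inv _ h5 h4
      rw [H.left_inv h2] at h6
      have h7 : f (v (i + (k + 1))) = v (i + k) := hv.1 (i + k)
      rw [h7] at h6
      exact h3 k (by omega) (by rw [← h6]; exact H.mapsTo_inv h4)
    · push Not at hvj
      rw [mem_preimage, historyConj_of_forall_notMem hvj]
      exact mem_of_mem_nhds hN

/-- Systems which are conjugate near the boundary of the basin have conjugate histories. -/
def IsConjOn.homeomorph [T1Space X] [T1Space Y] (hA : IsBackwardInvariant f D A z)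
    (hB : IsBackwardInvariant g E B y) (H : IsConjOn f D A g E B h h') :
    historiesIn f D ≃ₜ historiesIn g E where
  toFun := (H.mapsTo_historyConj hA hB).restrict _ _ _
  invFun := (H.symm.mapsTo_historyConj hB hA).restrict _ _ _
  left_inv w := Subtype.ext (H.historyConj_historyConj hA hB w.2)
  right_inv w := Subtype.ext (H.symm.historyConj_historyConj hB hA w.2)
  continuous_toFun := (H.continuousOn_historyConj hA hB).mapsToRestrict _
  continuous_invFun := (H.symm.continuousOn_historyConj hB hA).mapsToRestrict _

end

/-! ### The Blaschke model, the degree and the conjugacy of the basin -/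

/-- `ξ` maps `U` biholomorphically onto the unit disk, with inverse `g` and `ξ z = 0`. -/
structure IsRiemannMap (U : Set ℂ) (z : ℂ) (ξ g : ℂ → ℂ) : Prop where
  differentiableOn : DifferentiableOn ℂ ξ U
  differentiableOn_inv : DifferentiableOn ℂ g (ball 0 1)
  mapsTo : MapsTo ξ U (ball 0 1)
  mapsTo_inv : MapsTo g (ball 0 1) U
  left_inv : LeftInvOn g ξ U
  right_inv : LeftInvOn ξ g (ball 0 1)
  map_eq_zero : ξ z = 0

theorem exists_isRiemannMap_immediateBasin {p : ℂ[X]} {z : ℂ} (hp : 2 ≤ p.natDegree)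
    (hz : z ∈ interior (filledJuliaSet p)) : ∃ ξ g, IsRiemannMap (immediateBasin p z) z ξ g := by
  obtain ⟨ξ, g, h1, h2, h3, h4, h5, h6, h7⟩ := exists_riemannMap isOpen_immediateBasin
    isPreconnected_immediateBasin ((isBounded_filledJuliaSet hp).subset
      ((immediateBasin_subset hp hz).trans interior_subset))
    ((hasFullExhaustion_immediateBasin hp hz).hasSqrts isOpen_immediateBasin
      isPreconnected_immediateBasin (mem_immediateBasin hz)) (mem_immediateBasin hz)
  exact ⟨ξ, g, h1, h2, h3, h4, h5, h6, h7⟩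

section
variable {p : ℂ[X]} {z : ℂ} {ξ g : ℂ → ℂ}

/-- By properness the points that map into a compact disk form a compact subset of the basin, so in
the disk model they stay away from the circle. -/
theorem IsRiemannMap.isUnimodularAtBoundary (hp : 2 ≤ p.natDegree)
    (hz : z ∈ interior (filledJuliaSet p)) (hfix : p.eval z = z)
    (hξ : IsRiemannMap (immediateBasin p z) z ξ g) :
    IsUnimodularAtBoundary fun ζ => ξ (p.eval (g ζ)) := by
  have hp' := mapsTo_immediateBasin hp hz hfix
  rw [IsUnimodularAtBoundary, Metric.tendsto_nhds]
  intro ε hε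
  set ρ := 1 - min ε (1 / 2)
  have hρ : ρ < 1 := by
    have : 0 < min ε (1 / 2) := lt_min hε (by norm_num)
    linarith
  have hρε : 1 - ε ≤ ρ := by
    have := min_le_left ε (1 / 2)
    linarith
  have hsub : closedBall (0 : ℂ) ρ ⊆ ball 0 1 := closedBall_subset_ball hρ
  have hC : IsCompact (g '' closedBall 0 ρ) :=
    (isCompact_closedBall 0 ρ).image_of_continuousOn (hξ.differentiableOn_inv.continuousOn.mono hsub)
  have hCU : g '' closedBall 0 ρ ⊆ immediateBasin p z := (hξ.mapsTo_inv.mono_left hsub).image_subset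
  have hC' := isCompact_preimage_immediateBasin hp hz hC hCU
  have hξC := hC'.image_of_continuousOn (hξ.differentiableOn.continuousOn.mono inter_subset_left)
  obtain ⟨R, ⟨hR0, hR1⟩, hR⟩ := exists_pos_lt_subset_ball one_pos hξC.isClosed
    ((hξ.mapsTo.mono_left inter_subset_left).image_subset)
  filter_upwards [preimage_mem_comap (Ioo_mem_nhdsLT hR1)] with ζ hζ
  have hζ1 : ζ ∈ ball (0 : ℂ) 1 := mem_ball_zero_iff.mpr hζ.2
  have hgζ := hξ.mapsTo_inv hζ1
  have hB := hξ.mapsTo (hp' hgζ)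
  have h1 : ρ < ‖ξ (p.eval (g ζ))‖ := by
    by_contra h2
    push Not at h2
    have h3 : ξ (g ζ) ∈ ball (0 : ℂ) R :=
      hR ⟨g ζ, ⟨hgζ, _, mem_closedBall_zero_iff.mpr h2, hξ.left_inv (hp' hgζ)⟩, rfl⟩
    rw [hξ.right_inv hζ1, mem_ball_zero_iff] at h3
    exact absurd hζ.1 (not_lt.mpr h3.le)
  rw [mem_ball_zero_iff] at hB
  rw [Real.dist_eq, abs_lt]
  constructor
  · linarith
  · linarith

theorem IsRiemannMap.exists_blaschkeProduct (hp : 2 ≤ p.natDegree)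
    (hfix : p.eval z = z) (hattr : ‖(derivative p).eval z‖ < 1)
    (hξ : IsRiemannMap (immediateBasin p z) z ξ g) :
    ∃ s : Multiset ℂ, (∀ a ∈ s, ‖a‖ < 1) ∧ 0 ∈ s ∧ 2 ≤ s.card ∧ ∃ c : ℂ, ‖c‖ = 1 ∧
      ∀ x ∈ immediateBasin p z, ξ (p.eval x) = c * blaschkeProduct s (ξ x) := by
  have hz := mem_interior_filledJuliaSet hfix hattr
  have hzU := mem_immediateBasin hz
  have hp' := mapsTo_immediateBasin hp hz hfix
  have hd : DifferentiableOn ℂ (fun ζ => ξ (p.eval (g ζ))) (ball 0 1) :=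
    hξ.differentiableOn.comp (p.differentiable.comp_differentiableOn hξ.differentiableOn_inv)
      (hp'.comp hξ.mapsTo_inv)
  obtain ⟨s, hs, c, hc, hB⟩ := (hξ.isUnimodularAtBoundary hp hz hfix).exists_eq_blaschkeProduct hd
  have hB' : ∀ x ∈ immediateBasin p z, ξ (p.eval x) = c * blaschkeProduct s (ξ x) := by
    intro x hx
    rw [← hB _ (hξ.mapsTo hx), hξ.left_inv hx]
  have h0 : (0 : ℂ) ∈ s := by
    have h1 := hB' z hzU
    rw [hfix, hξ.map_eq_zero, eq_comm, mul_eq_zero] at h1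
    rcases h1 with h1 | h1
    · rw [h1, norm_zero] at hc
      exact absurd hc zero_ne_one
    · rw [blaschkeProduct, Multiset.prod_eq_zero_iff] at h1
      obtain ⟨a, ha, ha0⟩ := Multiset.mem_map.mp h1
      have : a = 0 := by simpa [blaschkeFactor] using ha0
      rwa [← this]
  refine ⟨s, hs, h0, ?_, c, hc, hB'⟩
  -- In degree one `p` preserves `‖ξ‖`, whereas orbits near `z` converge to `z`, where `ξ` vanishes.
  by_contra hcard
  obtain ⟨t, rfl⟩ := Multiset.exists_cons_of_mem h0
  rw [Multiset.card_cons] at hcard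
  have ht : t = 0 := by rw [← Multiset.card_eq_zero]; omega
  subst ht
  have hnorm : ∀ x ∈ immediateBasin p z, ‖ξ (p.eval x)‖ = ‖ξ x‖ := by
    intro x hx
    rw [hB' x hx, norm_mul, hc, one_mul, blaschkeProduct_cons, blaschkeFactor_zero]
    simp [blaschkeProduct]
  obtain ⟨r, hr, κ, hκ1, hκ0, hcontr⟩ := Polynomial.exists_contracting_ball hfix hattr
  have hU : immediateBasin p z ∩ ball z r ∈ 𝓝 z :=
    inter_mem (isOpen_immediateBasin.mem_nhds hzU) (ball_mem_nhds z hr)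
  obtain ⟨x, ⟨hxU, hxr⟩, hxz⟩ : ∃ x ∈ immediateBasin p z ∩ ball z r, x ≠ z := by
    have h1 : ∀ᶠ x in 𝓝[≠] z, x ∈ immediateBasin p z ∩ ball z r ∧ x ≠ z :=
      (eventually_mem_set.mpr (mem_nhdsWithin_of_mem_nhds hU)).and self_mem_nhdsWithin
    exact h1.exists
  have hit : ∀ k, (fun x => p.eval x)^[k] x ∈ immediateBasin p z ∧
      ‖ξ ((fun x => p.eval x)^[k] x)‖ = ‖ξ x‖ := by
    intro k
    induction k with
    | zero => exact ⟨hxU, rfl⟩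
    | succ k ih =>
      rw [Function.iterate_succ_apply']
      exact ⟨hp' ih.1, (hnorm _ ih.1).trans ih.2⟩
  have hlim : Tendsto (fun k => (fun x => p.eval x)^[k] x) atTop (𝓝 z) := by
    rw [tendsto_iff_dist_tendsto_zero]
    refine squeeze_zero (fun _ => dist_nonneg)
      (fun k => (dist_iterate_le_of_contracting hκ1 hκ0 hcontr hxr k).2) ?_
    simpa using (tendsto_pow_atTop_nhds_zero_of_lt_one hκ0 hκ1).mul_const (dist x z)
  have hξz : ContinuousAt ξ z :=
    hξ.differentiableOn.continuousOn.continuousAt (isOpen_immediateBasin.mem_nhds hzU)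
  have h1 := (hξz.tendsto.comp hlim).norm
  simp only [Function.comp_apply, (hit _).2, hξ.map_eq_zero, norm_zero] at h1
  have h2 : ‖ξ x‖ = 0 := tendsto_nhds_unique tendsto_const_nhds h1
  apply hxz
  rw [← hξ.left_inv hxU, norm_eq_zero.mp h2, ← hξ.map_eq_zero, hξ.left_inv hzU]

theorem eq_of_pow_mul_eventuallyEq {x : ℂ} {m k : ℕ} {u v : ℂ → ℂ} (hu : ContinuousAt u x)
    (hv : ContinuousAt v x) (hu0 : u x ≠ 0) (hv0 : v x ≠ 0)
    (h : ∀ᶠ y in 𝓝 x, (y - x) ^ m * u y = (y - x) ^ k * v y) : m = k := by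
  wlog hmk : m ≤ k generalizing m k u v
  · exact (this hv hu hv0 hu0 (h.mono fun _ => Eq.symm) (by omega)).symm
  obtain ⟨d, rfl⟩ := Nat.exists_eq_add_of_le hmk
  rcases Nat.eq_zero_or_pos d with rfl | hd
  · rfl
  exfalso
  apply hu0
  have h1 : ∀ᶠ y in 𝓝[≠] x, u y = (y - x) ^ d * v y := by
    filter_upwards [mem_nhdsWithin_of_mem_nhds h, self_mem_nhdsWithin] with y hy hyx
    rw [pow_add, mul_assoc] at hy
    exact mul_left_cancel₀ (pow_ne_zero m (sub_ne_zero.mpr hyx)) hy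
  have h2 : Tendsto (fun y => (y - x) ^ d * v y) (𝓝[≠] x) (𝓝 ((x - x) ^ d * v x)) :=
    ((by fun_prop : ContinuousAt (fun y => (y - x) ^ d * v y) x).tendsto).mono_left
      nhdsWithin_le_nhds
  have h3 := tendsto_nhds_unique (hu.tendsto.mono_left nhdsWithin_le_nhds)
    (h2.congr' (h1.mono fun _ => Eq.symm))
  rw [h3, sub_self, zero_pow hd.ne', zero_mul]

theorem IsRiemannMap.deriv_ne_zero {U : Set ℂ} (hU : IsOpen U) (hξ : IsRiemannMap U z ξ g) {x : ℂ}
    (hx : x ∈ U) : deriv ξ x ≠ 0 := by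
  have h1 := (hξ.differentiableOn.differentiableAt (hU.mem_nhds hx)).hasDerivAt
  have h2 := (hξ.differentiableOn_inv.differentiableAt
    (isOpen_ball.mem_nhds (hξ.mapsTo hx))).hasDerivAt
  have h3 : HasDerivAt (fun y => y) (deriv g (ξ x) * deriv ξ x) x := by
    refine (h2.comp x h1).congr_of_eventuallyEq ?_
    filter_upwards [hU.mem_nhds hx] with y hy
    exact (hξ.left_inv hy).symm
  intro h0
  rw [h0, mul_zero] at h3
  exact one_ne_zero ((hasDerivAt_id' x).unique h3)

theorem exists_eval_eq_pow_rootMultiplicity_mul {q : ℂ[X]} (hq : q ≠ 0) (x : ℂ) :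
    ∃ q₁ : ℂ[X], q₁.eval x ≠ 0 ∧
      ∀ y, q.eval y = (y - x) ^ q.rootMultiplicity x * q₁.eval y := by
  obtain ⟨q₁, h1, h2⟩ := exists_eq_pow_rootMultiplicity_mul_and_not_dvd q hq x
  refine ⟨q₁, fun h => h2 (dvd_iff_isRoot.mpr h), fun y => ?_⟩
  conv_lhs => rw [h1]
  simp

/-- The map `ξ` matches the solutions of `p x = w` in the basin with the roots of the Blaschke
polynomial for `ξ w`, all of which are in the disk. Multiplicities agree because the derivative of
`ξ` has no zeros. -/
theorem IsRiemannMap.hasDegreeOn (hp : 2 ≤ p.natDegree) (hz : z ∈ interior (filledJuliaSet p))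
    (hfix : p.eval z = z) (hξ : IsRiemannMap (immediateBasin p z) z ξ g) {s : Multiset ℂ}
    (hs : ∀ a ∈ s, ‖a‖ < 1) (hcard : 2 ≤ s.card) {c : ℂ} (hc : ‖c‖ = 1)
    (hB : ∀ x ∈ immediateBasin p z, ξ (p.eval x) = c * blaschkeProduct s (ξ x)) :
    HasDegreeOn p (immediateBasin p z) s.card := by
  classical
  have hp' := mapsTo_immediateBasin hp hz hfix
  have hopen : IsOpen (immediateBasin p z) := isOpen_immediateBasin
  refine ⟨hp', fun w hw => ?_⟩
  have hw1 : ‖ξ w‖ < 1 := mem_ball_zero_iff.mp (hξ.mapsTo hw)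
  set q := blaschkePolynomial s c (ξ w)
  have hqcard : q.roots.card = s.card := card_roots_blaschkePolynomial hs hc hw1
  have hq0 : q ≠ 0 := by
    intro h
    rw [h, roots_zero, Multiset.card_zero] at hqcard
    omega
  have hpw0 : p - C w ≠ 0 := by
    intro h
    rw [sub_eq_zero] at h
    rw [h, natDegree_C] at hp
    omega
  have hqξ : ∀ y ∈ immediateBasin p z, q.eval (ξ y) =
      (s.map fun a => 1 - (starRingEnd ℂ) a * ξ y).prod * (ξ (p.eval y) - ξ w) := by
    intro y hy
    rw [hB y hy]
    exact eval_blaschkePolynomial_of_norm_le hs c _ (mem_ball_zero_iff.mp (hξ.mapsTo hy)).le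
  have hmult : ∀ x ∈ immediateBasin p z, p.eval x = w →
      (p - C w).rootMultiplicity x = q.rootMultiplicity (ξ x) := by
    intro x hx hxw
    obtain ⟨p₁, hp₁, hpp₁⟩ := exists_eval_eq_pow_rootMultiplicity_mul hpw0 x
    obtain ⟨q₁, hq₁, hqq₁⟩ := exists_eval_eq_pow_rootMultiplicity_mul hq0 (ξ x)
    have hξx := hξ.differentiableOn.differentiableAt (hopen.mem_nhds hx)
    have hξw := hξ.differentiableOn.differentiableAt (hopen.mem_nhds hw)
    have c1 : ContinuousAt (dslope ξ x) x := continuousAt_dslope_same.mpr hξx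
    have c2 : ContinuousAt (fun y => dslope ξ w (p.eval y)) x := by
      refine ContinuousAt.comp ?_ p.continuous.continuousAt
      rw [hxw]
      exact continuousAt_dslope_same.mpr hξw
    have c3 : ContinuousAt (fun y => (s.map fun a => 1 - (starRingEnd ℂ) a * ξ y).prod) x :=
      tendsto_multiset_prod _ fun a _ =>
        continuousAt_const.sub (continuousAt_const.mul hξx.continuousAt)
    have c4 : ContinuousAt (fun y => q₁.eval (ξ y)) x :=
      (q₁.continuous.continuousAt).comp hξx.continuousAt
    -- Both sides compute the Blaschke polynomial at `ξ y`: once through `p y - w`, once through `ξ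
    -- y - ξ x`. The divided differences are nonzero at the base point, so the orders of vanishing
    -- can be compared.
    refine eq_of_pow_mul_eventuallyEq (x := x)
      (u := fun y => p₁.eval y * (dslope ξ w (p.eval y) *
        (s.map fun a => 1 - (starRingEnd ℂ) a * ξ y).prod))
      (v := fun y => dslope ξ x y ^ q.rootMultiplicity (ξ x) * q₁.eval (ξ y))
      (p₁.continuous.continuousAt.mul (c2.mul c3)) ((c1.pow _).mul c4) ?_ ?_ ?_
    · refine mul_ne_zero hp₁ (mul_ne_zero ?_ ?_)
      · rw [hxw, dslope_same]
        exact hξ.deriv_ne_zero hopen hw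
      · exact prod_one_sub_conj_mul_ne_zero hs (mem_ball_zero_iff.mp (hξ.mapsTo hx)).le
    · rw [dslope_same]
      exact mul_ne_zero (pow_ne_zero _ (hξ.deriv_ne_zero hopen hx)) hq₁
    · filter_upwards [hopen.mem_nhds hx] with y hy
      have h1 := hqξ y hy
      have h2 := sub_smul_dslope ξ w (p.eval y)
      have h3 := sub_smul_dslope ξ x y
      have h4 := hpp₁ y
      have h5 := hqq₁ (ξ y)
      rw [smul_eq_mul] at h2 h3
      rw [eval_sub, eval_C] at h4
      rw [← mul_assoc, ← h4, ← mul_assoc, ← mul_assoc, h2, ← mul_pow, h3, ← h5, h1, mul_comm]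
  rw [preimageCount]
  have hfin : ∀ x, x ∈ (Multiset.filter (· ∈ immediateBasin p z) (p - C w).roots).toFinset ↔
      p.eval x = w ∧ x ∈ immediateBasin p z := by
    intro x
    rw [Multiset.mem_toFinset, Multiset.mem_filter, mem_roots hpw0, IsRoot, eval_sub, eval_C,
      sub_eq_zero]
  have hfin' : ∀ ζ, ζ ∈ q.roots.toFinset ↔ q.eval ζ = 0 := by
    intro ζ
    rw [Multiset.mem_toFinset, mem_roots hq0, IsRoot]
  rw [Multiset.countP_eq_card_filter, ← Multiset.toFinset_sum_count_eq, ← hqcard,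
    ← Multiset.toFinset_sum_count_eq q.roots]
  refine Finset.sum_nbij' ξ g ?_ ?_ ?_ ?_ ?_
  · intro x hx
    obtain ⟨h1, h2⟩ := (hfin x).mp hx
    rw [hfin', hqξ x h2, h1, sub_self, mul_zero]
  · intro ζ hζ
    have h1 := (hfin' ζ).mp hζ
    have h2 := norm_lt_one_of_isRoot_blaschkePolynomial hs hc hw1 h1
    have h3 := mem_ball_zero_iff.mpr h2
    have h4 := hξ.mapsTo_inv h3
    have h5 := hqξ _ h4
    rw [hξ.right_inv h3, h1, zero_eq_mul] at h5
    rw [hfin]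
    refine ⟨?_, h4⟩
    have h6 := sub_eq_zero.mp (h5.resolve_left (prod_one_sub_conj_mul_ne_zero hs h2.le))
    exact hξ.left_inv.injOn (hp' h4) hw h6
  · intro x hx
    exact hξ.left_inv ((hfin x).mp hx).2
  · intro ζ hζ
    exact hξ.right_inv (mem_ball_zero_iff.mpr
      (norm_lt_one_of_isRoot_blaschkePolynomial hs hc hw1 ((hfin' ζ).mp hζ)))
  · intro x hx
    obtain ⟨h1, h2⟩ := (hfin x).mp hx
    rw [Multiset.count_filter_of_pos h2, count_roots, count_roots, hmult x h2 h1]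

end

theorem norm_blaschkeProduct_lt_one {s : Multiset ℂ} (hs : ∀ a ∈ s, ‖a‖ < 1) (h0 : s ≠ 0) {ζ : ℂ}
    (hζ : ‖ζ‖ < 1) : ‖blaschkeProduct s ζ‖ < 1 := by
  obtain ⟨a, ha⟩ := Multiset.exists_mem_of_ne_zero h0
  obtain ⟨t, rfl⟩ := Multiset.exists_cons_of_mem ha
  rw [blaschkeProduct_cons, norm_mul]
  have h1 := norm_blaschkeFactor_lt_one (hs a ha) hζ
  have h2 : ‖blaschkeProduct t ζ‖ ≤ 1 := by
    have := norm_blaschkeProduct_le_pow (s := t) (ζ := ζ) (τ := 1)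
      (fun b hb => (norm_blaschkeFactor_lt_one (hs b (Multiset.mem_cons_of_mem hb)) hζ).le)
      zero_le_one
    rwa [one_pow] at this
  exact (mul_le_of_le_one_right (norm_nonneg _) h2).trans_lt h1

/-- A Blaschke product of degree at least two which fixes `0` contracts smaller disks. -/
theorem exists_norm_blaschkeProduct_le {s : Multiset ℂ} (hs : ∀ a ∈ s, ‖a‖ < 1) (h0 : 0 ∈ s)
    (hcard : 2 ≤ s.card) {r : ℝ} (hr0 : 0 ≤ r) (hr : r < 1) :
    ∃ κ < 1, 0 ≤ κ ∧ ∀ ζ, ‖ζ‖ ≤ r → ‖blaschkeProduct s ζ‖ ≤ κ * ‖ζ‖ := by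
  obtain ⟨t, rfl⟩ := Multiset.exists_cons_of_mem h0
  rw [Multiset.card_cons] at hcard
  have ht : t ≠ 0 := by rw [← Multiset.card_pos]; omega
  have ht' : ∀ a ∈ t, ‖a‖ < 1 := fun b hb => hs b (Multiset.mem_cons_of_mem hb)
  have hcont : ContinuousOn (fun ζ => ‖blaschkeProduct t ζ‖) (closedBall 0 r) := fun ζ hζ =>
    ((differentiableAt_blaschkeProduct ht'
      ((mem_closedBall_zero_iff.mp hζ).trans hr.le)).continuousAt.norm).continuousWithinAt
  obtain ⟨ζ₀, hζ₀, hmax⟩ := (isCompact_closedBall (0 : ℂ) r).exists_isMaxOn ⟨0, by simpa⟩ hcont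
  refine ⟨‖blaschkeProduct t ζ₀‖, norm_blaschkeProduct_lt_one ht' ht
    ((mem_closedBall_zero_iff.mp hζ₀).trans_lt hr), norm_nonneg _, fun ζ hζ => ?_⟩
  rw [blaschkeProduct_cons, blaschkeFactor_zero, norm_mul, mul_comm]
  exact mul_le_mul_of_nonneg_right (hmax (mem_closedBall_zero_iff.mpr hζ)) (norm_nonneg _)

section
variable {p : ℂ[X]} {z : ℂ} {ξ g : ℂ → ℂ} {s : Multiset ℂ} {c : ℂ}

/-- Where `‖ξ‖ ≤ r`, the Blaschke model contracts by a uniform factor `κ < 1`. Hence such a point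
never maps into the outer annulus, and its iterates tend to `z` uniformly. -/
theorem IsRiemannMap.isBackwardInvariant (hp : 2 ≤ p.natDegree)
    (hz : z ∈ interior (filledJuliaSet p)) (hfix : p.eval z = z)
    (hξ : IsRiemannMap (immediateBasin p z) z ξ g)
    (hs : ∀ a ∈ s, ‖a‖ < 1) (h0 : 0 ∈ s) (hcard : 2 ≤ s.card) (hc : ‖c‖ = 1)
    (hB : ∀ x ∈ immediateBasin p z, ξ (p.eval x) = c * blaschkeProduct s (ξ x))
    {r : ℝ} (hr0 : 0 < r) (hr : r < 1) :
    IsBackwardInvariant (fun x => p.eval x) (immediateBasin p z)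
      (immediateBasin p z ∩ ξ ⁻¹' {ζ | r < ‖ζ‖}) z := by
  have hp' := mapsTo_immediateBasin hp hz hfix
  have hopen : IsOpen (immediateBasin p z) := isOpen_immediateBasin
  have hzU := mem_immediateBasin hz
  have hξc := hξ.differentiableOn.continuousOn
  obtain ⟨κ, hκ1, hκ0, hκ⟩ := exists_norm_blaschkeProduct_le hs h0 hcard hr0.le hr
  have hstep : ∀ x ∈ immediateBasin p z, ‖ξ x‖ ≤ r → ‖ξ (p.eval x)‖ ≤ κ * ‖ξ x‖ := by
    intro x hx hxr
    rw [hB x hx, norm_mul, hc, one_mul]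
    exact hκ _ hxr
  refine ⟨hp', p.continuous.continuousOn, inter_subset_left,
    hξc.isOpen_inter_preimage hopen (isOpen_lt continuous_const continuous_norm), ?_, ?_, hzU,
    hfix, ?_⟩
  · rintro x hx ⟨-, hx'⟩
    refine ⟨hx, ?_⟩
    by_contra hle
    simp only [mem_preimage, mem_ofPred_eq, not_lt] at hle hx'
    have := hstep x hx hle
    nlinarith [norm_nonneg (ξ x)]
  · intro N hN
    have hg0 : g 0 = z := by rw [← hξ.map_eq_zero, hξ.left_inv hzU]
    have hgc : ContinuousAt g 0 := hξ.differentiableOn_inv.continuousOn.continuousAt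
      (isOpen_ball.mem_nhds (mem_ball_self one_pos))
    have h1 : g ⁻¹' N ∈ 𝓝 0 := hgc.preimage_mem_nhds (by rwa [hg0])
    obtain ⟨ε, hε, hεN⟩ := Metric.mem_nhds_iff.mp h1
    obtain ⟨m, hm⟩ := exists_pow_lt_of_lt_one hε hκ1
    refine ⟨m, fun k hk x hx => ?_⟩
    have hxr : ‖ξ x‖ ≤ r := by
      by_contra h
      push Not at h
      exact hx.2 ⟨hx.1, h⟩
    have hit : ∀ k, (fun x => p.eval x)^[k] x ∈ immediateBasin p z ∧
        ‖ξ ((fun x => p.eval x)^[k] x)‖ ≤ κ ^ k * r := by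
      intro k
      induction k with
      | zero => exact ⟨hx.1, by simpa using hxr⟩
      | succ k ih =>
        rw [Function.iterate_succ_apply']
        refine ⟨hp' ih.1, ?_⟩
        have h2 : κ ^ k * r ≤ r := mul_le_of_le_one_left hr0.le (pow_le_one₀ hκ0 hκ1.le)
        refine (hstep _ ih.1 (ih.2.trans h2)).trans ?_
        rw [pow_succ', mul_assoc]
        exact mul_le_mul_of_nonneg_left ih.2 hκ0
    rw [← hξ.left_inv (hit k).1]
    apply hεN
    rw [mem_ball_zero_iff]
    have h3 : κ ^ k ≤ κ ^ m := pow_le_pow_of_le_one hκ0 hκ1.le hk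
    have h4 : κ ^ k * r ≤ κ ^ k := mul_le_of_le_one_right (pow_nonneg hκ0 k) hr.le
    linarith [(hit k).2]
  · have h1 : ContinuousAt (fun x => ‖ξ x‖) z := (hξc.continuousAt (hopen.mem_nhds hzU)).norm
    have h2 : ∀ᶠ x in 𝓝 z, ‖ξ x‖ < r := h1.eventually_lt_const (by simpa [hξ.map_eq_zero])
    filter_upwards [h2] with x hx
    rintro ⟨-, hx'⟩
    exact lt_asymm hx hx'

/-- The set is a round annulus seen through the conjugacy, so it is not round itself. The bound
`exists_norm_le` puts the rest of the disk into a disk of radius `ρ < 1`, where powers shrink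
uniformly, and `exists_norm_inv_le` keeps the set away from 0. -/
theorem IsBoundaryConjugacy.isBackwardInvariant {f : ℂ → ℂ} {n : ℕ} (hn : 2 ≤ n) {r : ℝ}
    {h h' : ℂ → ℂ} (H : IsBoundaryConjugacy f n r h h') :
    IsBackwardInvariant (fun ζ : ℂ => ζ ^ n) (ball 0 1)
      ({ζ | ζ ≠ 0 ∧ ‖ζ‖ < 1} ∩ h' ⁻¹' {ζ | r < ‖ζ‖}) 0 := by
  have hn0 : n ≠ 0 := by omega
  have hopen : IsOpen {ζ : ℂ | ζ ≠ 0 ∧ ‖ζ‖ < 1} :=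
    isOpen_ne.inter (isOpen_lt continuous_norm continuous_const)
  obtain ⟨ρ, hρ1, hρ0, hρ⟩ := H.exists_norm_le
  refine ⟨?_, (continuous_pow n).continuousOn, fun ζ hζ => mem_ball_zero_iff.mpr hζ.1.2,
    H.continuousOn_inv.isOpen_inter_preimage hopen (isOpen_lt continuous_const continuous_norm),
    ?_, ?_, mem_ball_self one_pos, zero_pow hn0, ?_⟩
  · intro ζ hζ
    rw [mem_ball_zero_iff] at hζ ⊢
    rw [norm_pow]
    exact pow_lt_one₀ (norm_nonneg _) hζ hn0
  · rintro ζ hζ ⟨⟨h1, -⟩, h2⟩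
    have h0 : ζ ≠ 0 := fun h0 => h1 (by simp only [h0, zero_pow hn0])
    have h3 := mem_ball_zero_iff.mp hζ
    exact ⟨⟨h0, h3⟩, (H.conj_inv ζ h0 h3 h2).1⟩
  · intro N hN
    obtain ⟨ε, hε, hεN⟩ := Metric.mem_nhds_iff.mp hN
    obtain ⟨m, hm⟩ := exists_pow_lt_of_lt_one hε hρ1
    refine ⟨m, fun k hk ζ hζ => ?_⟩
    have hζρ : ‖ζ‖ ≤ ρ := by
      by_cases h0 : ζ = 0
      · rwa [h0, norm_zero]
      · have h1 := mem_ball_zero_iff.mp hζ.1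
        refine hρ ζ h0 h1 ?_
        by_contra h2
        push Not at h2
        exact hζ.2 ⟨⟨h0, h1⟩, h2⟩
    have hit : ∀ k, ‖(fun ζ : ℂ => ζ ^ n)^[k] ζ‖ ≤ ρ ^ (k + 1) := by
      intro k
      induction k with
      | zero => simpa using hζρ
      | succ k ih =>
        rw [Function.iterate_succ_apply', norm_pow]
        refine (pow_le_pow_left₀ (norm_nonneg _) ih n).trans ?_
        rw [← pow_mul]
        exact pow_le_pow_of_le_one hρ0 hρ1.le (by nlinarith)
    apply hεN
    rw [mem_ball_zero_iff]
    exact (hit k).trans_lt ((pow_le_pow_of_le_one hρ0 hρ1.le (by omega)).trans_lt hm)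
  · obtain ⟨ε, hε, hεh⟩ := H.exists_norm_inv_le
    filter_upwards [ball_mem_nhds (0 : ℂ) hε] with ζ hζ
    rintro ⟨⟨h1, -⟩, h2⟩
    exact not_lt.mpr (hεh ζ h1 (mem_ball_zero_iff.mp hζ)) h2

theorem IsRiemannMap.isConjOn (hp : 2 ≤ p.natDegree)
    (hz : z ∈ interior (filledJuliaSet p)) (hfix : p.eval z = z)
    (hξ : IsRiemannMap (immediateBasin p z) z ξ g)
    (hB : ∀ x ∈ immediateBasin p z, ξ (p.eval x) = c * blaschkeProduct s (ξ x))
    {n : ℕ} {r : ℝ} {h h' : ℂ → ℂ}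
    (H : IsBoundaryConjugacy (fun ζ => c * blaschkeProduct s ζ) n r h h') :
    IsConjOn (fun x => p.eval x) (immediateBasin p z)
      (immediateBasin p z ∩ ξ ⁻¹' {ζ | r < ‖ζ‖}) (fun ζ : ℂ => ζ ^ n) (ball 0 1)
      ({ζ | ζ ≠ 0 ∧ ‖ζ‖ < 1} ∩ h' ⁻¹' {ζ | r < ‖ζ‖}) (fun x => h (ξ x)) (fun ζ => g (h' ζ)) := by
  have hp' := mapsTo_immediateBasin hp hz hfix
  have hξ' : ∀ x ∈ immediateBasin p z ∩ ξ ⁻¹' {ζ | r < ‖ζ‖}, ξ x ≠ 0 ∧ ‖ξ x‖ < 1 :=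
    fun x hx => ⟨norm_pos_iff.mp (H.pos.trans hx.2), mem_ball_zero_iff.mp (hξ.mapsTo hx.1)⟩
  have hg' : ∀ ζ ∈ {ζ | ζ ≠ 0 ∧ ‖ζ‖ < 1} ∩ h' ⁻¹' {ζ | r < ‖ζ‖}, h' ζ ∈ ball (0 : ℂ) 1 :=
    fun ζ hζ => mem_ball_zero_iff.mpr (H.mapsTo_inv ζ hζ.1.1 hζ.1.2).2
  refine ⟨?_, ?_, ?_, ?_, ?_, ?_, ?_, ?_⟩
  · exact H.continuousOn.comp (hξ.differentiableOn.continuousOn.mono inter_subset_left) hξ'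
  · exact hξ.differentiableOn_inv.continuousOn.comp (H.continuousOn_inv.mono inter_subset_left) hg'
  · intro x hx
    obtain ⟨h0, h1⟩ := hξ' x hx
    refine ⟨H.mapsTo _ h0 h1, ?_⟩
    rw [mem_preimage, H.left_inv _ h0 h1]
    exact hx.2
  · intro ζ hζ
    refine ⟨hξ.mapsTo_inv (hg' ζ hζ), ?_⟩
    rw [mem_preimage, hξ.right_inv (hg' ζ hζ)]
    exact hζ.2
  · intro x hx
    obtain ⟨h0, h1⟩ := hξ' x hx
    simp only [H.left_inv _ h0 h1]
    exact hξ.left_inv hx.1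
  · intro ζ hζ
    simp only [hξ.right_inv (hg' ζ hζ)]
    exact H.right_inv ζ hζ.1.1 hζ.1.2
  · intro x hx hx'
    have h2 := hx'.2
    rw [mem_preimage, hB x hx] at h2
    simp only [hB x hx]
    exact (H.conj _ (mem_ball_zero_iff.mp (hξ.mapsTo hx)) h2).2
  · rintro ζ hζ ⟨⟨h1, h1'⟩, h2⟩
    by_cases h0 : ζ = 0
    · subst h0
      rcases Nat.eq_zero_or_pos n with rfl | hn
      · simp at h1'
      · exact absurd (zero_pow hn.ne') h1
    · have hζ1 := mem_ball_zero_iff.mp hζ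
      have hh := mem_ball_zero_iff.mpr (H.mapsTo_inv ζ h0 hζ1).2
      have hgU := hξ.mapsTo_inv hh
      have h3 := hB _ hgU
      rw [hξ.right_inv hh] at h3
      simp only [(H.conj_inv ζ h0 hζ1 h2).2, ← h3]
      exact hξ.left_inv (hp' hgU)

end

/-- The histories in the immediate basin of an attracting fixed point are conjugate to the
histories in the unit disk under `ζ ↦ ζ ^ n`, where `n` is the degree of `p` on the basin. -/
theorem exists_homeomorph_historiesIn {p : ℂ[X]} {z : ℂ} (hp : 2 ≤ p.natDegree)
    (hfix : p.eval z = z) (hattr : ‖(derivative p).eval z‖ < 1) :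
    ∃ n, 2 ≤ n ∧ HasDegreeOn p (immediateBasin p z) n ∧
      ∃ hmaps : MapsTo (historyMap fun x => p.eval x)
          (historiesIn (fun x => p.eval x) (immediateBasin p z))
          (historiesIn (fun x => p.eval x) (immediateBasin p z)),
        ∃ ψ : historiesIn (fun x => p.eval x) (immediateBasin p z) ≃ₜ
          historiesIn (fun ζ : ℂ => ζ ^ n) (ball 0 1),
          (∀ w, (ψ (hmaps.restrict _ _ _ w) : ℕ → ℂ) =
            historyMap (fun ζ : ℂ => ζ ^ n) (ψ w : ℕ → ℂ)) ∧
          ∀ w : historiesIn (fun x => p.eval x) (immediateBasin p z),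
            (w : ℕ → ℂ) = (fun _ => z) ↔ (ψ w : ℕ → ℂ) = fun _ => 0 := by
  have hz := mem_interior_filledJuliaSet hfix hattr
  obtain ⟨ξ, g, hξ⟩ := exists_isRiemannMap_immediateBasin hp hz
  obtain ⟨s, hs, h0, hcard, c, hc, hB⟩ := hξ.exists_blaschkeProduct hp hfix hattr
  obtain ⟨P, T, δ, M, hδ, hP⟩ := exists_isStripLift_of_zero_mem hs h0 hcard hc
  obtain ⟨r, h, h', H⟩ := hP.exists_isBoundaryConjugacy
    (fun ζ hζ => by rw [norm_mul, hc, one_mul, norm_blaschkeProduct_eq_one hs hζ]) hδ hcard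
    (fun ζ hζ => ((differentiableAt_blaschkeProduct hs
      (mem_ball_zero_iff.mp hζ).le).const_mul c).differentiableWithinAt)
  have hA := hξ.isBackwardInvariant hp hz hfix hs h0 hcard hc hB H.pos H.lt_one
  have hA' := H.isBackwardInvariant hcard
  have hH := hξ.isConjOn hp hz hfix hB H
  have hψz : historyConj (fun ζ : ℂ => ζ ^ s.card) (immediateBasin p z ∩ ξ ⁻¹' {ζ | r < ‖ζ‖})
      (fun x => h (ξ x)) 0 (fun _ => z) = fun _ => 0 := by
    ext i
    exact historyConj_of_forall_notMem fun j => mem_of_mem_nhds hA.compl_mem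
  have hzmem : (fun _ => z) ∈ historiesIn (fun x => p.eval x) (immediateBasin p z) :=
    ⟨fun _ => hfix, fun _ => mem_immediateBasin hz⟩
  refine ⟨s.card, hcard, hξ.hasDegreeOn hp hz hfix hs hcard hc hB, mapsTo_historyMap hA.mapsTo,
    hH.homeomorph hA hA', fun w => hH.historyConj_historyMap hA hA' w.2, fun w => ⟨?_, ?_⟩⟩
  · intro hw
    rw [← hψz, ← hw]
    rfl
  · intro hw
    have : hH.homeomorph hA hA' w = hH.homeomorph hA hA' ⟨_, hzmem⟩ :=
      Subtype.ext (hw.trans hψz.symm)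
    exact congrArg Subtype.val ((hH.homeomorph hA hA').injective this)

/-! ### Histories of the power map as a cone over the solenoid -/

theorem history_pow_eq {n : ℕ} {w : ℕ → ℂ} (hw : w ∈ historySpace fun ζ : ℂ => ζ ^ n) (i : ℕ) :
    w i ^ n ^ i = w 0 := by
  induction i with
  | zero => simp
  | succ i ih => rw [pow_succ', pow_mul, show w (i + 1) ^ n = w i from hw i, ih]

theorem historiesIn_ball_eq_diskHistories (n : ℕ) :
    historiesIn (fun ζ : ℂ => ζ ^ n) (ball 0 1) = diskHistories n := by
  ext w
  refine ⟨fun h => ⟨h.1, h.2 0⟩, fun h => ⟨h.1, fun i => ?_⟩⟩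
  have h1 := h.2
  rw [← history_pow_eq h.1 i, mem_ball_zero_iff, norm_pow] at h1
  rw [mem_ball_zero_iff]
  by_contra h2
  push Not at h2
  exact absurd (one_le_pow₀ h2) (not_le.mpr h1)

/-- The action of `t ≥ 0` on histories which multiplies the point with index `0` by `t`. -/
def scaleHistory (n : ℕ) (t : ℝ) (w : ℕ → ℂ) (i : ℕ) : ℂ := (t ^ ((n : ℝ) ^ i)⁻¹ : ℝ) * w i

theorem rpow_inv_pow_succ {n : ℕ} (hn : 2 ≤ n) {t : ℝ} (ht : 0 ≤ t) (i : ℕ) :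
    (t ^ ((n : ℝ) ^ (i + 1))⁻¹) ^ n = t ^ ((n : ℝ) ^ i)⁻¹ := by
  have hn0 : (n : ℝ) ≠ 0 := by
    have : n ≠ 0 := by omega
    exact_mod_cast this
  rw [← Real.rpow_mul_natCast ht]
  congr 1
  rw [pow_succ]
  field_simp

theorem scaleHistory_mem {n : ℕ} (hn : 2 ≤ n) {t : ℝ} (ht : 0 ≤ t) {w : ℕ → ℂ}
    (hw : w ∈ historySpace fun ζ : ℂ => ζ ^ n) :
    scaleHistory n t w ∈ historySpace fun ζ : ℂ => ζ ^ n := by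
  intro i
  show ((t ^ ((n : ℝ) ^ (i + 1))⁻¹ : ℝ) * w (i + 1) : ℂ) ^ n = _
  rw [mul_pow, ← ofReal_pow, rpow_inv_pow_succ hn ht]
  have := hw i
  simp only at this
  rw [this]
  rfl

theorem scaleHistory_zero_index (n : ℕ) (t : ℝ) (w : ℕ → ℂ) : scaleHistory n t w 0 = t * w 0 := by
  simp [scaleHistory]

theorem continuous_scaleHistory (n : ℕ) :
    Continuous fun q : ℝ × (ℕ → ℂ) => scaleHistory n q.1 q.2 := by
  refine continuous_pi fun i => ?_
  have h1 : Continuous fun t : ℝ => t ^ ((n : ℝ) ^ i)⁻¹ :=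
    Real.continuous_rpow_const (by positivity)
  exact (continuous_ofReal.comp (h1.comp continuous_fst)).mul
    ((continuous_apply i).comp continuous_snd)

theorem scaleHistory_zero {n : ℕ} (hn : 2 ≤ n) (w : ℕ → ℂ) :
    scaleHistory n 0 w = fun _ => 0 := by
  have hn0 : (n : ℝ) ≠ 0 := by
    have : n ≠ 0 := by omega
    exact_mod_cast this
  ext i
  rw [scaleHistory, Real.zero_rpow (inv_ne_zero (pow_ne_zero i hn0)), ofReal_zero, zero_mul]

theorem scaleHistory_one (n : ℕ) (w : ℕ → ℂ) : scaleHistory n 1 w = w := by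
  ext i
  rw [scaleHistory, Real.one_rpow, ofReal_one, one_mul]

/-- The histories of the points of a disk about `0` are connected. -/
theorem isPreconnected_historiesOver_ball {n : ℕ} (hn : 2 ≤ n) (ε : ℝ) :
    IsPreconnected (historiesOver (fun ζ : ℂ => ζ ^ n) (ball 0 ε)) := by
  rcases le_or_gt ε 0 with hε | hε
  · rw [ball_eq_empty.mpr hε]
    have : historiesOver (fun ζ : ℂ => ζ ^ n) ∅ = ∅ := by
      ext w
      exact ⟨fun h => h.2, fun h => h.elim⟩
    rw [this]
    exact isPreconnected_empty
  refine isPreconnected_of_forall (fun _ => 0) fun w hw => ?_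
  have hc : Continuous fun t : ℝ => scaleHistory n t w :=
    (continuous_scaleHistory n).comp (Continuous.prodMk_left w)
  refine ⟨(fun t : ℝ => scaleHistory n t w) '' Icc 0 1, ?_,
    ⟨0, left_mem_Icc.mpr zero_le_one, scaleHistory_zero hn w⟩,
    ⟨1, right_mem_Icc.mpr zero_le_one, scaleHistory_one n w⟩,
    isPreconnected_Icc.image _ hc.continuousOn⟩
  rintro _ ⟨t, ht, rfl⟩
  refine ⟨scaleHistory_mem hn ht.1 hw.1, ?_⟩
  have h1 := mem_ball_zero_iff.mp hw.2
  rw [mem_ball_zero_iff]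
  show ‖scaleHistory n t w 0‖ < ε
  rw [scaleHistory_zero_index, norm_mul, norm_real, Real.norm_of_nonneg ht.1]
  exact (mul_le_of_le_one_left (norm_nonneg _) ht.2).trans_lt h1

theorem norm_history {n : ℕ} (hn : 2 ≤ n) {w : ℕ → ℂ} (hw : w ∈ historySpace fun ζ : ℂ => ζ ^ n)
    (i : ℕ) : ‖w i‖ = ‖w 0‖ ^ ((n : ℝ) ^ i)⁻¹ := by
  have hn0 : n ^ i ≠ 0 := pow_ne_zero i (by omega)
  rw [← history_pow_eq hw i, norm_pow, ← Nat.cast_pow, Real.pow_rpow_inv_natCast (norm_nonneg _) hn0]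

theorem isClosed_historySpace {X : Type*} [TopologicalSpace X] [T2Space X] {f : X → X}
    (hf : Continuous f) : IsClosed (historySpace f) := by
  have : historySpace f = ⋂ i, {w | f (w (i + 1)) = w i} := by
    ext w
    simp [historySpace]
  rw [this]
  exact isClosed_iInter fun i =>
    isClosed_eq (hf.comp (continuous_apply _)) (continuous_apply i)

instance (n : ℕ) : CompactSpace (solenoid n) :=
  isCompact_iff_compactSpace.mp (isClosed_historySpace (continuous_pow n)).isCompact

theorem coe_mem_historySpace {n : ℕ} (s : solenoid n) :
    (fun i => ((s : ℕ → Circle) i : ℂ)) ∈ historySpace fun ζ : ℂ => ζ ^ n := by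
  intro i
  have := s.2 i
  simp only at this ⊢
  rw [← this, Circle.coe_pow]

/-- Polar coordinates for the histories of points of the disk. -/
def polarHistory (n : ℕ) (hn : 2 ≤ n) (q : solenoid n × Ico (0 : ℝ) 1) : diskHistories n :=
  ⟨scaleHistory n q.2 fun i => ((q.1 : ℕ → Circle) i : ℂ),
    scaleHistory_mem hn q.2.2.1 (coe_mem_historySpace q.1), by
      rw [scaleHistory_zero_index, mem_ball_zero_iff, norm_mul, Circle.norm_coe, mul_one,
        norm_real, Real.norm_of_nonneg q.2.2.1]
      exact q.2.2.2⟩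

theorem norm_polarHistory {n : ℕ} (hn : 2 ≤ n) (q : solenoid n × Ico (0 : ℝ) 1) :
    ‖(polarHistory n hn q : ℕ → ℂ) 0‖ = q.2 := by
  show ‖scaleHistory n q.2 (fun i => ((q.1 : ℕ → Circle) i : ℂ)) 0‖ = _
  rw [scaleHistory_zero_index, norm_mul, Circle.norm_coe, mul_one,
    norm_real, Real.norm_of_nonneg q.2.2.1]

theorem continuous_polarHistory {n : ℕ} (hn : 2 ≤ n) : Continuous (polarHistory n hn) := by
  refine Continuous.subtype_mk ((continuous_scaleHistory n).comp
    ((continuous_subtype_val.comp continuous_snd).prodMk (continuous_pi fun i => ?_))) _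
  have h : Continuous fun q : solenoid n × Ico (0 : ℝ) 1 => (q.1 : ℕ → Circle) i :=
    (continuous_apply i).comp (continuous_subtype_val.comp continuous_fst)
  fun_prop

/-- The modulus of the last point recovers the radius, and the projection along the compact solenoid
is proper. Properness makes the continuous bijection from the quotient a homeomorphism. -/
theorem isProperMap_polarHistory {n : ℕ} (hn : 2 ≤ n) : IsProperMap (polarHistory n hn) := by
  let ν : diskHistories n → Ico (0 : ℝ) 1 := fun w =>
    ⟨‖(w : ℕ → ℂ) 0‖, norm_nonneg _, mem_ball_zero_iff.mp w.2.2⟩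
  have hν : Continuous ν := Continuous.subtype_mk
    (((continuous_apply 0).comp continuous_subtype_val).norm) _
  refine isProperMap_of_comp_of_t2 (continuous_polarHistory hn) hν ?_
  have : ν ∘ polarHistory n hn = Prod.snd := by
    ext q
    exact norm_polarHistory hn q
  rw [this]
  exact isProperMap_snd_of_compactSpace

theorem surjective_polarHistory {n : ℕ} (hn : 2 ≤ n) : Function.Surjective (polarHistory n hn) := by
  rintro ⟨w, hw, hw1⟩
  rw [mem_ball_zero_iff] at hw1
  by_cases h0 : w 0 = 0
  · refine ⟨(⟨fun _ => 1, fun _ => one_pow n⟩, ⟨0, le_rfl, one_pos⟩), Subtype.ext ?_⟩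
    show scaleHistory n 0 _ = w
    rw [scaleHistory_zero hn]
    ext i
    have := history_pow_eq hw i
    rw [h0] at this
    exact (pow_eq_zero_iff (pow_ne_zero i (by omega))).mp this |>.symm
  · have hwi : ∀ i, w i ≠ 0 := fun i hi => h0 (by
      rw [← history_pow_eq hw i, hi, zero_pow (pow_ne_zero i (by omega))])
    have hnorm : ∀ i, ‖w i / ‖w i‖‖ = 1 := fun i => by
      rw [norm_div, norm_real, norm_norm, div_self (norm_ne_zero_iff.mpr (hwi i))]
    let s : ℕ → Circle := fun i => ⟨w i / ‖w i‖, mem_sphere_zero_iff_norm.mpr (hnorm i)⟩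
    have hs : s ∈ solenoid n := by
      intro i
      apply Circle.ext
      rw [Circle.coe_pow]
      show (w (i + 1) / ‖w (i + 1)‖) ^ n = w i / ‖w i‖
      have := hw i
      simp only at this
      rw [div_pow, this, ← ofReal_pow, ← norm_pow, this]
    refine ⟨(⟨s, hs⟩, ⟨‖w 0‖, norm_nonneg _, hw1⟩), Subtype.ext ?_⟩
    ext i
    show ((‖w 0‖ ^ ((n : ℝ) ^ i)⁻¹ : ℝ) : ℂ) * (w i / ‖w i‖) = w i
    rw [← norm_history hn hw, mul_div_cancel₀]
    exact_mod_cast norm_ne_zero_iff.mpr (hwi i)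

theorem polarHistory_eq_iff {n : ℕ} (hn : 2 ≤ n) (q q' : solenoid n × Ico (0 : ℝ) 1) :
    polarHistory n hn q = polarHistory n hn q' ↔ coneSetoid (solenoid n) q q' := by
  constructor
  · intro h
    have h2 : (q.2 : ℝ) = q'.2 := by
      rw [← norm_polarHistory hn q, h, norm_polarHistory hn q']
    by_cases h0 : (q.2 : ℝ) = 0
    · exact Or.inr ⟨h0, by rw [← h2, h0]⟩
    · left
      refine Prod.ext (Subtype.ext (funext fun i => Circle.ext ?_)) (Subtype.ext h2)
      have h3 := congrFun (congrArg Subtype.val h) i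
      simp only [polarHistory, scaleHistory] at h3
      rw [← h2] at h3
      refine mul_left_cancel₀ ?_ h3
      rw [ofReal_ne_zero]
      exact (Real.rpow_pos_of_pos (lt_of_le_of_ne q.2.2.1 (Ne.symm h0)) _).ne'
  · rintro (h | ⟨h, h'⟩)
    · rw [h]
    · apply Subtype.ext
      simp only [polarHistory]
      rw [h, h', scaleHistory_zero hn, scaleHistory_zero hn]

/-- The histories of the points of the disk form the open cone over the solenoid. -/
theorem exists_openCone_homeomorph {n : ℕ} (hn : 2 ≤ n) :
    ∃ φ : OpenCone (solenoid n) ≃ₜ diskHistories n,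
      ∀ s : solenoid n, (φ (OpenCone.apex s) : ℕ → ℂ) = fun _ => 0 := by
  let F : OpenCone (solenoid n) → diskHistories n :=
    Quotient.lift (polarHistory n hn) fun a b h => (polarHistory_eq_iff hn a b).mpr h
  have hF : ∀ q, F (Quotient.mk _ q) = polarHistory n hn q := fun q => rfl
  have hFc : Continuous F := (continuous_polarHistory hn).quotient_lift _
  have hinj : Function.Injective F := by
    intro a b
    induction a using Quotient.inductionOn
    induction b using Quotient.inductionOn
    intro h
    exact Quotient.sound ((polarHistory_eq_iff hn _ _).mp h)
  have hsurj : Function.Surjective F := fun w => by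
    obtain ⟨q, hq⟩ := surjective_polarHistory hn w
    exact ⟨Quotient.mk _ q, hq⟩
  have hclosed : IsClosedMap F := by
    intro S hS
    have : F '' S = polarHistory n hn '' ((Quotient.mk _) ⁻¹' S) := by
      ext w
      constructor
      · rintro ⟨a, ha, rfl⟩
        induction a using Quotient.inductionOn with
        | h q => exact ⟨q, ha, rfl⟩
      · rintro ⟨q, hq, rfl⟩
        exact ⟨_, hq, rfl⟩
    rw [this]
    exact (isProperMap_polarHistory hn).isClosedMap _ (hS.preimage continuous_quotient_mk')
  refine ⟨(Equiv.ofBijective F ⟨hinj, hsurj⟩).toHomeomorphOfContinuousClosed hFc hclosed,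
    fun s => ?_⟩
  exact scaleHistory_zero hn _

/-! ### Local connectedness and the failure of a lamination structure -/

/-- `x` has arbitrarily small preconnected neighborhoods. -/
def IsConnectedImKleinen {X : Type*} [TopologicalSpace X] (x : X) : Prop :=
  ∀ U ∈ 𝓝 x, ∃ V ∈ 𝓝 x, V ⊆ U ∧ IsPreconnected V

section
variable {X Y : Type*} [TopologicalSpace X] [TopologicalSpace Y]

theorem IsConnectedImKleinen.map_openPartialHomeomorph {x : X} (h : IsConnectedImKleinen x)
    (e : OpenPartialHomeomorph X Y) (hx : x ∈ e.source) : IsConnectedImKleinen (e x) := by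
  intro U hU
  obtain ⟨V, hV, hVU, hVc⟩ := h (e.source ∩ e ⁻¹' U)
    (inter_mem (e.open_source.mem_nhds hx) ((e.continuousAt hx).preimage_mem_nhds hU))
  refine ⟨e '' V, e.image_mem_nhds hx hV, ?_,
    hVc.image _ (e.continuousOn.mono (hVU.trans inter_subset_left))⟩
  rintro _ ⟨y, hy, rfl⟩
  exact (hVU hy).2

theorem isConnectedImKleinen_iff_of_isEmbedding {j : X → Y} (hj : IsEmbedding j) {x : X}
    (hr : range j ∈ 𝓝 (j x)) : IsConnectedImKleinen (j x) ↔ IsConnectedImKleinen x := by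
  have hmap : (𝓝 x).map j = 𝓝 (j x) := hj.map_nhds_of_mem x hr
  constructor
  · intro h U hU
    have hU' : j '' U ∈ 𝓝 (j x) := by
      rw [← hmap]
      exact image_mem_map hU
    obtain ⟨V, hV, hVU, hVc⟩ := h _ hU'
    refine ⟨j ⁻¹' V, hj.continuous.continuousAt.preimage_mem_nhds hV, ?_, ?_⟩
    · intro y hy
      obtain ⟨y', hy', he⟩ := hVU hy
      rwa [← hj.injective he]
    · rw [← hj.isInducing.isPreconnected_image,
        image_preimage_eq_of_subset (hVU.trans (image_subset_range j U))]
      exact hVc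
  · intro h U hU
    obtain ⟨V, hV, hVU, hVc⟩ := h _ (hj.continuous.continuousAt.preimage_mem_nhds hU)
    refine ⟨j '' V, ?_, image_subset_iff.mpr hVU, hVc.image _ hj.continuous.continuousOn⟩
    rw [← hmap]
    exact image_mem_map hV

/-- In a product with `ℂ`, the points of one leaf have the same local topology. -/
theorem IsConnectedImKleinen.exists_ne_of_chart {T : Type*} [TopologicalSpace T]
    (e : OpenPartialHomeomorph X (T × ℂ)) {x : X} (hx : x ∈ e.source)
    (h : IsConnectedImKleinen x) {O : Set X} (hO : O ∈ 𝓝 x) :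
    ∃ y ∈ O, y ≠ x ∧ IsConnectedImKleinen y := by
  have hex : e x ∈ e.target := e.map_source hx
  have h1 : e.target ∩ e.symm ⁻¹' O ∈ 𝓝 (e x) := by
    refine inter_mem (e.open_target.mem_nhds hex) ?_
    refine (e.continuousAt_symm hex).preimage_mem_nhds ?_
    rwa [e.left_inv hx]
  have hc : ContinuousAt (fun ζ : ℂ => ((e x).1, ζ)) (e x).2 := by fun_prop
  have h2 : ∀ᶠ ζ in 𝓝[≠] (e x).2, ((e x).1, ζ) ∈ e.target ∩ e.symm ⁻¹' O ∧ ζ ≠ (e x).2 :=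
    (eventually_mem_set.mpr (mem_nhdsWithin_of_mem_nhds (hc.preimage_mem_nhds h1))).and
      self_mem_nhdsWithin
  obtain ⟨ζ, ⟨hζt, hζO⟩, hζ⟩ := h2.exists
  refine ⟨e.symm ((e x).1, ζ), hζO, ?_, ?_⟩
  · intro he
    have := e.right_inv hζt
    rw [he] at this
    exact hζ (congrArg Prod.snd this).symm
  · let τ : T × ℂ ≃ₜ T × ℂ := (Homeomorph.refl T).prodCongr (Homeomorph.addRight (ζ - (e x).2))
    have h3 := (h.map_openPartialHomeomorph e hx).map_openPartialHomeomorph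
      τ.toOpenPartialHomeomorph (mem_univ _)
    have h4 : τ.toOpenPartialHomeomorph (e x) = ((e x).1, ζ) := by
      apply Prod.ext
      · rfl
      · show (e x).2 + (ζ - (e x).2) = ζ
        ring
    rw [h4] at h3
    exact h3.map_openPartialHomeomorph e.symm hζt

end

/-- The constant history `0` of the disk. -/
def zeroHistory (n : ℕ) (hn : 2 ≤ n) : diskHistories n :=
  ⟨fun _ => 0, fun _ => zero_pow (by omega), mem_ball_self one_pos⟩

/-- Since `‖w i‖` is a fixed positive power of `‖w 0‖`, bounds on `w 0` alone give a neighborhood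
base, and each such neighborhood is contracted to the zero history by scaling. -/
theorem isConnectedImKleinen_zeroHistory {n : ℕ} (hn : 2 ≤ n) :
    IsConnectedImKleinen (zeroHistory n hn) := by
  intro U hU
  let ν : diskHistories n → ℝ := fun w => ‖(w : ℕ → ℂ) 0‖
  have hν : Continuous ν := ((continuous_apply 0).comp continuous_subtype_val).norm
  have hle : comap ν (𝓝 0) ≤ 𝓝 (zeroHistory n hn) := by
    rw [nhds_subtype, ← map_le_iff_le_comap]
    show Tendsto (fun w : diskHistories n => (w : ℕ → ℂ)) (comap ν (𝓝 0)) (𝓝 fun _ => 0)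
    rw [tendsto_pi_nhds]
    intro i
    rw [tendsto_zero_iff_norm_tendsto_zero]
    have h1 : (fun w : diskHistories n => ‖(w : ℕ → ℂ) i‖) = fun w => ν w ^ ((n : ℝ) ^ i)⁻¹ :=
      funext fun w => norm_history hn w.2.1 i
    rw [h1]
    have h2 : ContinuousAt (fun t : ℝ => t ^ ((n : ℝ) ^ i)⁻¹) 0 :=
      (Real.continuous_rpow_const (by positivity)).continuousAt
    have hn0 : (n : ℝ) ≠ 0 := by
      have : n ≠ 0 := by omega
      exact_mod_cast this
    have h3 := h2.tendsto
    rw [Real.zero_rpow (inv_ne_zero (pow_ne_zero i hn0))] at h3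
    exact h3.comp tendsto_comap
  obtain ⟨S, hS, hSU⟩ := mem_comap.mp (hle hU)
  obtain ⟨ε, hε, hεS⟩ := Metric.mem_nhds_iff.mp hS
  refine ⟨ν ⁻¹' ball 0 (min ε 1), hν.continuousAt.preimage_mem_nhds ?_, ?_, ?_⟩
  · have h0 : ν (zeroHistory n hn) = 0 := norm_zero
    rw [h0]
    exact ball_mem_nhds 0 (lt_min hε one_pos)
  · exact (preimage_mono ((ball_subset_ball (min_le_left _ _)).trans hεS)).trans hSU
  · rw [← IsInducing.subtypeVal.isPreconnected_image]
    convert isPreconnected_historiesOver_ball hn (min ε 1) using 1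
    ext w
    constructor
    · rintro ⟨v, hv, rfl⟩
      refine ⟨v.2.1, mem_ball_zero_iff.mpr ?_⟩
      have := mem_ball_zero_iff.mp hv
      rwa [Real.norm_of_nonneg (norm_nonneg _)] at this
    · rintro ⟨h1, h2⟩
      refine ⟨⟨w, h1, ball_subset_ball (min_le_right _ _) h2⟩, mem_ball_zero_iff.mpr ?_, rfl⟩
      rw [Real.norm_of_nonneg (norm_nonneg _)]
      exact mem_ball_zero_iff.mp h2

theorem isPreconnected_eq_of_pow_eq_one {X : Type*} [TopologicalSpace X] {V : Set X}
    (hV : IsPreconnected V) {q : X → ℂ} (hq : ContinuousOn q V) {m : ℕ} (hm : 0 < m)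
    (h : ∀ v ∈ V, q v ^ m = 1) {v w : X} (hv : v ∈ V) (hw : w ∈ V) : q v = q w := by
  have hfin : {ζ : ℂ | ζ ^ m = 1}.Finite := by
    refine (nthRootsFinset m (1 : ℂ)).finite_toSet.subset fun ζ hζ => ?_
    exact (Polynomial.mem_nthRootsFinset hm (1 : ℂ)).mpr hζ
  exact hV.constant_of_mapsTo hfin.isDiscrete hq h hv hw

/-- The history `w`, with the point of index `i` rotated by `n ^ J / n ^ i` turns. -/
def rotateHistory (n J : ℕ) (w : ℕ → ℂ) (i : ℕ) : ℂ :=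
  w i * exp (2 * Real.pi * I * (n : ℂ) ^ J / (n : ℂ) ^ i)

/-- At indices up to `J` the rotation consists of whole turns. So the rotated histories converge to
the original one as `J` grows. -/
theorem rotateHistory_of_le {n J i : ℕ} (hn : n ≠ 0) (h : i ≤ J) (w : ℕ → ℂ) :
    rotateHistory n J w i = w i := by
  have hn0 : (n : ℂ) ≠ 0 := by exact_mod_cast hn
  obtain ⟨d, rfl⟩ := Nat.exists_eq_add_of_le h
  have : 2 * Real.pi * I * (n : ℂ) ^ (i + d) / (n : ℂ) ^ i =
      ((n ^ d : ℕ) : ℂ) * (2 * Real.pi * I) := by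
    rw [pow_add]
    field_simp
    push_cast
    ring
  rw [rotateHistory, this, exp_nat_mul_two_pi_mul_I, mul_one]

theorem rotateHistory_mem {n : ℕ} (hn : n ≠ 0) (J : ℕ) {w : ℕ → ℂ} (hw : w ∈ diskHistories n) :
    rotateHistory n J w ∈ diskHistories n := by
  have hn0 : (n : ℂ) ≠ 0 := by exact_mod_cast hn
  refine ⟨fun i => ?_, by rw [rotateHistory_of_le hn (Nat.zero_le _)]; exact hw.2⟩
  show rotateHistory n J w (i + 1) ^ n = _
  rw [rotateHistory, mul_pow, show w (i + 1) ^ n = w i from hw.1 i, ← exp_nat_mul, rotateHistory]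
  congr 2
  rw [pow_succ]
  field_simp

/-- A small connected neighborhood would contain some rotated history, which has the same `w 0` but
a different point at index `J + 1`. Over a slit disk of values of `w 0`, a root of unity
distinguishes the two continuously. -/
theorem not_isConnectedImKleinen_diskHistories {n : ℕ} (hn : 2 ≤ n) {w : diskHistories n}
    (hw : w ≠ zeroHistory n hn) : ¬ IsConnectedImKleinen w := by
  intro h
  obtain ⟨w, hwm⟩ := w
  have hn' : n ≠ 0 := by omega
  have hn0 : (n : ℂ) ≠ 0 := by exact_mod_cast hn'
  have hw0 : w 0 ≠ 0 := by
    intro h0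
    apply hw
    apply Subtype.ext
    ext i
    have := history_pow_eq hwm.1 i
    rw [h0] at this
    exact (pow_eq_zero_iff (pow_ne_zero i hn')).mp this
  have hwi : ∀ i, w i ≠ 0 := fun i hi => hw0 (by
    rw [← history_pow_eq hwm.1 i, hi, zero_pow (pow_ne_zero i hn')])
  have hev : ∀ i : ℕ, Continuous fun v : diskHistories n => (v : ℕ → ℂ) i :=
    fun i => (continuous_apply i).comp continuous_subtype_val
  have hslit : (fun v : diskHistories n => (v : ℕ → ℂ) 0 / w 0) ⁻¹' slitPlane ∈
      𝓝 (⟨w, hwm⟩ : diskHistories n) := by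
    refine ((hev 0).div_const _).continuousAt.preimage_mem_nhds (isOpen_slitPlane.mem_nhds ?_)
    simp only [div_self hw0]
    exact one_mem_slitPlane
  obtain ⟨V, hV, hVU, hVc⟩ := h _ hslit
  have hlim : Tendsto (fun J => (⟨rotateHistory n J w, rotateHistory_mem hn' J hwm⟩ :
      diskHistories n)) atTop (𝓝 ⟨w, hwm⟩) := by
    rw [tendsto_subtype_rng, tendsto_pi_nhds]
    intro i
    refine tendsto_const_nhds.congr' ?_
    filter_upwards [eventually_ge_atTop i] with J hJ
    exact (rotateHistory_of_le hn' hJ w).symm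
  obtain ⟨J, hJ⟩ := (hlim.eventually_mem hV).exists
  set m := n ^ (J + 1) with hm
  have hm0 : (m : ℂ) ≠ 0 := by exact_mod_cast pow_ne_zero _ hn'
  -- The quotient of two points of index `J + 1`, divided by the principal `m`-th root of the
  -- quotient of the points of index 0. It is an `m`-th root of unity, hence constant on `V`, but
  -- takes the values 1 and `exp (2πi / n)`.
  set q : diskHistories n → ℂ := fun v =>
    (v : ℕ → ℂ) (J + 1) / w (J + 1) * exp (-(log ((v : ℕ → ℂ) 0 / w 0) / m)) with hq
  have hqc : ContinuousOn q V := by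
    refine ((hev _).div_const _).continuousOn.mul (ContinuousOn.cexp (ContinuousOn.neg
      (ContinuousOn.div_const (ContinuousOn.clog ((hev 0).div_const _).continuousOn ?_) _)))
    exact hVU
  have hq1 : ∀ v ∈ V, q v ^ m = 1 := by
    intro v hv
    have h1 : (v : ℕ → ℂ) 0 / w 0 ≠ 0 := slitPlane_ne_zero (hVU hv)
    simp only [hq]
    rw [mul_pow, ← exp_nat_mul, div_pow, hm, history_pow_eq v.2.1, history_pow_eq hwm.1, ← hm,
      mul_neg, mul_div_cancel₀ _ hm0, exp_neg, exp_log h1, mul_inv_cancel₀ h1]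
  have h1 := isPreconnected_eq_of_pow_eq_one hVc hqc (by positivity) hq1 hJ (mem_of_mem_nhds hV)
  have h2 : q ⟨w, hwm⟩ = 1 := by
    simp only [hq]
    rw [div_self (hwi _), div_self hw0, log_one, zero_div, neg_zero, exp_zero, mul_one]
  have h3 : q ⟨rotateHistory n J w, rotateHistory_mem hn' J hwm⟩ =
      exp (2 * Real.pi * I / n) := by
    simp only [hq]
    rw [rotateHistory_of_le hn' (Nat.zero_le J), div_self hw0, log_one, zero_div, neg_zero, exp_zero,
      mul_one, rotateHistory, mul_div_cancel_left₀ _ (hwi _)]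
    congr 1
    rw [pow_succ]
    field_simp
  rw [h2, h3] at h1
  exact (isPrimitiveRoot_exp n hn').ne_one (by omega) h1

/-- A space with a neighborhood of a point which looks like a neighborhood of `0` in the space of
histories of the disk is not a Riemann surface lamination. -/
theorem not_isRiemannSurfaceLamination_of_isEmbedding {n : ℕ} (hn : 2 ≤ n) {X : Type}
    [TopologicalSpace X] {j : X → diskHistories n} (hj : IsEmbedding j) {x : X}
    (hx : j x = zeroHistory n hn) (hr : range j ∈ 𝓝 (j x)) : ¬ IsRiemannSurfaceLamination X := by
  rintro ⟨-, A, hA, -⟩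
  obtain ⟨c, -, hc⟩ := hA x
  have h1 : IsConnectedImKleinen x := by
    rw [← isConnectedImKleinen_iff_of_isEmbedding hj hr, hx]
    exact isConnectedImKleinen_zeroHistory hn
  -- Near `x` the image of `j` is still a neighborhood of `j y`, so the local topology at `y` is
  -- that of the disk histories at `j y`.
  have hO : {y | range j ∈ 𝓝 (j y)} ∈ 𝓝 x :=
    hj.continuous.continuousAt.eventually (eventually_mem_nhds_iff.mpr hr)
  obtain ⟨y, hyO, hyx, hy⟩ := h1.exists_ne_of_chart c.chart hc hO
  rw [← isConnectedImKleinen_iff_of_isEmbedding hj hyO] at hy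
  exact not_isConnectedImKleinen_diskHistories hn (fun h => hyx (hj.injective (h.trans hx.symm))) hy

/-! ### Assembling the result -/

theorem distinguishedComponent_eq_historiesIn {p : ℂ[X]} {z : ℂ} (hp : 2 ≤ p.natDegree)
    (hz : z ∈ interior (filledJuliaSet p)) (hfix : p.eval z = z) :
    distinguishedComponent p z = historiesIn (fun x => p.eval x) (immediateBasin p z) := by
  ext w
  exact mem_distinguishedComponent_iff hp hz hfix

/-- The coordinate of index `i` sends the connected component into a connected subset of `p^{-i}(Ω)`
containing `z`, which gives the inclusion not covered by the connectedness hypothesis. -/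
theorem distinguishedComponent_eq_connectedComponentIn {p : ℂ[X]} {z : ℂ}
    (hconn : IsPreconnected (distinguishedComponent p z))
    (hmem : (fun _ => z) ∈ distinguishedComponent p z) :
    distinguishedComponent p z =
      connectedComponentIn
        (historiesOver (fun x => p.eval x) (immediateBasin p z)) (fun _ => z) := by
  have hsub : distinguishedComponent p z ⊆
    historiesOver (fun x => p.eval x) (immediateBasin p z) := fun w hw => hw.1
  refine (hconn.subset_connectedComponentIn hmem hsub).antisymm fun w hw => ?_
  have hcsub := connectedComponentIn_subset
    (historiesOver (fun x => p.eval x) (immediateBasin p z)) (fun _ => z)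
  refine ⟨hcsub hw, fun i => ?_⟩
  have h1 : IsPreconnected ((fun w : ℕ → ℂ => w i) '' connectedComponentIn
      (historiesOver (fun x => p.eval x) (immediateBasin p z)) (fun _ => z)) :=
    isPreconnected_connectedComponentIn.image _ (continuous_apply i).continuousOn
  refine h1.subset_connectedComponentIn ⟨_, mem_connectedComponentIn (hsub hmem), rfl⟩ ?_ ⟨w, hw, rfl⟩
  rintro _ ⟨v, hv, rfl⟩
  have h2 := hcsub hv
  have h3 := iterate_history h2.1 0 i
  rw [zero_add] at h3
  rw [mem_preimage, h3]
  exact h2.2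

theorem proposition7p2 (p : Polynomial ℂ) (hp : 2 ≤ p.natDegree) (z : ℂ)
    (hfix : p.eval z = z) (hattr : ‖(Polynomial.derivative p).eval z‖ < 1) :
    -- the distinguished component is the connected component of the fixed history
    distinguishedComponent p z =
      connectedComponentIn
        (historiesOver (fun x => p.eval x) (immediateBasin p z)) (fun _ => z) ∧
    ∃ n : ℕ, 2 ≤ n ∧ HasDegreeOn p (immediateBasin p z) n ∧
      -- the conjugating homeomorphism
      (∃ hmaps : Set.MapsTo (historyMap fun x => p.eval x)
          (distinguishedComponent p z) (distinguishedComponent p z),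
        ∃ ψ : distinguishedComponent p z ≃ₜ diskHistories n,
          ∀ w : distinguishedComponent p z,
            (ψ (hmaps.restrict _ _ _ w) : ℕ → ℂ) =
              historyMap (fun ζ : ℂ => ζ ^ n) (ψ w : ℕ → ℂ)) ∧
      -- the component is a cone over a solenoid, with the fixed history as its cone point
      (∃ φ : OpenCone (solenoid n) ≃ₜ distinguishedComponent p z,
        ∀ s : solenoid n, (φ (OpenCone.apex s) : ℕ → ℂ) = fun _ => z) ∧
      -- no neighborhood of the fixed history in the component is a Riemann surface lamination
      ∀ N : Set (ℕ → ℂ), N ⊆ distinguishedComponent p z →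
        N ∈ 𝓝[distinguishedComponent p z] (fun _ => z) →
        ¬ IsRiemannSurfaceLamination N := by
  have hz := mem_interior_filledJuliaSet hfix hattr
  have heq := distinguishedComponent_eq_historiesIn hp hz hfix
  obtain ⟨n, hn, hdeg, hmaps, ψ, hψ, hψz⟩ := exists_homeomorph_historiesIn hp hfix hattr
  rw [← heq] at hmaps
  have hmem : (fun _ => z) ∈ distinguishedComponent p z := by
    rw [heq]
    exact ⟨fun _ => hfix, fun _ => mem_immediateBasin hz⟩
  obtain ⟨Ψ, hΨ, hΨz⟩ : ∃ Ψ : distinguishedComponent p z ≃ₜ diskHistories n,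
      (∀ w, (Ψ (hmaps.restrict _ _ _ w) : ℕ → ℂ) =
        historyMap (fun ζ : ℂ => ζ ^ n) (Ψ w : ℕ → ℂ)) ∧
      ∀ w : distinguishedComponent p z,
        (w : ℕ → ℂ) = (fun _ => z) ↔ (Ψ w : ℕ → ℂ) = fun _ => 0 :=
    ⟨((Homeomorph.setCongr heq).trans ψ).trans
      (Homeomorph.setCongr (historiesIn_ball_eq_diskHistories n)),
      fun w => hψ (Homeomorph.setCongr heq w), fun w => hψz (Homeomorph.setCongr heq w)⟩
  have hΨ0 : Ψ ⟨_, hmem⟩ = zeroHistory n hn := Subtype.ext ((hΨz ⟨_, hmem⟩).mp rfl)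
  -- Connectedness is carried over from the disk model, where every history shrinks to the zero
  -- history.
  have hconn : IsPreconnected (distinguishedComponent p z) := by
    have h1 : PreconnectedSpace (diskHistories n) :=
      Subtype.preconnectedSpace (isPreconnected_historiesOver_ball hn 1)
    have h2 : PreconnectedSpace (distinguishedComponent p z) :=
      Ψ.symm.surjective.denseRange.preconnectedSpace Ψ.symm.continuous
    exact isPreconnected_iff_preconnectedSpace.mpr h2
  obtain ⟨φ, hφ⟩ := exists_openCone_homeomorph hn
  refine ⟨distinguishedComponent_eq_connectedComponentIn hconn hmem, n, hn, hdeg,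
    ⟨hmaps, Ψ, hΨ⟩, ⟨φ.trans Ψ.symm, fun s => ?_⟩, fun N hN hNz => ?_⟩
  · rw [hΨz, Homeomorph.trans_apply, Homeomorph.apply_symm_apply]
    exact hφ s
  · have hzN : (fun _ => z) ∈ N := mem_of_mem_nhdsWithin hmem hNz
    have hincl : IsEmbedding (inclusion hN) := IsEmbedding.inclusion hN
    refine not_isRiemannSurfaceLamination_of_isEmbedding hn (x := ⟨_, hzN⟩)
      (Ψ.isEmbedding.comp hincl) hΨ0 ?_
    rw [range_comp, range_inclusion]
    refine Ψ.isOpenMap.image_mem_nhds ?_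
    rw [nhds_subtype]
    exact ⟨_, mem_nhdsWithin_iff_eventually.mp hNz, fun w hw => hw w.2⟩

end
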